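/- Let $m$ be Lebesgue measure on $(0,\infty)$; measurable functions are real-valued and identified when equal a.e. For a measurable $x$ let $x^*(t)=\inf\{s\ge 0: m(\{|x|\ge s\})\le t\}$ be its decreasing rearrangement. Write $y\prec\prec x$ if $\int_0^t y^*\,ds\le\int_0^t x^*\,ds$ for all $t\ge 0$, and $y\prec x$ if $y\prec\prec x$ and $\|y\|_1=\|x\|_1$. A fully symmetric space on $(0,\infty)$ is a Banach space $E$ of measurable functions $x$ satisfying $m(\{|x|>s\})<\infty$ for some $s$, such that: (1) $x\in E$, $|y|\le|x|$ imply $y\in E$ and $\|y\|_E\le\|x\|_E$; (2) $x\in E$, $y^*=x^*$ imply $y\in E$ and $\|y\|_E=\|x\|_E$; (3) $x\in E$, $y\in L_1+L_\infty$, $y\prec\prec x$ imply $y\in E$ and $\|y\|_E\le\|x\|_E$. For $x\in L_1(0,\infty)$ put $\Omega'(x)=\{0\le y\in L_1(0,\infty): y\prec x\}$, and, for $x\in E\subseteq L_1$, let $Q'(x)$ be the $\|\cdot\|_E$-closure of the convex hull of the set of extreme points of $\Omega'(x)$. For $s>0$ let $(\sigma_s f)(t)=f(t/s)$. **Theorem.**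 Let $E$ be a fully symmetric space on $(0,\infty)$ with $E\subseteq L_1(0,\infty)$, and let $x\in E$. Then the limit $$\varphi_{fin}(x)=\lim_{s\to\infty}\frac1s\,\bigl\|\sigma_s(x^*)\chi_{[0,1]}\bigr\|_E$$ exists and is finite, and $\Omega'(x)=Q'(x)$ if and only if $\varphi_{fin}(x)=0$. -/

import Mathlib

open MeasureTheory Set Filter Topology
open scoped ENNReal

noncomputable section

namespace SymmetricSpaces

/-- Lebesgue measure on the semi-axis `(0, ∞)`. -/
abbrev mHalf : Measure ℝ := volume.restrict (Ioi (0 : ℝ))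

/-- `L₀(0, ∞)`: real-valued (hence finite a.e.) Lebesgue measurable functions on `(0, ∞)`,
identified when equal almost everywhere. -/
abbrev L0 : Type := ℝ →ₘ[mHalf] ℝ

/-- `S₀`: the functions `x` with `m {|x| > s} < ∞` for some `s`. -/
def MemS0 (x : L0) : Prop := ∃ s : ℝ, mHalf {t | s < |x t|} < ∞

/-- Membership in `L₁(0, ∞)`. -/
def MemL1 (x : L0) : Prop := Integrable (⇑x) mHalf

/-- Membership in `L₁ + L_∞`. -/
def MemL1AddLinfty (x : L0) : Prop :=
  ∃ f g : L0, MemL1 f ∧ MemLp (⇑g) ∞ mHalf ∧ x = f + g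

/-- The `L₁`-norm, with value `∞` off `L₁`. -/
def normL1 (x : L0) : ℝ≥0∞ := eLpNorm (⇑x) 1 mHalf

/-- The non-increasing right-continuous rearrangement
`x^*(t) = inf {s ≥ 0 : m {|x| ≥ s} ≤ t}`, with values in `[0, ∞]`
(it is finite at every `t > 0` when `x ∈ S₀`). -/
def rearr (x : L0) (t : ℝ) : ℝ≥0∞ :=
  sInf {s : ℝ≥0∞ | mHalf {u | s ≤ ‖x u‖ₑ} ≤ ENNReal.ofReal t}

theorem rearr_antitone (x : L0) : Antitone (rearr x) := by
  intro a b hab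
  refine sInf_le_sInf ?_
  intro s hs
  exact le_trans hs (ENNReal.ofReal_le_ofReal hab)

/-- `y^* = x^*` on `(0, ∞)`. -/
def SameRearr (y x : L0) : Prop := ∀ t : ℝ, 0 < t → rearr y t = rearr x t

/-- Submajorization `y ≺≺ x` in the sense of Hardy, Littlewood and Polya. -/
def Submajorized (y x : L0) : Prop :=
  ∀ t : ℝ, 0 ≤ t → ∫⁻ s in Ioo 0 t, rearr y s ≤ ∫⁻ s in Ioo 0 t, rearr x s

/-- Majorization `y ≺ x`: submajorization together with `‖y‖₁ = ‖x‖₁`. -/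
def Majorized (y x : L0) : Prop := Submajorized y x ∧ normL1 y = normL1 x

/-- The orbit `Ω'(x) = {0 ≤ y ∈ L₁ : y ≺ x}`. -/
def OmegaPrime (x : L0) : Set L0 := {y | 0 ≤ y ∧ MemL1 y ∧ Majorized y x}

/-- The dilation operator `(σ_τ f)(s) = f (s / τ)` on functions on the semi-axis. -/
def dilation (τ : ℝ) (f : ℝ → ℝ) : ℝ → ℝ := fun s => f (s / τ)

/-- The function `σ_τ(x^*) χ_[0,1]`. -/
def dilRearrCutFun (τ : ℝ) (x : L0) : ℝ → ℝ :=
  (Icc (0 : ℝ) 1).indicator (dilation τ fun t => (rearr x t).toReal)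

theorem measurable_dilRearrCutFun (τ : ℝ) (x : L0) : Measurable (dilRearrCutFun τ x) := by
  have h : Measurable fun t => (rearr x t).toReal := (rearr_antitone x).measurable.ennreal_toReal
  exact (h.comp (measurable_id.div_const τ)).indicator measurableSet_Icc

/-- The class of `σ_τ(x^*) χ_[0,1]` in `L₀`. -/
def dilRearrCut (τ : ℝ) (x : L0) : L0 :=
  AEEqFun.mk (dilRearrCutFun τ x) (measurable_dilRearrCutFun τ x).aestronglyMeasurable

section Spaces

variable {E : Type*} [NormedAddCommGroup E] [NormedSpace ℝ E]

/-- `E` is a symmetric space on `(0, ∞)`. A normed space of measurable functions is given as a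
normed space `E` with an injective linear map `ι : E → L₀`, through which the elements of `E`
are functions; `y ∈ E` for `y : L₀` reads `∃ z, ι z = y`. Completeness is required separately, by
`CompleteSpace E`. -/
structure IsSymmetric (ι : E →ₗ[ℝ] L0) : Prop where
  injective : Function.Injective ι
  memS0 : ∀ x : E, MemS0 (ι x)
  ideal : ∀ (x : E) (y : L0), |y| ≤ |ι x| → ∃ z : E, ι z = y ∧ ‖z‖ ≤ ‖x‖
  symmetric : ∀ (x : E) (y : L0), SameRearr y (ι x) → ∃ z : E, ι z = y ∧ ‖z‖ = ‖x‖

/-- `E` is a fully symmetric space: it is symmetric and `x ∈ E`, `y ∈ L₁ + L_∞`, `y ≺≺ x` imply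
`y ∈ E` and `‖y‖_E ≤ ‖x‖_E`. -/
structure IsFullySymmetric (ι : E →ₗ[ℝ] L0) : Prop extends IsSymmetric ι where
  fully : ∀ (x : E) (y : L0), MemL1AddLinfty y → Submajorized y (ι x) →
    ∃ z : E, ι z = y ∧ ‖z‖ ≤ ‖x‖

/-- The norm `‖f‖_E` of a function `f`, with the convention `‖f‖_E = ∞` if `f ∉ E`. -/
def normE (ι : E →ₗ[ℝ] L0) (f : L0) : ℝ≥0∞ := ⨅ (z : E) (_ : ι z = f), ‖z‖ₑ

/-- The quotient `(1 / s) ‖σ_s(x^*) χ_[0,1]‖_E`. -/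
def phiFinQuot (ι : E →ₗ[ℝ] L0) (x : L0) (s : ℝ) : ℝ≥0∞ :=
  normE ι (dilRearrCut s x) / ENNReal.ofReal s

/-- `φ_fin(x)`, the limit of `(1 / s) ‖σ_s(x^*) χ_[0,1]‖_E` as `s → ∞`. -/
def phiFin (ι : E →ₗ[ℝ] L0) (x : L0) : ℝ≥0∞ := limUnder atTop (phiFinQuot ι x)

/-- `Q'(x)`: the norm closure in `E` of the convex hull of the extreme points of `Ω'(x)`. -/
def QPrime (ι : E →ₗ[ℝ] L0) (x : L0) : Set L0 :=
  ι '' closure (convexHull ℝ (ι ⁻¹' (extremePoints ℝ (OmegaPrime x))))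

end Spaces

end SymmetricSpaces

end

noncomputable section

/-! Everything is measured by the excess `Phi f c`, the integral of `(|f| - c)₊`. It is dual to `t ↦
∫_0^t f^*`, so submajorization is comparison of excesses at positive levels, and level `0` records
the `L₁`-norm (`submajorized_of_Phi`, `Phi_le_of_submajorized`). Full symmetry of `E` then reads:
smaller excess, smaller norm (`EN_le_of_Phi`). In the same terms the extreme points of `Ω'(x)` are
exactly the nonnegative integrable functions with the excess of `x`, that is, those equimeasurable
with `|x|` (`mem_extremePoints_of_Phi_eq`, `Phi_eq_of_mem_extremePoints`).

The function `s⁻¹ σ_s(x^*) χ_[0,1]` has excess `Phi (x^* χ_[0,1/s]) (s c)` at level `c`, which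
decreases in `s`; so the limit exists and is an infimum. The inclusion of `E` in `L₁` is
automatically bounded (`exists_eLpNorm_le`), so `Ω'(x)` contains limits in `E` of its elements and
`Q'(x) ⊆ Ω'(x)` always.

Necessity. A convex combination of `N` extreme points has at least the excess of `N⁻¹ σ_N(x^*)`
(`Phi_mul_card_le`): finite averages cannot flatten `x` further. If `Ω'(x) = Q'(x)`, some bounded
`y` in `Ω'(x)` lies close to such a combination `w`. The part of `N⁻¹ σ_N(x^*)` above the bound of
`y` is then submajorized by `w - y`, so its norm is small, and for unbounded `x^*` this forces
`φ_fin(x) = 0`. For bounded `x^*` it vanishes anyway.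

Sufficiency. Let `f = x^*`, `g = y^*` with `y` in `Ω'(x)`. On a block `(p, Q p]`, increments of `∫
g` beyond `μ p` are controlled, up to the factor `(μ - 1) / (μ - 2)`, by increments of `∫ f` beyond
the point where `∫ f` reaches `∫_0^p g` (`primitive_sub_le_reach`). Sampling with mesh `p / n` and a
weak form of Rado's theorem dominate `g` on the block by an average of rearranged samples of `f`
plus a correction coming from the first mesh cell. The number of permutations depends only on `n`,
`Q`, `μ` and the precision, so one average serves all blocks of a geometric sequence. The
corrections together are submajorized by `n⁻¹ σ_n f` and have small integral; when `φ_fin(x) = 0`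
this makes their norm small (`exists_EN_le_of_phiFin_eq_zero`). Averaging over shifted systems of
blocks takes care of the initial pieces `(p, μ p]`.

Transporting from `g` back to `y` and rounding gives an average `b ≤ |y|` of parts of `f` with `|y|
- b` small in norm (`exists_approx_below`). Each part is completed to a function equimeasurable with
`f`, the missing pieces being spread over many disjoint sets. The added function is submajorized by
`R⁻¹ σ_R f` and has the same integral as `|y| - b`, so `φ_fin(x) = 0` makes it small too
(`exists_completion`, `OmegaPrime_subset_QPrime`). -/

namespace SymmetricSpaces

/-! ### The excess over a level -/

/-- The excess `∫ (|f| - c)₊` of `f` over the level `c`. -/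
def Phi (f : ℝ → ℝ) (c : ℝ) : ℝ≥0∞ := ∫⁻ t, ENNReal.ofReal (|f t| - c) ∂mHalf

theorem Phi_congr {f g : ℝ → ℝ} (h : f =ᵐ[mHalf] g) (c : ℝ) : Phi f c = Phi g c :=
  lintegral_congr_ae (h.mono fun t ht => by simp only [ht])

theorem Phi_mono {f g : ℝ → ℝ} (h : ∀ᵐ t ∂mHalf, |f t| ≤ |g t|) (c : ℝ) : Phi f c ≤ Phi g c :=
  lintegral_mono_ae (h.mono fun t ht => ENNReal.ofReal_le_ofReal (by linarith))

theorem Phi_antitone (f : ℝ → ℝ) : Antitone (Phi f) := fun _ _ h =>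
  lintegral_mono fun _ => ENNReal.ofReal_le_ofReal (by linarith)

theorem Phi_zero (f : ℝ → ℝ) : Phi f 0 = eLpNorm f 1 mHalf := by
  rw [eLpNorm_one_eq_lintegral_enorm, Phi]
  refine lintegral_congr fun t => ?_
  rw [sub_zero, Real.enorm_eq_ofReal_abs]

theorem Phi_lt_top {f : ℝ → ℝ} (hf : Integrable f mHalf) {c : ℝ} (hc : 0 ≤ c) : Phi f c < ∞ :=
  ((Phi_antitone f hc).trans_eq (Phi_zero f)).trans_lt (memLp_one_iff_integrable.2 hf).2

/-- Layer cake: the excess over `c` is the integral over `s > 0` of the measure of `{|f| > s + c}`,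
so it depends monotonically on the distribution. -/
theorem Phi_le_of_dist {f g : ℝ → ℝ} (hf : AEMeasurable f mHalf) (hg : AEMeasurable g mHalf)
    (h : ∀ s, 0 < s → mHalf {t | s < |f t|} ≤ mHalf {t | s < |g t|}) {c : ℝ} (hc : 0 ≤ c) :
    Phi f c ≤ Phi g c := by
  have key : ∀ f : ℝ → ℝ, AEMeasurable f mHalf →
      Phi f c = ∫⁻ s in Ioi 0, mHalf {t | s + c < |f t|} := by
    intro f hf
    have h1 : Phi f c = ∫⁻ t, ENNReal.ofReal (max (|f t| - c) 0) ∂mHalf := by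
      simp [Phi, ENNReal.ofReal_max]
    rw [h1, lintegral_eq_lintegral_meas_lt (f := fun t => max (|f t| - c) 0) mHalf
      (ae_of_all _ fun t => le_max_right _ _)]
    · refine setLIntegral_congr_fun measurableSet_Ioi fun s hs => ?_
      simp only [mem_Ioi] at hs
      congr 1; ext t
      simp only [mem_ofPred_eq, lt_max_iff]
      constructor
      · rintro (h | h) <;> linarith
      · intro h; left; linarith
    · exact ((continuous_abs.measurable.comp_aemeasurable hf).sub_const c).max aemeasurable_const
  rw [key f hf, key g hg]
  refine setLIntegral_mono' measurableSet_Ioi fun s hs => h _ ?_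
  simp only [mem_Ioi] at hs
  linarith

theorem Phi_eq_of_dist {f g : ℝ → ℝ} (hf : AEMeasurable f mHalf) (hg : AEMeasurable g mHalf)
    (h : ∀ s, 0 < s → mHalf {t | s < |f t|} = mHalf {t | s < |g t|}) {c : ℝ} (hc : 0 ≤ c) :
    Phi f c = Phi g c :=
  le_antisymm (Phi_le_of_dist hf hg (fun s hs => (h s hs).le) hc)
    (Phi_le_of_dist hg hf (fun s hs => (h s hs).ge) hc)

theorem mHalf_gt_lt_top {f : ℝ → ℝ} (hf : Integrable f mHalf) {s : ℝ} (hs : 0 < s) :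
    mHalf {t | s < |f t|} < ∞ := by
  refine (measure_mono ?_).trans_lt (hf.measure_norm_ge_lt_top hs)
  intro t ht
  simpa using (le_of_lt ht)

/-! ### The decreasing rearrangement and its distribution -/

theorem lt_rearr_iff (x : L0) (s : ℝ≥0∞) (t : ℝ) :
    s < rearr x t ↔ ENNReal.ofReal t < mHalf {u | s < ‖x u‖ₑ} := by
  constructor
  · intro h
    by_contra! h2
    refine absurd h (not_lt.2 ?_)
    refine le_of_forall_gt_imp_ge_of_dense fun s' hs' => sInf_le ?_
    exact (measure_mono fun u hu => lt_of_lt_of_le hs' hu).trans h2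
  · intro h
    rcases eq_or_ne s ∞ with rfl | hs
    · simp at h
    -- The rearrangement is defined by the sets `{|x| ≥ s}`; continuity of measure along levels
    -- decreasing to `s` passes from these to the strict superlevel set.
    obtain ⟨w, hw, hwlim⟩ : ∃ w : ℕ → ℝ≥0∞, (∀ n, s < w n) ∧ Antitone w ∧
        Tendsto w atTop (𝓝 s) := by
      obtain ⟨w, h1, h2, h3⟩ := exists_seq_strictAnti_tendsto' (lt_top_iff_ne_top.2 hs)
      exact ⟨w, fun n => (h2 n).1, h1.antitone, h3⟩
    have hU : {u | s < ‖x u‖ₑ} = ⋃ n, {u | w n ≤ ‖x u‖ₑ} := by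
      ext u
      simp only [mem_ofPred_eq, mem_iUnion]
      constructor
      · intro hu
        obtain ⟨n, hn⟩ := ((tendsto_order.1 hwlim.2).2 _ hu).exists
        exact ⟨n, hn.le⟩
      · rintro ⟨n, hn⟩
        exact (hw n).trans_le hn
    have hmono : Monotone fun n => {u | w n ≤ ‖x u‖ₑ} := fun a b hab u hu =>
      (hwlim.1 hab).trans hu
    rw [hU, hmono.measure_iUnion, lt_iSup_iff] at h
    obtain ⟨n, hn⟩ := h
    refine (hw n).trans_le (le_sInf fun σ hσ => ?_)
    by_contra! hlt
    exact absurd (hn.trans_le ((measure_mono fun u hu => hlt.le.trans hu).trans hσ)) (lt_irrefl _)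

/-- The real-valued decreasing rearrangement. -/
def rearrR (x : L0) (t : ℝ) : ℝ := (rearr x t).toReal

theorem rearrR_nonneg (x : L0) (t : ℝ) : 0 ≤ rearrR x t := ENNReal.toReal_nonneg

theorem measurable_rearrR (x : L0) : Measurable (rearrR x) :=
  (rearr_antitone x).measurable.ennreal_toReal

theorem rearr_lt_top {x : L0} (hx : MemL1 x) {t : ℝ} (ht : 0 < t) : rearr x t < ∞ := by
  by_contra! h
  rw [top_le_iff] at h
  have h1 : ∀ s : ℝ, 0 < s → ENNReal.ofReal (s * t) ≤ eLpNorm x 1 mHalf := by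
    intro s hs
    have h2 := (lt_rearr_iff x (ENNReal.ofReal s) t).1 (h ▸ ENNReal.ofReal_lt_top)
    have h3 := mul_meas_ge_le_lintegral₀ (μ := mHalf) hx.1.enorm (ENNReal.ofReal s)
    rw [eLpNorm_one_eq_lintegral_enorm]
    refine le_trans ?_ h3
    rw [ENNReal.ofReal_mul hs.le]
    gcongr
    exact h2.le.trans (measure_mono fun u hu => (le_of_lt hu : _ ≤ ‖x u‖ₑ))
  have h4 : eLpNorm x 1 mHalf < ∞ := (memLp_one_iff_integrable.2 hx).2
  have h5 := h1 (((eLpNorm x 1 mHalf).toReal + 1) / t) (by positivity)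
  rw [div_mul_cancel₀ _ ht.ne', ENNReal.ofReal_le_iff_le_toReal h4.ne] at h5
  linarith

theorem ofReal_rearrR {x : L0} (hx : MemL1 x) {t : ℝ} (ht : 0 < t) :
    ENNReal.ofReal (rearrR x t) = rearr x t :=
  ENNReal.ofReal_toReal (rearr_lt_top hx ht).ne

theorem rearrR_antitoneOn {x : L0} (hx : MemL1 x) : AntitoneOn (rearrR x) (Ioi 0) := by
  intro a ha b _ hab
  exact ENNReal.toReal_mono (rearr_lt_top hx ha).ne (rearr_antitone x hab)

theorem lt_rearrR_iff {x : L0} (hx : MemL1 x) {s t : ℝ} (hs : 0 ≤ s) (ht : 0 < t) :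
    s < rearrR x t ↔ ENNReal.ofReal t < mHalf {u | s < |x u|} := by
  have : {u | s < |x u|} = {u | ENNReal.ofReal s < ‖x u‖ₑ} := by
    ext u
    simp only [mem_ofPred_eq, Real.enorm_eq_ofReal_abs]
    rw [ENNReal.ofReal_lt_ofReal_iff_of_nonneg hs]
  rw [this, ← lt_rearr_iff, ← ofReal_rearrR hx ht, ENNReal.ofReal_lt_ofReal_iff_of_nonneg hs]

theorem mHalf_ofReal_lt (M : ℝ≥0∞) : mHalf {t : ℝ | ENNReal.ofReal t < M} = M := by
  rw [Measure.restrict_apply (measurableSet_lt ENNReal.measurable_ofReal measurable_const)]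
  rcases eq_or_ne M ∞ with rfl | hM
  · simp
  · have : {t : ℝ | ENNReal.ofReal t < M} ∩ Ioi 0 = Ioo 0 M.toReal := by
      ext t
      simp only [mem_inter_iff, mem_ofPred_eq, mem_Ioi, mem_Ioo]
      constructor
      · rintro ⟨h1, h2⟩
        exact ⟨h2, (ENNReal.ofReal_lt_iff_lt_toReal h2.le hM).1 h1⟩
      · rintro ⟨h1, h2⟩
        exact ⟨(ENNReal.ofReal_lt_iff_lt_toReal h1.le hM).2 h2, h1⟩
    rw [this, Real.volume_Ioo, sub_zero, ENNReal.ofReal_toReal hM]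

theorem ae_pos : ∀ᵐ t ∂mHalf, 0 < t := ae_restrict_mem measurableSet_Ioi

/-- By `lt_rearrR_iff`, the set where `x^* > s` is, up to a null set, the interval from `0` to the
measure of `{|x| > s}`. -/
theorem dist_rearrR {x : L0} (hx : MemL1 x) {s : ℝ} (hs : 0 ≤ s) :
    mHalf {t | s < |rearrR x t|} = mHalf {u | s < |x u|} := by
  rw [← mHalf_ofReal_lt (mHalf {u | s < |x u|})]
  refine measure_congr ?_
  filter_upwards [ae_pos] with t ht
  refine propext ?_
  change s < |rearrR x t| ↔ ENNReal.ofReal t < _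
  rw [abs_of_nonneg (rearrR_nonneg x t), lt_rearrR_iff hx hs ht]

theorem Phi_rearrR {x : L0} (hx : MemL1 x) {c : ℝ} (hc : 0 ≤ c) : Phi (rearrR x) c = Phi x c :=
  Phi_eq_of_dist (measurable_rearrR x).aemeasurable hx.1.aemeasurable
    (fun _ hs => dist_rearrR hx hs.le) hc

theorem integrable_rearrR {x : L0} (hx : MemL1 x) : Integrable (rearrR x) mHalf := by
  rw [← memLp_one_iff_integrable]
  refine ⟨(measurable_rearrR x).aestronglyMeasurable, ?_⟩
  rw [← Phi_zero, Phi_rearrR hx le_rfl]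
  exact Phi_lt_top hx le_rfl

/-! ### Submajorization as comparison of excesses -/

theorem lintegral_Ioo_le_Phi {f : ℝ → ℝ} (hf0 : ∀ t, 0 ≤ f t)
    {c t : ℝ} (hc : 0 ≤ c) :
    ∫⁻ s in Ioo 0 t, ENNReal.ofReal (f s) ≤ Phi f c + ENNReal.ofReal (c * t) := by
  calc ∫⁻ s in Ioo 0 t, ENNReal.ofReal (f s)
      ≤ ∫⁻ s in Ioo 0 t, (ENNReal.ofReal (|f s| - c) + ENNReal.ofReal c) := by
        refine lintegral_mono fun s => ?_
        rw [abs_of_nonneg (hf0 s)]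
        refine le_trans (ENNReal.ofReal_le_ofReal (by linarith)) ENNReal.ofReal_add_le
    _ = (∫⁻ s in Ioo 0 t, ENNReal.ofReal (|f s| - c)) + ENNReal.ofReal (c * t) := by
        rw [lintegral_add_right _ measurable_const]
        simp [ENNReal.ofReal_mul hc]
    _ ≤ _ := by
        refine add_le_add_left ?_ _
        exact lintegral_mono' (Measure.restrict_mono Ioo_subset_Ioi_self le_rfl) le_rfl

/-- The equality case of `lintegral_Ioo_le_Phi`: the level separates the values before `t` from
those after `t`. The two statements express a Legendre duality between `∫_0^t f` and the excess. -/
theorem Phi_add_eq_lintegral_Ioo {f : ℝ → ℝ} (hf0 : ∀ t, 0 ≤ f t)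
    {c t : ℝ} (hc : 0 ≤ c) (h1 : ∀ s, 0 < s → s < t → c ≤ f s)
    (h2 : ∀ s, 0 < s → t < s → f s ≤ c) :
    Phi f c + ENNReal.ofReal (c * t) = ∫⁻ s in Ioo 0 t, ENNReal.ofReal (f s) := by
  have h3 : Phi f c = ∫⁻ s in Ioo 0 t, ENNReal.ofReal (|f s| - c) := by
    rw [Phi, ← lintegral_indicator measurableSet_Ioi, ← lintegral_indicator measurableSet_Ioo]
    refine lintegral_congr_ae ?_
    have : ∀ᵐ s ∂(volume : Measure ℝ), s ≠ t := by simp [ae_iff]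
    filter_upwards [this] with s hst
    by_cases h0 : 0 < s
    · rcases lt_or_gt_of_ne hst with hlt | hlt
      · simp [indicator, h0, hlt]
      · have : |f s| - c ≤ 0 := by
          rw [abs_of_nonneg (hf0 s)]
          linarith [h2 s h0 hlt]
        simp [indicator, h0, hlt.not_gt, this]
    · simp [indicator, h0]
  have h4 : ENNReal.ofReal (c * t) = ∫⁻ s in Ioo 0 t, ENNReal.ofReal c := by
    simp [ENNReal.ofReal_mul hc]
  rw [h3, h4, ← lintegral_add_right _ measurable_const]
  refine setLIntegral_congr_fun measurableSet_Ioo fun s hs => ?_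
  rw [abs_of_nonneg (hf0 s), ← ENNReal.ofReal_add _ hc, sub_add_cancel]
  linarith [h1 s hs.1 hs.2]

theorem lintegral_rearr {x : L0} (hx : MemL1 x) (t : ℝ) :
    ∫⁻ s in Ioo 0 t, rearr x s = ∫⁻ s in Ioo 0 t, ENNReal.ofReal (rearrR x s) :=
  setLIntegral_congr_fun measurableSet_Ioo fun _ hs => (ofReal_rearrR hx hs.1).symm

/-- At the level `c = x^*(t)` the dual bound for `∫_0^t x^*` is an equality, while for `y` the
inequality suffices. -/
theorem submajorized_of_Phi {x y : L0} (hx : MemL1 x) (hy : MemL1 y)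
    (h : ∀ c, 0 < c → Phi y c ≤ Phi x c) : Submajorized y x := by
  intro t ht
  rcases ht.eq_or_lt with rfl | ht
  · simp
  rw [lintegral_rearr hx, lintegral_rearr hy]
  have h' : ∀ c, 0 ≤ c → Phi y c ≤ Phi x c := by
    intro c hc
    rcases hc.eq_or_lt with rfl | hc
    -- Level `0` is not part of the hypothesis; it follows from positive levels by monotone
    -- convergence. It is needed when `x^*(t) = 0`.
    · have hlim : Tendsto (fun n : ℕ => Phi y (1 / ((n : ℝ) + 1))) atTop (𝓝 (Phi y 0)) := by
        refine lintegral_tendsto_of_tendsto_of_monotone (fun n => ?_) ?_ ?_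
        · exact ((continuous_abs.measurable.comp_aemeasurable
            hy.1.aemeasurable).sub_const _).ennreal_ofReal
        · refine ae_of_all _ fun t a b hab => ENNReal.ofReal_le_ofReal ?_
          have := Nat.one_div_le_one_div (α := ℝ) hab
          linarith
        · refine ae_of_all _ fun t => ENNReal.tendsto_ofReal ?_
          exact tendsto_const_nhds.sub tendsto_one_div_add_atTop_nhds_zero_nat
      exact le_of_tendsto hlim (Eventually.of_forall fun n =>
        (h _ (by positivity)).trans (Phi_antitone _ (by positivity)))
    · exact h c hc
  have hc := rearrR_nonneg x t
  refine (lintegral_Ioo_le_Phi (rearrR_nonneg y) hc).trans ?_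
  rw [Phi_rearrR hy hc]
  refine (add_le_add_left (h' _ hc) _).trans ?_
  rw [← Phi_rearrR hx hc, Phi_add_eq_lintegral_Ioo (rearrR_nonneg x) hc]
  · exact fun s hs hst => rearrR_antitoneOn hx hs ht hst.le
  · exact fun s hs hst => rearrR_antitoneOn hx ht hs hst.le

/-- The dual choice: `t` is the measure of `{|y| > c}`, where `y^*` crosses the level `c`, so that
the bound is an equality for `y`. -/
theorem Phi_le_of_submajorized {x y : L0} (hx : MemL1 x) (hy : MemL1 y) (h : Submajorized y x)
    {c : ℝ} (hc : 0 < c) : Phi y c ≤ Phi x c := by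
  have hfin := mHalf_gt_lt_top hy hc
  set τ := (mHalf {t | c < |y t|}).toReal with hτ
  have hτ0 : 0 ≤ τ := ENNReal.toReal_nonneg
  have h1 := h τ hτ0
  rw [lintegral_rearr hx, lintegral_rearr hy, ← Phi_add_eq_lintegral_Ioo (rearrR_nonneg y) hc.le,
    Phi_rearrR hy hc.le] at h1
  · have h2 := h1.trans (lintegral_Ioo_le_Phi (rearrR_nonneg x) hc.le)
    rw [Phi_rearrR hx hc.le] at h2
    exact (ENNReal.add_le_add_iff_right ENNReal.ofReal_ne_top).1 h2
  · intro s hs hst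
    exact ((lt_rearrR_iff hy hc.le hs).2
      ((ENNReal.ofReal_lt_iff_lt_toReal hs.le hfin.ne).2 hst)).le
  · intro s hs hst
    by_contra! hlt
    have := (lt_rearrR_iff hy hc.le hs).1 hlt
    rw [ENNReal.ofReal_lt_iff_lt_toReal hs.le hfin.ne] at this
    linarith

/-! ### The norm of `E` on functions -/

section

variable {E : Type*} [NormedAddCommGroup E] [NormedSpace ℝ E]

/-- The norm `‖f‖_E` of a function `f` on the semi-axis, `∞` if its class is not in `E`. -/
def EN (ι : E →ₗ[ℝ] L0) (f : ℝ → ℝ) : ℝ≥0∞ := ⨅ (z : E) (_ : ⇑(ι z) =ᵐ[mHalf] f), ‖z‖ₑ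

variable {ι : E →ₗ[ℝ] L0}

theorem normE_eq_EN (u : L0) : normE ι u = EN ι u := by
  unfold normE EN
  refine iInf_congr fun z => ?_
  rw [AEEqFun.ext_iff]

theorem EN_congr {f g : ℝ → ℝ} (h : f =ᵐ[mHalf] g) : EN ι f = EN ι g := by
  unfold EN
  refine iInf_congr fun z => ?_
  rw [show (⇑(ι z) =ᵐ[mHalf] f) = (⇑(ι z) =ᵐ[mHalf] g) from
    propext ⟨fun h' => h'.trans h, fun h' => h'.trans h.symm⟩]

theorem EN_le_of_ae {f : ℝ → ℝ} {z : E} (h : ⇑(ι z) =ᵐ[mHalf] f) : EN ι f ≤ ‖z‖ₑ :=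
  iInf₂_le z h

theorem EN_eq_of_ae (hι : Function.Injective ι) {f : ℝ → ℝ} {z : E} (h : ⇑(ι z) =ᵐ[mHalf] f) :
    EN ι f = ‖z‖ₑ := by
  refine le_antisymm (EN_le_of_ae h) (le_iInf₂ fun z' hz' => ?_)
  rw [hι (AEEqFun.ext (hz'.trans h.symm))]

theorem exists_of_EN_lt {f : ℝ → ℝ} {r : ℝ≥0∞} (h : EN ι f < r) :
    ∃ z : E, ⇑(ι z) =ᵐ[mHalf] f ∧ ‖z‖ₑ < r := by
  unfold EN at h
  simp only [iInf_lt_iff] at h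
  obtain ⟨z, hz, h⟩ := h
  exact ⟨z, hz, h⟩

theorem exists_of_EN_lt_top {f : ℝ → ℝ} (h : EN ι f < ∞) :
    ∃ z : E, ⇑(ι z) =ᵐ[mHalf] f := (exists_of_EN_lt h).imp fun _ h => h.1

theorem EN_zero : EN ι (fun _ => 0) = 0 := by
  refine le_antisymm ((EN_le_of_ae (z := 0) ?_).trans_eq enorm_zero) zero_le
  rw [map_zero]
  exact AEEqFun.coeFn_zero

theorem EN_add_le (f g : ℝ → ℝ) : EN ι (fun t => f t + g t) ≤ EN ι f + EN ι g := by
  refine ENNReal.le_of_forall_pos_le_add fun ε hε hlt => ?_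
  have hf : EN ι f ≠ ∞ := fun h => by simp [h] at hlt
  have hg : EN ι g ≠ ∞ := fun h => by simp [h] at hlt
  have hε' : (ε / 2 : ℝ≥0∞) ≠ 0 := by simpa using hε.ne'
  obtain ⟨z, hz, hz'⟩ := exists_of_EN_lt (ENNReal.lt_add_right hf hε')
  obtain ⟨w, hw, hw'⟩ := exists_of_EN_lt (ENNReal.lt_add_right hg hε')
  have : ⇑(ι (z + w)) =ᵐ[mHalf] fun t => f t + g t := by
    rw [map_add]
    filter_upwards [AEEqFun.coeFn_add (ι z) (ι w), hz, hw] with t h1 h2 h3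
    rw [h1, Pi.add_apply, h2, h3]
  refine (EN_le_of_ae this).trans ((enorm_add_le z w).trans ((add_le_add hz'.le hw'.le).trans_eq ?_))
  rw [add_add_add_comm, ENNReal.add_halves]

theorem EN_const_mul_le (c : ℝ) (f : ℝ → ℝ) (hf : EN ι f ≠ ∞) :
    EN ι (fun t => c * f t) ≤ ENNReal.ofReal |c| * EN ι f := by
  by_cases hc : c = 0
  · simp [hc, EN_zero]
  have hc' : ENNReal.ofReal |c| ≠ 0 := by simpa using hc
  refine ENNReal.le_of_forall_pos_le_add fun ε hε _ => ?_
  have hε' : (ε / ENNReal.ofReal |c| : ℝ≥0∞) ≠ 0 := by simp [hε.ne']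
  obtain ⟨z, hz, hz'⟩ := exists_of_EN_lt (ENNReal.lt_add_right hf hε')
  have : ⇑(ι (c • z)) =ᵐ[mHalf] fun t => c * f t := by
    rw [map_smul]
    filter_upwards [AEEqFun.coeFn_smul c (ι z), hz] with t h1 h2
    rw [h1, Pi.smul_apply, h2, smul_eq_mul]
  refine (EN_le_of_ae this).trans ?_
  rw [enorm_smul, Real.enorm_eq_ofReal_abs]
  refine (mul_le_mul_right hz'.le _).trans_eq ?_
  rw [mul_add, ENNReal.mul_div_cancel hc' ENNReal.ofReal_ne_top]

theorem EN_sum_le {κ : Type*} (s : Finset κ) (f : κ → ℝ → ℝ) :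
    EN ι (fun t => ∑ i ∈ s, f i t) ≤ ∑ i ∈ s, EN ι (f i) := by
  classical
  induction s using Finset.induction_on with
  | empty => simp [EN_zero]
  | insert a s ha ih =>
    simp only [Finset.sum_insert ha]
    exact (EN_add_le _ _).trans (add_le_add_right ih _)

theorem EN_mono (hE : IsSymmetric ι) {f g : ℝ → ℝ} (hf : AEStronglyMeasurable f mHalf)
    (h : ∀ᵐ t ∂mHalf, |f t| ≤ |g t|) : EN ι f ≤ EN ι g := by
  refine le_iInf₂ fun z hz => ?_
  obtain ⟨w, hw, hwz⟩ := hE.ideal z (AEEqFun.mk f hf) (by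
    rw [← AEEqFun.coeFn_le]
    filter_upwards [AEEqFun.coeFn_abs (ι z), AEEqFun.coeFn_abs (AEEqFun.mk f hf),
      AEEqFun.coeFn_mk f hf, hz, h] with t h1 h2 h3 h4 h5
    rw [h1, h2, h3, h4]
    exact h5)
  refine (EN_le_of_ae (z := w) ?_).trans (enorm_le_iff_norm_le.2 hwz)
  rw [hw]
  exact AEEqFun.coeFn_mk f hf

/-- Full symmetry in the form used throughout: a norm inequality follows from comparing excesses at
positive levels. If `g` is not in `E` the right side is `∞`. -/
theorem EN_le_of_Phi (hE : IsFullySymmetric ι) (hL1 : ∀ z : E, MemL1 (ι z)) {f g : ℝ → ℝ}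
    (hf : Integrable f mHalf) (h : ∀ c, 0 < c → Phi f c ≤ Phi g c) : EN ι f ≤ EN ι g := by
  refine le_iInf₂ fun z hz => ?_
  have hmk := AEEqFun.coeFn_mk f hf.1
  have hf' : MemL1 (AEEqFun.mk f hf.1) := hf.congr hmk.symm
  obtain ⟨w, hw, hwz⟩ := hE.fully z (AEEqFun.mk f hf.1)
    ⟨_, 0, hf', by
      have : ⇑(0 : L0) =ᵐ[mHalf] 0 := AEEqFun.coeFn_zero
      exact (memLp_congr_ae this).2 MemLp.zero, (add_zero _).symm⟩
    (submajorized_of_Phi (hL1 z) hf' fun c hc => by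
      rw [Phi_congr hmk, Phi_congr hz]
      exact h c hc)
  refine (EN_le_of_ae (z := w) ?_).trans (enorm_le_iff_norm_le.2 hwz)
  rw [hw]
  exact hmk

end

/-! ### Non-atomicity of Lebesgue measure -/

/-- The measure of the part of `A` to the left of `t`. -/
def rk (A : Set ℝ) (t : ℝ) : ℝ := (mHalf (A ∩ Iio t)).toReal

theorem mHalf_inter_Iio_lt_top (A : Set ℝ) (t : ℝ) : mHalf (A ∩ Iio t) < ∞ := by
  refine (measure_mono inter_subset_right).trans_lt ?_
  rw [Measure.restrict_apply measurableSet_Iio, inter_comm, Ioi_inter_Iio]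
  simp

theorem ofReal_rk (A : Set ℝ) (t : ℝ) : ENNReal.ofReal (rk A t) = mHalf (A ∩ Iio t) :=
  ENNReal.ofReal_toReal (mHalf_inter_Iio_lt_top A t).ne

theorem rk_mono (A : Set ℝ) : Monotone (rk A) := fun _ b h =>
  ENNReal.toReal_mono (mHalf_inter_Iio_lt_top A b).ne
    (measure_mono (inter_subset_inter_right _ (Iio_subset_Iio h)))

theorem rk_nonneg (A : Set ℝ) (t : ℝ) : 0 ≤ rk A t := ENNReal.toReal_nonneg

theorem rk_le_add (A : Set ℝ) {a b : ℝ} (h : a ≤ b) : rk A b ≤ rk A a + (b - a) := by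
  rw [← ENNReal.ofReal_le_ofReal_iff (add_nonneg (rk_nonneg _ _) (sub_nonneg.2 h)),
    ENNReal.ofReal_add (rk_nonneg _ _) (sub_nonneg.2 h), ofReal_rk, ofReal_rk]
  calc mHalf (A ∩ Iio b) ≤ mHalf (A ∩ Iio a ∪ Ico a b) := by
        refine measure_mono fun t ht => ?_
        rcases lt_or_ge t a with h' | h'
        · exact Or.inl ⟨ht.1, h'⟩
        · exact Or.inr ⟨h', ht.2⟩
    _ ≤ _ := (measure_union_le _ _).trans (add_le_add_right
        ((Measure.restrict_apply_le _ _).trans_eq (by simp)) _)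

theorem continuous_rk (A : Set ℝ) : Continuous (rk A) := by
  have : LipschitzWith 1 (rk A) := by
    refine LipschitzWith.of_le_add_mul 1 fun a b => ?_
    rw [Real.dist_eq, NNReal.coe_one, one_mul]
    rcases le_total a b with h | h
    · linarith [rk_mono A h, abs_nonneg (a - b)]
    · linarith [rk_le_add A h, le_abs_self (a - b)]
  exact this.continuous

theorem rk_of_nonpos (A : Set ℝ) {t : ℝ} (ht : t ≤ 0) : rk A t = 0 := by
  have : mHalf (A ∩ Iio t) = 0 := by
    refine measure_mono_null inter_subset_right ?_
    rw [Measure.restrict_apply measurableSet_Iio, Iio_inter_Ioi, Ioo_eq_empty (not_lt.2 ht),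
      measure_empty]
  simp [rk, this]

theorem exists_rk_eq (A : Set ℝ) {c : ℝ} (hc0 : 0 ≤ c) (hc : ENNReal.ofReal c < mHalf A) :
    ∃ t, 0 ≤ t ∧ rk A t = c := by
  have hU : A = ⋃ n : ℕ, A ∩ Iio (n : ℝ) := by
    ext t
    simp only [mem_iUnion, mem_inter_iff, mem_Iio]
    exact ⟨fun h => (exists_nat_gt t).imp fun n hn => ⟨h, hn⟩, fun ⟨n, h, _⟩ => h⟩
  have hmono : Monotone fun n : ℕ => A ∩ Iio (n : ℝ) := fun a b hab =>
    inter_subset_inter_right _ (Iio_subset_Iio (by exact_mod_cast hab))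
  rw [hU, hmono.measure_iUnion, lt_iSup_iff] at hc
  obtain ⟨n, hn⟩ := hc
  rw [← ofReal_rk, ENNReal.ofReal_lt_ofReal_iff_of_nonneg hc0] at hn
  have h0 : rk A 0 ≤ c := by rw [rk_of_nonpos A le_rfl]; exact hc0
  obtain ⟨t, ht, hteq⟩ := intermediate_value_Icc (Nat.cast_nonneg n) (continuous_rk A).continuousOn
    (show c ∈ Icc _ _ from ⟨h0, hn.le⟩)
  exact ⟨t, ht.1, hteq⟩

/-- The rank function is continuous, so `A` can be cut where it takes the value half the measure of
`A`. -/
theorem exists_halves {A : Set ℝ} (hA : MeasurableSet A) (h0 : mHalf A ≠ 0) (h1 : mHalf A ≠ ∞) :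
    ∃ B ⊆ A, MeasurableSet B ∧ mHalf B = mHalf A / 2 ∧ mHalf (A \ B) = mHalf A / 2 := by
  have hhalf : ENNReal.ofReal ((mHalf A / 2).toReal) = mHalf A / 2 :=
    ENNReal.ofReal_toReal (ENNReal.div_lt_top h1 (by simp)).ne
  obtain ⟨t, -, ht⟩ := exists_rk_eq A (c := (mHalf A / 2).toReal) ENNReal.toReal_nonneg (by
    rw [hhalf]; exact ENNReal.half_lt_self h0 h1)
  have hB : mHalf (A ∩ Iio t) = mHalf A / 2 := by rw [← ofReal_rk, ht, hhalf]
  refine ⟨A ∩ Iio t, inter_subset_left, hA.inter measurableSet_Iio, hB, ?_⟩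
  rw [measure_sdiff inter_subset_left (hA.inter measurableSet_Iio).nullMeasurableSet
    (mHalf_inter_Iio_lt_top A t).ne, hB, ENNReal.sub_half h1]

/-! ### Convexity of the excess, and the orbit in terms of excesses -/

/-- The real-valued excess of a nonnegative function over the level `c`. -/
def PhiR (f : ℝ → ℝ) (c : ℝ) : ℝ := ∫ t, max (f t - c) 0 ∂mHalf

theorem integrable_excess {f : ℝ → ℝ} (hf : Integrable f mHalf) {c : ℝ} (hc : 0 ≤ c) :
    Integrable (fun t => max (f t - c) 0) mHalf := by
  refine hf.mono ((hf.1.sub aestronglyMeasurable_const).sup aestronglyMeasurable_const)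
    (ae_of_all _ fun t => ?_)
  rw [Real.norm_eq_abs, Real.norm_eq_abs, abs_of_nonneg (le_max_right _ _)]
  exact max_le (by linarith [le_abs_self (f t)]) (abs_nonneg _)

theorem Phi_eq_ofReal {f : ℝ → ℝ} (hf : Integrable f mHalf) (h0 : ∀ᵐ t ∂mHalf, 0 ≤ f t) {c : ℝ}
    (hc : 0 ≤ c) : Phi f c = ENNReal.ofReal (PhiR f c) := by
  rw [PhiR, ofReal_integral_eq_lintegral_ofReal (integrable_excess hf hc)
    (ae_of_all _ fun t => le_max_right _ _), Phi]
  refine lintegral_congr_ae (h0.mono fun t ht => ?_)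
  simp only [abs_of_nonneg ht, ENNReal.ofReal_max, ENNReal.ofReal_zero]
  exact (max_eq_left zero_le).symm

theorem PhiR_nonneg (f : ℝ → ℝ) (c : ℝ) : 0 ≤ PhiR f c :=
  integral_nonneg fun _ => le_max_right _ _

/-- The excess is an integral of the convex functions `c ↦ (f(t) - c)₊`. Convexity also yields
continuity at positive levels. -/
theorem convexOn_PhiR {f : ℝ → ℝ} (hf : Integrable f mHalf) : ConvexOn ℝ (Ici 0) (PhiR f) := by
  refine ⟨convex_Ici 0, fun c hc d hd a b ha hb hab => ?_⟩
  have h1 := integrable_excess hf hc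
  have h2 := integrable_excess hf hd
  simp only [smul_eq_mul, PhiR]
  rw [← integral_const_mul, ← integral_const_mul, ← integral_add (h1.const_mul a) (h2.const_mul b)]
  refine integral_mono (integrable_excess hf (add_nonneg (mul_nonneg ha hc) (mul_nonneg hb hd)))
    ((h1.const_mul a).add (h2.const_mul b)) fun t => ?_
  have e : f t - (a * c + b * d) = a * (f t - c) + b * (f t - d) := by
    linear_combination (-f t) * hab
  refine max_le ?_ (by positivity)
  rw [e]
  gcongr <;> exact le_max_left _ _

theorem PhiR_antitone {f : ℝ → ℝ} (hf : Integrable f mHalf) : AntitoneOn (PhiR f) (Ici 0) :=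
  fun c hc d hd h => integral_mono (integrable_excess hf hd) (integrable_excess hf hc) fun t =>
    max_le_max (by linarith) le_rfl

/-- Positive levels encode submajorization and level `0` encodes equality of the `L₁`-norms. -/
theorem mem_OmegaPrime_iff {x y : L0} (hx : MemL1 x) : y ∈ OmegaPrime x ↔
    (∀ᵐ t ∂mHalf, 0 ≤ y t) ∧ MemL1 y ∧ (∀ c, 0 < c → Phi y c ≤ Phi x c) ∧ Phi y 0 = Phi x 0 := by
  have h0 : (0 : L0) ≤ y ↔ ∀ᵐ t ∂mHalf, 0 ≤ y t := by
    rw [← AEEqFun.coeFn_le]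
    have hz : ⇑(0 : L0) =ᵐ[mHalf] 0 := AEEqFun.coeFn_zero
    constructor
    · intro h; filter_upwards [hz, h] with t h1 h2; simpa [h1] using h2
    · intro h; filter_upwards [hz, h] with t h1 h2; simpa [h1] using h2
  simp only [OmegaPrime, mem_ofPred_eq, Majorized, normL1, Phi_zero, h0]
  constructor
  · rintro ⟨h1, h2, h3, h4⟩
    exact ⟨h1, h2, fun c hc => Phi_le_of_submajorized hx h2 h3 hc, h4⟩
  · rintro ⟨h1, h2, h3, h4⟩
    exact ⟨h1, h2, submajorized_of_Phi hx h2 h3, h4⟩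

theorem mk_mem_OmegaPrime {x : L0} (hx : MemL1 x) {f : ℝ → ℝ} (hf : Integrable f mHalf)
    (h0 : ∀ᵐ t ∂mHalf, 0 ≤ f t) (h1 : ∀ c, 0 < c → Phi f c ≤ Phi x c) (h2 : Phi f 0 = Phi x 0) :
    AEEqFun.mk f hf.1 ∈ OmegaPrime x := by
  have hmk := AEEqFun.coeFn_mk f hf.1
  rw [mem_OmegaPrime_iff hx]
  refine ⟨?_, hf.congr hmk.symm, fun c hc => ?_, ?_⟩
  · filter_upwards [hmk, h0] with t h h'; rwa [h]
  · rw [Phi_congr hmk]; exact h1 c hc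
  · rw [Phi_congr hmk, h2]

theorem coe_combo (u v : L0) (a b : ℝ) :
    ⇑(a • u + b • v) =ᵐ[mHalf] fun t => a * u t + b * v t := by
  filter_upwards [AEEqFun.coeFn_add (a • u) (b • v), AEEqFun.coeFn_smul a u,
    AEEqFun.coeFn_smul b v] with t h1 h2 h3
  rw [h1, Pi.add_apply, h2, h3]
  simp

theorem Phi_combo_le {f g : ℝ → ℝ} (hf : AEMeasurable f mHalf) {a b : ℝ} (ha : 0 ≤ a) (hb : 0 ≤ b)
    (hab : a + b = 1) (c : ℝ) :
    Phi (fun t => a * f t + b * g t) c ≤ ENNReal.ofReal a * Phi f c + ENNReal.ofReal b * Phi g c := by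
  unfold Phi
  rw [← lintegral_const_mul' _ _ ENNReal.ofReal_ne_top,
    ← lintegral_const_mul' _ _ ENNReal.ofReal_ne_top, ← lintegral_add_left']
  · refine lintegral_mono fun t => ?_
    simp only
    rw [← ENNReal.ofReal_mul ha, ← ENNReal.ofReal_mul hb]
    refine le_trans (ENNReal.ofReal_le_ofReal ?_) ENNReal.ofReal_add_le
    calc |a * f t + b * g t| - c ≤ a * |f t| + b * |g t| - c := by
          have := abs_add_le (a * f t) (b * g t)
          rw [abs_mul, abs_mul, abs_of_nonneg ha, abs_of_nonneg hb] at this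
          linarith
      _ = _ := by linear_combination c * hab
  · exact ((continuous_abs.measurable.comp_aemeasurable hf).sub_const
      _).ennreal_ofReal.const_mul _

theorem convex_OmegaPrime {x : L0} (hx : MemL1 x) : Convex ℝ (OmegaPrime x) := by
  intro u hu v hv a b ha hb hab
  rw [mem_OmegaPrime_iff hx] at hu hv ⊢
  obtain ⟨hu0, hu1, hu2, hu3⟩ := hu
  obtain ⟨hv0, hv1, hv2, hv3⟩ := hv
  have hc := coe_combo u v a b
  have hab' : ENNReal.ofReal a + ENNReal.ofReal b = 1 := by
    rw [← ENNReal.ofReal_add ha hb, hab, ENNReal.ofReal_one]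
  refine ⟨?_, ?_, fun c hc' => ?_, ?_⟩
  · filter_upwards [hc, hu0, hv0] with t h1 h2 h3
    rw [h1]; positivity
  · exact ((hu1.const_mul a).add (hv1.const_mul b)).congr hc.symm
  · rw [Phi_congr hc]
    refine (Phi_combo_le hu1.1.aemeasurable ha hb hab c).trans ?_
    calc _ ≤ ENNReal.ofReal a * Phi x c + ENNReal.ofReal b * Phi x c := by
          gcongr
          · exact hu2 c hc'
          · exact hv2 c hc'
      _ = _ := by rw [← add_mul, hab', one_mul]
  · rw [Phi_congr hc]
    have : Phi (fun t => a * u t + b * v t) 0 =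
        ENNReal.ofReal a * Phi u 0 + ENNReal.ofReal b * Phi v 0 := by
      unfold Phi
      rw [← lintegral_const_mul' _ _ ENNReal.ofReal_ne_top,
        ← lintegral_const_mul' _ _ ENNReal.ofReal_ne_top, ← lintegral_add_left']
      · refine lintegral_congr_ae ?_
        filter_upwards [hu0, hv0] with t h2 h3
        simp only [sub_zero]
        rw [← ENNReal.ofReal_mul ha, ← ENNReal.ofReal_mul hb,
          ← ENNReal.ofReal_add (by positivity) (by positivity), abs_of_nonneg h2, abs_of_nonneg h3,
          abs_of_nonneg (by positivity)]
      · exact ((continuous_abs.measurable.comp_aemeasurable hu1.1.aemeasurable).sub_const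
          _).ennreal_ofReal.const_mul _
    rw [this, hu3, hv3, ← add_mul, hab', one_mul]

/-! ### The extreme points of the orbit -/

theorem mem_extremePoints_of_Phi_eq {x z : L0} (hx : MemL1 x) (h0 : ∀ᵐ t ∂mHalf, 0 ≤ z t)
    (hz : MemL1 z) (h : ∀ c, 0 ≤ c → Phi z c = Phi x c) : z ∈ extremePoints ℝ (OmegaPrime x) := by
  refine ⟨(mem_OmegaPrime_iff hx).2 ⟨h0, hz, fun c hc => (h c hc.le).le, h 0 le_rfl⟩, ?_⟩
  rintro u hu v hv ⟨a, b, ha, hb, hab, rfl⟩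
  rw [mem_OmegaPrime_iff hx] at hu hv
  obtain ⟨hu0, hu1, hu2, hu3⟩ := hu
  obtain ⟨hv0, hv1, hv2, hv3⟩ := hv
  have hc := coe_combo u v a b
  -- The combination already has the largest excess allowed at level `q`, so the pointwise convexity
  -- inequality for `(· - q)₊` integrates to an equality and holds with equality a.e. Rational
  -- levels keep the exceptional sets countable in number.
  have key : ∀ q : ℚ, 0 < (q : ℝ) → ∀ᵐ t ∂mHalf, max (a * u t + b * v t - q) 0 =
      a * max (u t - q) 0 + b * max (v t - q) 0 := by
    intro q hq
    have e1 : Phi (fun t => a * u t + b * v t) q = Phi x q := by rw [← Phi_congr hc, h q hq.le]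
    have hcombo : Integrable (fun t => a * u t + b * v t) mHalf :=
      (hu1.const_mul a).add (hv1.const_mul b)
    rw [Phi_eq_ofReal hcombo (by filter_upwards [hu0, hv0] with t h2 h3; positivity) hq.le] at e1
    have e2 := hu2 q hq
    have e3 := hv2 q hq
    rw [Phi_eq_ofReal hu1 hu0 hq.le, ← e1, ENNReal.ofReal_le_ofReal_iff (PhiR_nonneg _ _)] at e2
    rw [Phi_eq_ofReal hv1 hv0 hq.le, ← e1, ENNReal.ofReal_le_ofReal_iff (PhiR_nonneg _ _)] at e3
    have i1 := (integrable_excess hu1 hq.le).const_mul a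
    have i2 := (integrable_excess hv1 hq.le).const_mul b
    have i3 := integrable_excess hcombo hq.le
    have hle : ∀ t, max (a * u t + b * v t - q) 0 ≤ a * max (u t - q) 0 + b * max (v t - q) 0 := by
      intro t
      refine max_le ?_ (by positivity)
      calc a * u t + b * v t - q = a * (u t - q) + b * (v t - q) := by linear_combination (q : ℝ) * hab
        _ ≤ _ := by gcongr <;> exact le_max_left _ _
    have i4 : Integrable (fun t => (a * max (u t - q) 0 + b * max (v t - q) 0) -
        max (a * u t + b * v t - q) 0) mHalf := (i1.add i2).sub i3
    have hint : ∫ t, ((a * max (u t - q) 0 + b * max (v t - q) 0) -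
        max (a * u t + b * v t - q) 0) ∂mHalf = 0 := by
      refine le_antisymm ?_ (integral_nonneg fun t => sub_nonneg.2 (hle t))
      have : ∫ t, ((a * max (u t - q) 0 + b * max (v t - q) 0) -
          max (a * u t + b * v t - q) 0) ∂mHalf = a * PhiR u q + b * PhiR v q -
          PhiR (fun t => a * u t + b * v t) q := by
        have i12 : Integrable (fun t => a * max (u t - q) 0 + b * max (v t - q) 0) mHalf := i1.add i2
        rw [integral_sub i12 i3, integral_add i1 i2, integral_const_mul, integral_const_mul]
        rfl
      rw [this]
      have e4 := mul_le_mul_of_nonneg_left e2 ha.le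
      have e5 := mul_le_mul_of_nonneg_left e3 hb.le
      have e6 : a * PhiR (fun t => a * u t + b * v t) q + b * PhiR (fun t => a * u t + b * v t) q =
          PhiR (fun t => a * u t + b * v t) q := by rw [← add_mul, hab, one_mul]
      linarith
    have := (integral_eq_zero_iff_of_nonneg (fun t => sub_nonneg.2 (hle t)) i4).1 hint
    filter_upwards [this] with t ht
    simp only [Pi.zero_apply] at ht
    linarith
  have hall : ∀ᵐ t ∂mHalf, ∀ q : ℚ, 0 < (q : ℝ) → max (a * u t + b * v t - q) 0 =
      a * max (u t - q) 0 + b * max (v t - q) 0 := by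
    rw [ae_all_iff]
    intro q
    by_cases hq : 0 < (q : ℝ)
    · filter_upwards [key q hq] with t ht _ using ht
    · exact ae_of_all _ fun t h => absurd h hq
  have huv : ⇑u =ᵐ[mHalf] v := by
    filter_upwards [hall, hu0, hv0] with t ht h1 h2
    by_contra hne
    -- A level strictly between two different values makes the convexity inequality strict.
    have main : ∀ a b p q : ℝ, 0 < a → 0 < b → p < q → ∀ r, p < r → r < q →
        max (a * p + b * q - r) 0 = a * max (p - r) 0 + b * max (q - r) 0 → a + b = 1 → False := by
      intro a b p q ha hb hpq r hr1 hr2 he hab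
      rw [max_eq_right (by linarith : p - r ≤ 0), max_eq_left (by linarith : 0 ≤ q - r)] at he
      have h5 : 0 < b * (q - r) := mul_pos hb (by linarith)
      have h6 : a * p + b * q - r = a * (p - r) + b * (q - r) := by linear_combination r * hab
      have h7 : a * (p - r) < 0 := mul_neg_of_pos_of_neg ha (by linarith)
      have : max (a * p + b * q - r) 0 < b * (q - r) := max_lt (by linarith) h5
      linarith
    rcases lt_or_gt_of_ne hne with hlt | hlt
    · obtain ⟨q, hq1, hq2⟩ := exists_rat_btwn hlt
      exact main a b _ _ ha hb hlt q hq1 hq2 (ht q (h1.trans_lt hq1)) hab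
    · obtain ⟨q, hq1, hq2⟩ := exists_rat_btwn hlt
      refine main b a _ _ hb ha hlt q hq1 hq2 ?_ (by linarith)
      have := ht q (h2.trans_lt hq1)
      rw [add_comm (b * _), add_comm (b * _)]
      exact this
  refine AEEqFun.ext ?_
  filter_upwards [huv, hc] with t h1 h2
  rw [h2, ← h1]
  linear_combination (-u t) * hab

theorem Phi_eq_ofReal_abs {f : ℝ → ℝ} (hf : Integrable f mHalf) {c : ℝ} (hc : 0 ≤ c) :
    Phi f c = ENNReal.ofReal (PhiR (fun t => |f t|) c) := by
  rw [← Phi_eq_ofReal hf.abs (ae_of_all _ fun t => abs_nonneg _) hc]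
  simp [Phi]

/-- Perturbing `z` on a set where its values lie in `[p + η, q - η]` changes the excess only over
levels in `[p, q]`, and there by at most the `L₁`-norm of the perturbation. -/
theorem add_perturbation_mem_OmegaPrime {x z : L0} (hx : MemL1 x) (hz : z ∈ OmegaPrime x)
    {p q η ε : ℝ} (hp : 0 < p) {h : ℝ → ℝ} (hh : Integrable h mHalf)
    (hsupp : ∀ t, h t ≠ 0 → p + η ≤ z t ∧ z t ≤ q - η) (hbd : ∀ t, |h t| ≤ η)
    (hint : ∫ t, h t ∂mHalf = 0) (hnorm : ∫ t, |h t| ∂mHalf ≤ ε)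
    (hgap : ∀ c, p ≤ c → c ≤ q → PhiR z c + ε ≤ (Phi x c).toReal) :
    AEEqFun.mk (fun t => z t + h t) (((mem_OmegaPrime_iff hx).1 hz).2.1.add hh).1 ∈
      OmegaPrime x := by
  obtain ⟨h0, h1, h2, h3⟩ := (mem_OmegaPrime_iff hx).1 hz
  have hi : Integrable (fun t => z t + h t) mHalf := h1.add hh
  have hnn : ∀ᵐ t ∂mHalf, 0 ≤ z t + h t := by
    filter_upwards [h0] with t ht
    by_cases hht : h t = 0
    · simpa [hht] using ht
    · linarith [(hsupp t hht).1, neg_le_of_abs_le (hbd t)]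
  have hlow : ∀ c, 0 ≤ c → c ≤ p → Phi (fun t => z t + h t) c = Phi z c := by
    intro c hc hcp
    rw [Phi_eq_ofReal hi hnn hc, Phi_eq_ofReal h1 h0 hc]
    congr 1
    have : PhiR (fun t => z t + h t) c = ∫ t, (max (z t - c) 0 + h t) ∂mHalf := by
      refine integral_congr_ae (ae_of_all _ fun t => ?_)
      simp only
      by_cases hht : h t = 0
      · simp [hht]
      · have := (hsupp t hht).1
        have hb := neg_le_of_abs_le (hbd t)
        have hb' := (abs_nonneg _).trans (hbd t)
        rw [max_eq_left (by linarith), max_eq_left (by linarith)]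
        ring
    rw [this, integral_add (integrable_excess h1 hc) hh, hint, add_zero]
    rfl
  refine mk_mem_OmegaPrime hx hi hnn (fun c hc => ?_) (by rw [hlow 0 le_rfl hp.le, h3])
  rcases le_or_gt c p with hcp | hcp
  · rw [hlow c hc.le hcp]; exact h2 c hc
  rcases le_or_gt c q with hcq | hcq
  · have e := hgap c hcp.le hcq
    rw [Phi_eq_ofReal hi hnn hc.le, ← ENNReal.ofReal_toReal (Phi_lt_top hx hc.le).ne]
    refine ENNReal.ofReal_le_ofReal (le_trans ?_ e)
    have : PhiR (fun t => z t + h t) c ≤ ∫ t, (max (z t - c) 0 + |h t|) ∂mHalf := by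
      refine integral_mono (integrable_excess hi hc.le)
        ((integrable_excess h1 hc.le).add hh.abs) fun t => ?_
      refine max_le ?_ (add_nonneg (le_max_right _ _) (abs_nonneg _))
      have := le_max_left (z t - c) 0
      have := le_abs_self (h t)
      simp only
      linarith
    rw [integral_add (integrable_excess h1 hc.le) hh.abs] at this
    have e2 : ∫ t, max (z t - c) 0 ∂mHalf = PhiR z c := rfl
    linarith
  · refine le_trans (le_of_eq ?_) (h2 c hc)
    rw [Phi_eq_ofReal hi hnn hc.le, Phi_eq_ofReal h1 h0 hc.le]
    congr 1
    refine integral_congr_ae (ae_of_all _ fun t => ?_)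
    simp only
    by_cases hht : h t = 0
    · simp [hht]
    · have := (hsupp t hht).2
      have hb := le_of_abs_le (hbd t)
      have hb' := (abs_nonneg _).trans (hbd t)
      rw [max_eq_right (by linarith), max_eq_right (by linarith)]

/-- Both excesses are continuous at positive levels, so their difference attains a positive minimum
on the compact interval `[p, q]`. -/
theorem exists_gap {x z : L0} (hx : MemL1 x) (hz : z ∈ OmegaPrime x) {p q : ℝ} (hp : 0 < p)
    (hgap : ∀ c, p ≤ c → c ≤ q → Phi z c < Phi x c) :
    ∃ ε > 0, ∀ c, p ≤ c → c ≤ q → PhiR z c + ε ≤ (Phi x c).toReal := by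
  obtain ⟨h0, h1, h2, h3⟩ := (mem_OmegaPrime_iff hx).1 hz
  rcases lt_or_ge q p with hpq | hpq
  · exact ⟨1, one_pos, fun c h h' => by linarith⟩
  have hxa : ∀ c ∈ Icc p q, (Phi x c).toReal = PhiR (fun t => |x t|) c := fun c hc => by
    rw [Phi_eq_ofReal_abs hx (hp.le.trans hc.1), ENNReal.toReal_ofReal (PhiR_nonneg _ _)]
  have hcont : ∀ f : ℝ → ℝ, Integrable f mHalf → ContinuousOn (PhiR f) (Icc p q) := fun f hf =>
    (ConvexOn.continuousOn isOpen_Ioi ((convexOn_PhiR hf).subset Ioi_subset_Ici_self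
      (convex_Ioi 0))).mono fun c hc => hp.trans_le hc.1
  have hc : ContinuousOn (fun c => (Phi x c).toReal - PhiR z c) (Icc p q) :=
    ((hcont _ hx.abs).congr hxa).sub (hcont _ h1)
  obtain ⟨c0, hc0, hmin⟩ := isCompact_Icc.exists_isMinOn ⟨p, left_mem_Icc.2 hpq⟩ hc
  refine ⟨(Phi x c0).toReal - PhiR z c0, ?_, fun c h h' => ?_⟩
  · have := hgap c0 hc0.1 hc0.2
    have hc0' : 0 ≤ c0 := hp.le.trans hc0.1
    rw [Phi_eq_ofReal h1 h0 hc0', ENNReal.ofReal_lt_iff_lt_toReal (PhiR_nonneg _ _)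
      (Phi_lt_top hx hc0').ne] at this
    linarith
  · have := hmin (show c ∈ Icc p q from ⟨h, h'⟩)
    simp only [mem_ofPred_eq] at this
    linarith

-- Otherwise `z` takes values well inside `(p, q)` on a set of positive measure. Adding and
-- subtracting a small constant with opposite signs on two halves of that set stays in `Ω'(x)`,
-- because of the gap, and contradicts extremality.
open Classical in
theorem measure_between_eq_zero {x z : L0} (hx : MemL1 x)
    (hz : z ∈ extremePoints ℝ (OmegaPrime x)) {p q : ℝ} (hp : 0 < p)
    (hgap : ∀ c, p ≤ c → c ≤ q → Phi z c < Phi x c) : mHalf {t | p < z t ∧ z t < q} = 0 := by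
  obtain ⟨h0, h1, h2, h3⟩ := (mem_OmegaPrime_iff hx).1 hz.1
  obtain ⟨ε, hε, hgap'⟩ := exists_gap hx hz.1 hp hgap
  have hzm : Measurable z := z.measurable
  by_contra hne
  have hU : {t | p < z t ∧ z t < q} ⊆
      ⋃ n : ℕ, {t | p + 1 / ((n : ℝ) + 1) ≤ z t ∧ z t ≤ q - 1 / ((n : ℝ) + 1)} := by
    intro t ht
    obtain ⟨n, hn⟩ := exists_nat_one_div_lt (lt_min (sub_pos.2 ht.1) (sub_pos.2 ht.2))
    rw [lt_min_iff] at hn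
    exact mem_iUnion.2 ⟨n, ⟨by linarith, by linarith⟩⟩
  obtain ⟨n, hn⟩ : ∃ n : ℕ, mHalf {t | p + 1 / ((n : ℝ) + 1) ≤ z t ∧
      z t ≤ q - 1 / ((n : ℝ) + 1)} ≠ 0 := by
    by_contra! hall
    exact hne (measure_mono_null hU (measure_iUnion_null hall))
  set η0 : ℝ := 1 / ((n : ℝ) + 1) with hη0
  have hη0pos : 0 < η0 := by positivity
  set A := {t | p + η0 ≤ z t ∧ z t ≤ q - η0} with hA
  have hAm : MeasurableSet A :=
    (measurableSet_le measurable_const hzm).inter (measurableSet_le hzm measurable_const)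
  have hAfin : mHalf A ≠ ∞ := by
    refine ((measure_mono fun t ht => ?_).trans_lt (mHalf_gt_lt_top h1 hp)).ne
    exact (show p < |z t| by linarith [ht.1, le_abs_self (z t)])
  obtain ⟨B, hBA, hBm, hB1, hB2⟩ := exists_halves hAm hn hAfin
  set M := (mHalf A).toReal with hM
  have hMpos : 0 < M := ENNReal.toReal_pos hn hAfin
  -- The first bound keeps the perturbed values between `p` and `q`; the second makes the `L₁`-norm
  -- `M η` of the perturbation at most the gap `ε`.
  set η := min η0 (ε / M) with hη
  have hηpos : 0 < η := lt_min hη0pos (div_pos hε hMpos)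
  have hBfin : mHalf B ≠ ∞ := (lt_of_le_of_lt (measure_mono hBA) hAfin.lt_top).ne
  have hCfin : mHalf (A \ B) ≠ ∞ := (lt_of_le_of_lt (measure_mono sdiff_subset) hAfin.lt_top).ne
  have hCm : MeasurableSet (A \ B) := hAm.diff hBm
  set h : ℝ → ℝ := fun t => B.indicator (fun _ => η) t - (A \ B).indicator (fun _ => η) t with hh
  have iB : Integrable (B.indicator fun _ => η) mHalf :=
    (integrable_indicator_iff hBm).2 (integrableOn_const hBfin)
  have iC : Integrable ((A \ B).indicator fun _ => η) mHalf :=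
    (integrable_indicator_iff hCm).2 (integrableOn_const hCfin)
  have hhi : Integrable h mHalf := iB.sub iC
  have hval : ∀ t, h t = if t ∈ B then η else if t ∈ A then -η else 0 := by
    intro t
    by_cases hb : t ∈ B
    · simp [hh, hb]
    · by_cases ha : t ∈ A <;> simp [hh, hb, ha]
  have habs : ∀ t, |h t| = A.indicator (fun _ => η) t := by
    intro t
    rw [hval]
    by_cases hb : t ∈ B
    · simp [hb, hBA hb, abs_of_pos hηpos]
    · by_cases ha : t ∈ A <;> simp [hb, ha, abs_of_pos hηpos]
  have hsupp : ∀ t, h t ≠ 0 → p + η ≤ z t ∧ z t ≤ q - η := by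
    intro t ht
    have ha : t ∈ A := by
      by_contra ha
      have := habs t
      rw [indicator_of_notMem ha, abs_eq_zero] at this
      exact ht this
    have := min_le_left η0 (ε / M)
    exact ⟨by linarith [ha.1], by linarith [ha.2]⟩
  have hbd : ∀ t, |h t| ≤ η := fun t => by
    rw [habs]; exact indicator_le_self' (fun _ _ => hηpos.le) t
  have hint : ∫ t, h t ∂mHalf = 0 := by
    rw [integral_sub iB iC, integral_indicator_const _ hBm, integral_indicator_const _ hCm,
      measureReal_def, measureReal_def, hB1, hB2, sub_self]
  have hnorm : ∫ t, |h t| ∂mHalf ≤ ε := by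
    simp only [habs]
    rw [integral_indicator_const _ hAm, measureReal_def, ← hM, smul_eq_mul]
    calc M * η ≤ M * (ε / M) := by gcongr; exact min_le_right _ _
      _ = ε := mul_div_cancel₀ _ hMpos.ne'
  have m1 := add_perturbation_mem_OmegaPrime hx hz.1 hp hhi hsupp hbd hint hnorm hgap'
  have m2 := add_perturbation_mem_OmegaPrime hx hz.1 hp (h := fun t => -h t) hhi.neg
    (fun t ht => hsupp t (neg_ne_zero.1 ht)) (fun t => by rw [abs_neg]; exact hbd t)
    (by rw [integral_neg, hint, neg_zero]) (by simpa only [abs_neg] using hnorm) hgap'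
  have e := hz.2 m1 m2 ⟨1 / 2, 1 / 2, by norm_num, by norm_num, by norm_num, by
    refine AEEqFun.ext ?_
    filter_upwards [coe_combo (AEEqFun.mk (fun t => z t + h t) (h1.add hhi).1)
      (AEEqFun.mk (fun t => z t + -h t) (h1.add hhi.neg).1) (1 / 2) (1 / 2),
      AEEqFun.coeFn_mk (fun t => z t + h t) (h1.add hhi).1,
      AEEqFun.coeFn_mk (fun t => z t + -h t) (h1.add hhi.neg).1] with t e1 e2 e3
    rw [e1, e2, e3]
    ring⟩
  have e0 : ∀ᵐ t ∂mHalf, t ∉ A := by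
    filter_upwards [AEEqFun.coeFn_mk (fun t => z t + h t) (h1.add hhi).1] with t e1 ha
    rw [e] at e1
    have : h t = 0 := by linarith
    have e2 := habs t
    rw [this, abs_zero, indicator_of_mem ha] at e2
    linarith
  exact hn (measure_eq_zero_iff_ae_notMem.2 e0)

/-- Suppose the excesses differ at `c`, and let `(α, β)` be the surrounding interval where they
differ. An extreme `z` takes no values there, so its excess is affine on `[α, β]`. The excess of `x`
is convex and agrees with it at the ends, hence lies below it, a contradiction. -/
theorem Phi_eq_of_mem_extremePoints {x z : L0} (hx : MemL1 x)
    (hz : z ∈ extremePoints ℝ (OmegaPrime x)) {c : ℝ} (hc : 0 ≤ c) : Phi z c = Phi x c := by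
  obtain ⟨h0, h1, h2, h3⟩ := (mem_OmegaPrime_iff hx).1 hz.1
  rcases hc.eq_or_lt with rfl | hc
  · exact h3
  refine le_antisymm (h2 c hc) ?_
  by_contra! hlt
  have hxa : ∀ c, 0 ≤ c → Phi x c = ENNReal.ofReal (PhiR (fun t => |x t|) c) :=
    fun c hc => Phi_eq_ofReal_abs hx hc
  set D : ℝ → ℝ := fun c => PhiR (fun t => |x t|) c - PhiR z c with hD
  have hDnn : ∀ c, 0 ≤ c → 0 ≤ D c := by
    intro c hc
    rcases hc.eq_or_lt with rfl | hc
    · rw [hxa 0 le_rfl, Phi_eq_ofReal h1 h0 le_rfl,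
        ENNReal.ofReal_eq_ofReal_iff (PhiR_nonneg _ _) (PhiR_nonneg _ _)] at h3
      exact sub_nonneg.2 h3.le
    · have := h2 c hc
      rw [hxa c hc.le, Phi_eq_ofReal h1 h0 hc.le,
        ENNReal.ofReal_le_ofReal_iff (PhiR_nonneg _ _)] at this
      exact sub_nonneg.2 this
  have hD0 : D 0 = 0 := by
    rw [hxa 0 le_rfl, Phi_eq_ofReal h1 h0 le_rfl,
        ENNReal.ofReal_eq_ofReal_iff (PhiR_nonneg _ _) (PhiR_nonneg _ _)] at h3
    simp [hD, h3]
  have hDpos : ∀ c, 0 ≤ c → D c ≠ 0 → Phi z c < Phi x c := by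
    intro c hc hne
    have : 0 < D c := lt_of_le_of_ne (hDnn c hc) (Ne.symm hne)
    rw [hxa c hc, Phi_eq_ofReal h1 h0 hc, ENNReal.ofReal_lt_ofReal_iff_of_nonneg (PhiR_nonneg _ _)]
    exact sub_pos.1 this
  have hDc : D c ≠ 0 := by
    intro h
    rw [hxa c hc.le, Phi_eq_ofReal h1 h0 hc.le, show PhiR z c = PhiR (fun t => |x t|) c by
      simp only [hD] at h; linarith] at hlt
    exact lt_irrefl _ hlt
  have hcontf : ∀ f : ℝ → ℝ, Integrable f mHalf → ContinuousOn (PhiR f) (Ioi 0) := fun f hf =>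
    ConvexOn.continuousOn isOpen_Ioi ((convexOn_PhiR hf).subset Ioi_subset_Ici_self (convex_Ioi 0))
  have hDcont : ContinuousOn D (Ioi 0) := (hcontf _ hx.abs).sub (hcontf _ h1)
  -- the nearest zero of `D` below `c`
  obtain ⟨α, hα0, hαc, hDα, hαmax⟩ : ∃ α, 0 ≤ α ∧ α < c ∧ D α = 0 ∧
      ∀ d, α < d → d ≤ c → D d ≠ 0 := by
    set S := {d | 0 ≤ d ∧ d ≤ c ∧ D d = 0} with hS
    have hne : S.Nonempty := ⟨0, le_rfl, hc.le, hD0⟩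
    have hbdd : BddAbove S := ⟨c, fun d hd => hd.2.1⟩
    have h1 : 0 ≤ sSup S := le_csSup hbdd ⟨le_rfl, hc.le, hD0⟩
    have h2 : sSup S ≤ c := csSup_le hne fun d hd => hd.2.1
    have h3 : D (sSup S) = 0 := by
      rcases h1.eq_or_lt with h | h
      · rw [← h, hD0]
      · obtain ⟨u, -, hu, huS⟩ := exists_seq_tendsto_sSup hne hbdd
        have := (hDcont.continuousAt (Ioi_mem_nhds h)).tendsto.comp hu
        refine tendsto_nhds_unique this ?_
        refine tendsto_const_nhds.congr fun n => ((huS n).2.2).symm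
    refine ⟨sSup S, h1, lt_of_le_of_ne h2 fun h => hDc (h ▸ h3), h3, fun d hd hdc h => ?_⟩
    exact absurd (le_csSup hbdd (show d ∈ S from ⟨h1.trans hd.le, hdc, h⟩)) (not_le.2 hd)
  have hnull : ∀ β, (∀ d, α < d → d < β → D d ≠ 0) → mHalf {t | α < z t ∧ z t < β} = 0 := by
    intro β hβ
    have hU : {t | α < z t ∧ z t < β} ⊆ ⋃ n : ℕ, {t | α + 1 / ((n : ℝ) + 1) < z t ∧
        z t < β - 1 / ((n : ℝ) + 1)} := by
      intro t ht
      obtain ⟨n, hn⟩ := exists_nat_one_div_lt (lt_min (sub_pos.2 ht.1) (sub_pos.2 ht.2))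
      rw [lt_min_iff] at hn
      exact mem_iUnion.2 ⟨n, ⟨by linarith, by linarith⟩⟩
    refine measure_mono_null hU (measure_iUnion_null fun n => ?_)
    have hn : (0 : ℝ) < 1 / ((n : ℝ) + 1) := by positivity
    exact measure_between_eq_zero hx hz (by linarith) fun d hd hd' =>
      hDpos d (by linarith) (hβ d (by linarith) (by linarith))
  by_cases hex : ∃ d, c ≤ d ∧ D d = 0
  · obtain ⟨β, hcβ, hDβ, hβmin⟩ : ∃ β, c < β ∧ D β = 0 ∧ ∀ d, c ≤ d → d < β → D d ≠ 0 := by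
      set S := {d | c ≤ d ∧ D d = 0} with hS
      have hne : S.Nonempty := hex
      have hbdd : BddBelow S := ⟨c, fun d hd => hd.1⟩
      have h1 : c ≤ sInf S := le_csInf hne fun d hd => hd.1
      have h3 : D (sInf S) = 0 := by
        obtain ⟨u, -, hu, huS⟩ := exists_seq_tendsto_sInf hne hbdd
        have := (hDcont.continuousAt (Ioi_mem_nhds (hc.trans_le h1))).tendsto.comp hu
        refine tendsto_nhds_unique this ?_
        refine tendsto_const_nhds.congr fun n => ((huS n).2).symm
      refine ⟨sInf S, lt_of_le_of_ne h1 fun h => hDc (h.symm ▸ h3), h3, fun d hd hdc h => ?_⟩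
      exact absurd (csInf_le hbdd (show d ∈ S from ⟨hd, h⟩)) (not_le.2 hdc)
    have hn := hnull β fun d hd hd' => by
      rcases le_total d c with h | h
      · exact hαmax d hd h
      · exact hβmin d h hd'
    have hαβ : 0 < β - α := by linarith
    set w1 := (β - c) / (β - α) with hw1
    set w2 := (c - α) / (β - α) with hw2
    have hw1' : 0 ≤ w1 := div_nonneg (by linarith) hαβ.le
    have hw2' : 0 ≤ w2 := div_nonneg (by linarith) hαβ.le
    have hws : w1 + w2 = 1 := by rw [hw1, hw2]; field_simp; ring
    have hwc : w1 * α + w2 * β = c := by rw [hw1, hw2]; field_simp; ring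
    have hcx := (convexOn_PhiR hx.abs).2 (show α ∈ Ici (0 : ℝ) from hα0)
      (show β ∈ Ici (0 : ℝ) from (hc.trans hcβ).le) hw1' hw2' hws
    simp only [smul_eq_mul, hwc] at hcx
    -- For each value of `z` outside `(α, β)` the function `d ↦ (z(t) - d)₊` is affine on `[α, β]`.
    have hcz : PhiR z c = w1 * PhiR z α + w2 * PhiR z β := by
      unfold PhiR
      rw [← integral_const_mul, ← integral_const_mul, ← integral_add
        ((integrable_excess h1 hα0).const_mul _)
        ((integrable_excess h1 (hc.trans hcβ).le).const_mul _)]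
      refine integral_congr_ae ?_
      have : ∀ᵐ t ∂mHalf, ¬ (α < z t ∧ z t < β) := measure_eq_zero_iff_ae_notMem.1 hn
      filter_upwards [this] with t ht
      rcases le_or_gt (z t) α with h | h
      · rw [max_eq_right (by linarith), max_eq_right (by linarith), max_eq_right (by linarith)]
        ring
      · have h' : β ≤ z t := by
          by_contra! h'; exact ht ⟨h, h'⟩
        rw [max_eq_left (by linarith), max_eq_left (by linarith), max_eq_left (by linarith)]
        linear_combination (-z t) * hws + hwc
    have e1 : PhiR (fun t => |x t|) α = PhiR z α := by simp only [hD] at hDα; linarith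
    have e2 : PhiR (fun t => |x t|) β = PhiR z β := by simp only [hD] at hDβ; linarith
    rw [e1, e2, ← hcz] at hcx
    exact hDc (le_antisymm (by simp only [hD]; linarith) (hDnn c hc.le))
  · push Not at hex
    have hn : ∀ᵐ t ∂mHalf, ∀ n : ℕ, ¬ (α < z t ∧ z t < n) := by
      rw [ae_all_iff]
      intro n
      have := hnull n fun d hd _ => by
        rcases le_total d c with h | h
        · exact hαmax d hd h
        · exact hex d h
      exact measure_eq_zero_iff_ae_notMem.1 this
    -- The unbounded case `β = ∞`: here `z ≤ α` a.e., so both excesses vanish at `α` and therefore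
    -- at `c`.
    have hz0 : PhiR z α = 0 := by
      refine integral_eq_zero_of_ae ?_
      filter_upwards [hn] with t ht
      obtain ⟨n, hn⟩ := exists_nat_gt (z t)
      have : z t ≤ α := by by_contra! h; exact ht n ⟨h, hn⟩
      simp [this]
    have e1 : PhiR (fun t => |x t|) α = 0 := by simp only [hD] at hDα; linarith
    have e2 := PhiR_antitone hx.abs (show α ∈ Ici (0 : ℝ) from hα0)
      (show c ∈ Ici (0 : ℝ) from hc.le) hαc.le
    have e3 := PhiR_nonneg z c
    exact hDc (le_antisymm (by simp only [hD]; linarith) (hDnn c hc.le))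

/-! ### Bounded inclusion of `E` in `L₁`, and `Q'(x) ⊆ Ω'(x)` -/

section

variable {E : Type*} [NormedAddCommGroup E] [NormedSpace ℝ E] {ι : E →ₗ[ℝ] L0}

theorem ae_eq_zero_of_EN_eq_zero (hι : Function.Injective ι) {f : ℝ → ℝ} (h : EN ι f = 0) :
    f =ᵐ[mHalf] fun _ => 0 := by
  obtain ⟨z, hz⟩ := exists_of_EN_lt_top (h.trans_lt ENNReal.zero_lt_top)
  rw [EN_eq_of_ae hι hz, enorm_eq_zero] at h
  subst h
  rw [map_zero] at hz
  exact hz.symm.trans AEEqFun.coeFn_zero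

theorem coe_sub' (u v : E) : ⇑(ι (u - v)) =ᵐ[mHalf] fun t => ι u t - ι v t := by
  rw [map_sub]
  exact AEEqFun.coeFn_sub _ _

/-- The negative part of the limit is dominated by the modulus of the difference with each term of
the tail, so its norm is zero. -/
theorem nonneg_of_tendsto (hE : IsSymmetric ι) {u : E} {s : ℕ → E}
    (hs : Tendsto s atTop (𝓝 u)) (h : ∀ᶠ n in atTop, ∀ᵐ t ∂mHalf, 0 ≤ ι (s n) t) :
    ∀ᵐ t ∂mHalf, 0 ≤ ι u t := by
  have key : EN ι (fun t => max (-(ι u t)) 0) = 0 := by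
    refine le_antisymm ?_ zero_le
    have hlim : Tendsto (fun n => ‖s n - u‖ₑ) atTop (𝓝 0) := by
      have := (continuous_enorm.tendsto _).comp (tendsto_sub_nhds_zero_iff.2 hs)
      rwa [enorm_zero] at this
    refine ge_of_tendsto hlim (h.mono fun n hn => ?_)
    rw [← EN_eq_of_ae hE.injective (ae_eq_refl (⇑(ι (s n - u))))]
    refine EN_mono hE ((ι u).aestronglyMeasurable.neg.sup aestronglyMeasurable_const) ?_
    filter_upwards [hn, coe_sub' (s n) u] with t h1 h2
    rw [h2, abs_of_nonneg (le_max_right _ _)]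
    exact max_le ((by linarith : _ ≤ ι (s n) t - ι u t).trans (le_abs_self _)) (abs_nonneg _)
  filter_upwards [ae_eq_zero_of_EN_eq_zero hE.injective key] with t ht
  linarith [le_max_left (-(ι u t)) 0]

/-- A positive map from a Banach lattice is bounded. If `‖z_n‖₁ > 4^n ‖z_n‖` for all `n`, the sum of
`2^{-n} |z_n| / ‖z_n‖` converges in `E` and dominates each of its terms, whose `L₁`-norms exceed
`2^n`. -/
theorem exists_eLpNorm_le [CompleteSpace E] (hE : IsSymmetric ι) (hL1 : ∀ z : E, MemL1 (ι z)) :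
    ∃ K : ℝ, 0 < K ∧ ∀ z : E, eLpNorm (ι z) 1 mHalf ≤ ENNReal.ofReal (K * ‖z‖) := by
  by_contra! hcon
  choose z hz using fun n : ℕ => hcon (4 ^ n) (by positivity)
  have hz0 : ∀ n, 0 < ‖z n‖ := by
    intro n
    rw [norm_pos_iff]
    intro h
    have := hz n
    rw [h, map_zero, eLpNorm_congr_ae (AEEqFun.coeFn_zero : ⇑(0 : L0) =ᵐ[mHalf] 0)] at this
    simp at this
  choose w hw hwz using fun n => hE.ideal (z n) |ι (z n)| (by
    rw [← AEEqFun.coeFn_le]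
    filter_upwards [AEEqFun.coeFn_abs (ι (z n)), AEEqFun.coeFn_abs |ι (z n)|] with t h1 h2
    rw [h2, h1, abs_abs])
  set u : ℕ → E := fun n => ((2 : ℝ) ^ n * ‖z n‖)⁻¹ • w n with hu
  have hu_coe : ∀ n, ⇑(ι (u n)) =ᵐ[mHalf] fun t => ((2 : ℝ) ^ n * ‖z n‖)⁻¹ * |ι (z n) t| := by
    intro n
    rw [hu, map_smul, hw]
    filter_upwards [AEEqFun.coeFn_smul ((2 : ℝ) ^ n * ‖z n‖)⁻¹ |ι (z n)|,
      AEEqFun.coeFn_abs (ι (z n))] with t h1 h2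
    rw [h1, Pi.smul_apply, h2, smul_eq_mul]
  have hu_norm : ∀ n, ‖u n‖ ≤ (1 / 2 : ℝ) ^ n := by
    intro n
    have := hz0 n
    rw [hu, norm_smul, norm_inv, Real.norm_of_nonneg (by positivity), inv_mul_le_iff₀ (by positivity),
      mul_right_comm, ← mul_pow]
    norm_num
    exact hwz n
  have hu_nn : ∀ n, ∀ᵐ t ∂mHalf, 0 ≤ ι (u n) t := fun n => by
    filter_upwards [hu_coe n] with t ht
    rw [ht]; positivity
  have hsum : Summable u :=
    Summable.of_norm_bounded (summable_geometric_of_lt_one (by norm_num) (by norm_num)) hu_norm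
  obtain ⟨v, hv⟩ := hsum
  have hge : ∀ n, ∀ᵐ t ∂mHalf, ι (u n) t ≤ ι v t := by
    intro n
    have h1 : Tendsto (fun N => ∑ i ∈ Finset.range N, u i - u n) atTop (𝓝 (v - u n)) :=
      hv.tendsto_sum_nat.sub_const _
    have h2 := nonneg_of_tendsto hE h1 (by
      filter_upwards [eventually_gt_atTop n] with N hN
      have : ∑ i ∈ Finset.range N, u i - u n = ∑ i ∈ (Finset.range N).erase n, u i := by
        rw [← Finset.sum_erase_add _ _ (Finset.mem_range.2 hN), add_sub_cancel_right]
      rw [this]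
      generalize (Finset.range N).erase n = S
      classical
      induction S using Finset.induction_on with
      | empty =>
        rw [Finset.sum_empty, map_zero]
        filter_upwards [(AEEqFun.coeFn_zero : ⇑(0 : L0) =ᵐ[mHalf] 0)] with t ht
        rw [ht]; rfl
      | insert a S ha ih =>
        rw [Finset.sum_insert ha, map_add]
        filter_upwards [ih, hu_nn a, AEEqFun.coeFn_add (ι (u a)) (ι (∑ i ∈ S, u i))]
          with t h1 h2 h3
        rw [h3]
        exact add_nonneg h2 h1)
    filter_upwards [h2, coe_sub' v (u n)] with t h3 h4
    rw [h4] at h3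
    linarith
  have hbig : ∀ n : ℕ, ENNReal.ofReal (2 ^ n) ≤ eLpNorm (ι v) 1 mHalf := by
    intro n
    have h0 := hz0 n
    have h1 : eLpNorm (ι (u n)) 1 mHalf ≤ eLpNorm (ι v) 1 mHalf := by
      refine eLpNorm_mono_ae ?_
      filter_upwards [hge n, hu_nn n] with t h1 h2
      rw [Real.norm_of_nonneg h2]
      exact h1.trans (le_abs_self _)
    refine le_trans ?_ h1
    have h2 : eLpNorm (ι (u n)) 1 mHalf = ENNReal.ofReal ((2 : ℝ) ^ n * ‖z n‖)⁻¹ *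
        eLpNorm (ι (z n)) 1 mHalf := by
      rw [eLpNorm_congr_ae (hu_coe n), eLpNorm_one_eq_lintegral_enorm,
        eLpNorm_one_eq_lintegral_enorm, ← lintegral_const_mul' _ _ ENNReal.ofReal_ne_top]
      refine lintegral_congr fun t => ?_
      rw [enorm_mul, Real.enorm_eq_ofReal (by positivity), Real.enorm_abs]
    rw [h2]
    calc ENNReal.ofReal (2 ^ n) = ENNReal.ofReal ((2 : ℝ) ^ n * ‖z n‖)⁻¹ *
          ENNReal.ofReal (4 ^ n * ‖z n‖) := by
          rw [← ENNReal.ofReal_mul (by positivity)]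
          congr 1
          rw [show (4 : ℝ) = 2 * 2 by norm_num, mul_pow]
          field_simp
      _ ≤ _ := by gcongr; exact (hz n).le
  have hfin : eLpNorm (ι v) 1 mHalf < ∞ := (memLp_one_iff_integrable.2 (hL1 v)).2
  obtain ⟨n, hn⟩ := pow_unbounded_of_one_lt (eLpNorm (ι v) 1 mHalf).toReal (one_lt_two : (1 : ℝ) < 2)
  have := hbig n
  rw [ENNReal.ofReal_le_iff_le_toReal hfin.ne] at this
  linarith

theorem Phi_le_add (f g : ℝ → ℝ) (hg : AEMeasurable g mHalf) (c : ℝ) :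
    Phi f c ≤ Phi g c + eLpNorm (fun t => f t - g t) 1 mHalf := by
  rw [eLpNorm_one_eq_lintegral_enorm, Phi, Phi, ← lintegral_add_left']
  · refine lintegral_mono fun t => ?_
    simp only
    rw [Real.enorm_eq_ofReal_abs]
    refine le_trans (ENNReal.ofReal_le_ofReal ?_) ENNReal.ofReal_add_le
    linarith [abs_sub_abs_le_abs_sub (f t) (g t)]
  · exact ((continuous_abs.measurable.comp_aemeasurable hg).sub_const _).ennreal_ofReal

/-- The orbit is convex, and each condition defining it survives limits in `E`: positivity by
`nonneg_of_tendsto`, and the excess conditions since the excess is 1-Lipschitz in `L₁`. -/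
theorem QPrime_subset_OmegaPrime [CompleteSpace E] (hE : IsSymmetric ι)
    (hL1 : ∀ z : E, MemL1 (ι z)) (x : E) : QPrime ι (ι x) ⊆ OmegaPrime (ι x) := by
  rintro _ ⟨z, hz, rfl⟩
  have hsub : convexHull ℝ (ι ⁻¹' extremePoints ℝ (OmegaPrime (ι x))) ⊆
      ι ⁻¹' OmegaPrime (ι x) := by
    refine convexHull_min (preimage_mono extremePoints_subset) ?_
    exact (convex_OmegaPrime (hL1 x)).is_linear_preimage ι.isLinear
  obtain ⟨s, hs, hlim⟩ := mem_closure_iff_seq_limit.1 hz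
  have hs' : ∀ n, ι (s n) ∈ OmegaPrime (ι x) := fun n => hsub (hs n)
  simp only [mem_OmegaPrime_iff (hL1 x)] at hs' ⊢
  obtain ⟨K, hK, hKle⟩ := exists_eLpNorm_le hE hL1
  have hdist : Tendsto (fun n => ENNReal.ofReal (K * ‖z - s n‖)) atTop (𝓝 0) := by
    have h1 : Tendsto (fun n => K * ‖z - s n‖) atTop (𝓝 (K * ‖z - z‖)) :=
      ((tendsto_const_nhds.sub hlim).norm).const_mul K
    rw [sub_self, norm_zero, mul_zero] at h1
    have := ENNReal.tendsto_ofReal h1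
    rwa [ENNReal.ofReal_zero] at this
  have hle1 : ∀ n c, Phi (ι z) c ≤ Phi (ι (s n)) c + ENNReal.ofReal (K * ‖z - s n‖) := by
    intro n c
    refine (Phi_le_add _ _ (hL1 (s n)).1.aemeasurable c).trans (add_le_add_right ?_ _)
    rw [← eLpNorm_congr_ae (coe_sub' z (s n))]
    exact hKle _
  have hle2 : ∀ n c, Phi (ι (s n)) c ≤ Phi (ι z) c + ENNReal.ofReal (K * ‖z - s n‖) := by
    intro n c
    refine (Phi_le_add _ _ (hL1 z).1.aemeasurable c).trans (add_le_add_right ?_ _)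
    rw [← eLpNorm_congr_ae (coe_sub' (s n) z), norm_sub_rev]
    exact hKle _
  refine ⟨nonneg_of_tendsto hE hlim (Eventually.of_forall fun n => (hs' n).1), hL1 z,
    fun c hc => ?_, le_antisymm ?_ ?_⟩
  · have h1 : Tendsto (fun n => Phi (ι x) c + ENNReal.ofReal (K * ‖z - s n‖)) atTop
        (𝓝 (Phi (ι x) c + 0)) := tendsto_const_nhds.add hdist
    rw [add_zero] at h1
    exact ge_of_tendsto' h1 fun n => (hle1 n c).trans (add_le_add_left ((hs' n).2.2.1 c hc) _)
  · have h1 : Tendsto (fun n => Phi (ι x) 0 + ENNReal.ofReal (K * ‖z - s n‖)) atTop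
        (𝓝 (Phi (ι x) 0 + 0)) := tendsto_const_nhds.add hdist
    rw [add_zero] at h1
    exact ge_of_tendsto' h1 fun n => (hle1 n 0).trans_eq (by rw [(hs' n).2.2.2])
  · have h1 : Tendsto (fun n => Phi (ι z) 0 + ENNReal.ofReal (K * ‖z - s n‖)) atTop
        (𝓝 (Phi (ι z) 0 + 0)) := tendsto_const_nhds.add hdist
    rw [add_zero] at h1
    exact ge_of_tendsto' h1 fun n => ((hs' n).2.2.2.symm.le).trans (hle2 n 0)

/-! ### Dilations and the existence of the limit -/

theorem EN_const_mul {c : ℝ} (hc : 0 < c) (f : ℝ → ℝ) :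
    EN ι (fun t => c * f t) = ENNReal.ofReal c * EN ι f := by
  have hc' : ENNReal.ofReal c ≠ 0 := by simpa using hc
  have key : ∀ g : ℝ → ℝ, ∀ d, 0 < d → EN ι g ≠ ∞ →
      EN ι (fun t => d * g t) ≤ ENNReal.ofReal d * EN ι g := fun g d hd hg => by
    simpa [abs_of_pos hd] using EN_const_mul_le d g hg
  by_cases hcf : EN ι (fun t => c * f t) = ∞
  · by_cases hf : EN ι f = ∞
    · rw [hcf, hf, ENNReal.mul_top hc']
    · have h1 := key f c hc hf
      rw [hcf, top_le_iff] at h1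
      exact absurd h1 (ENNReal.mul_ne_top ENNReal.ofReal_ne_top hf)
  have h2 := key _ c⁻¹ (inv_pos.2 hc) hcf
  have e : (fun t => c⁻¹ * (c * f t)) = f := by
    ext t; field_simp
  rw [e] at h2
  have hf : EN ι f ≠ ∞ := ne_top_of_le_ne_top (ENNReal.mul_ne_top ENNReal.ofReal_ne_top hcf) h2
  refine le_antisymm (key f c hc hf) ?_
  refine (mul_le_mul_right h2 _).trans_eq ?_
  rw [← mul_assoc, ← ENNReal.ofReal_mul hc.le, mul_inv_cancel₀ hc.ne', ENNReal.ofReal_one, one_mul]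

theorem lintegral_comp_div (g : ℝ → ℝ≥0∞) {s : ℝ} (hs : 0 < s) :
    ∫⁻ t, g (t / s) ∂mHalf = ENNReal.ofReal s * ∫⁻ t, g t ∂mHalf := by
  have hemb : MeasurableEmbedding fun t : ℝ => t * s :=
    (Homeomorph.mulRight₀ s hs.ne').measurableEmbedding
  have hmap : Measure.map (fun t : ℝ => t * s) mHalf = ENNReal.ofReal s⁻¹ • mHalf := by
    have h1 : (fun t : ℝ => t * s) ⁻¹' Ioi 0 = Ioi 0 := by
      ext t; simp [hs]
    have h2 := (hemb.restrict_map volume (Ioi 0)).symm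
    rw [h1, Real.map_volume_mul_right hs.ne', abs_of_pos (inv_pos.2 hs)] at h2
    rw [mHalf, h2, Measure.restrict_smul]
  have h3 : ∫⁻ t, g t ∂mHalf = ∫⁻ t, g (t / s) ∂(Measure.map (fun t : ℝ => t * s) mHalf) := by
    rw [hemb.lintegral_map]
    refine lintegral_congr fun t => ?_
    rw [mul_div_cancel_right₀ _ hs.ne']
  rw [h3, hmap, lintegral_smul_measure, smul_eq_mul, ← mul_assoc, ← ENNReal.ofReal_mul hs.le,
    mul_inv_cancel₀ hs.ne', ENNReal.ofReal_one, one_mul]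

/-- The map `f ↦ s⁻¹ σ_s f` preserves the integral and divides heights by `s`, so its only effect on
the excess is to scale the level. -/
theorem Phi_dilation (f : ℝ → ℝ) {s : ℝ} (hs : 0 < s) (c : ℝ) :
    Phi (fun t => s⁻¹ * f (t / s)) c = Phi f (s * c) := by
  unfold Phi
  have := lintegral_comp_div (fun t => ENNReal.ofReal (|s⁻¹ * f t| - c)) hs
  rw [this, ← lintegral_const_mul' _ _ ENNReal.ofReal_ne_top]
  refine lintegral_congr fun t => ?_
  rw [← ENNReal.ofReal_mul hs.le, abs_mul, abs_of_pos (inv_pos.2 hs)]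
  congr 1
  field_simp

/-- The function `s⁻¹ σ_s(x^*) χ_[0,1]`. -/
def scaledCut (x : L0) (s : ℝ) : ℝ → ℝ := fun t =>
  s⁻¹ * (Icc (0 : ℝ) s⁻¹).indicator (rearrR x) (t / s)

theorem scaledCut_eq (x : L0) {s : ℝ} (hs : 0 < s) (t : ℝ) :
    scaledCut x s t = s⁻¹ * dilRearrCutFun s x t := by
  unfold scaledCut dilRearrCutFun dilation rearrR
  congr 1
  have : t / s ∈ Icc 0 s⁻¹ ↔ t ∈ Icc (0 : ℝ) 1 := by
    simp only [mem_Icc, inv_eq_one_div]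
    rw [div_le_div_iff_of_pos_right hs, le_div_iff₀ hs, zero_mul]
  by_cases h : t ∈ Icc (0 : ℝ) 1
  · rw [indicator_of_mem h, indicator_of_mem (this.2 h)]
  · rw [indicator_of_notMem h, indicator_of_notMem (fun h' => h (this.1 h'))]

theorem measurable_scaledCut (x : L0) (s : ℝ) : Measurable (scaledCut x s) :=
  (((measurable_rearrR x).indicator measurableSet_Icc).comp
    (measurable_id.div_const s)).const_mul _

theorem scaledCut_nonneg (x : L0) {s : ℝ} (hs : 0 < s) (t : ℝ) : 0 ≤ scaledCut x s t :=
  mul_nonneg (inv_pos.2 hs).le (indicator_nonneg (fun _ _ => rearrR_nonneg x _) _)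

theorem phiFinQuot_eq (x : L0) {s : ℝ} (hs : 0 < s) :
    phiFinQuot ι x s = EN ι (scaledCut x s) := by
  have h1 : scaledCut x s = fun t => s⁻¹ * dilRearrCutFun s x t := funext (scaledCut_eq x hs)
  rw [h1, EN_const_mul (inv_pos.2 hs), phiFinQuot, normE_eq_EN, dilRearrCut,
    EN_congr (AEEqFun.coeFn_mk _ _), ENNReal.ofReal_inv_of_pos hs, ENNReal.div_eq_inv_mul]

theorem Phi_scaledCut (x : L0) {s : ℝ} (hs : 0 < s) (c : ℝ) :
    Phi (scaledCut x s) c = Phi ((Icc (0 : ℝ) s⁻¹).indicator (rearrR x)) (s * c) :=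
  Phi_dilation _ hs c

theorem abs_indicator_le (S : Set ℝ) (f : ℝ → ℝ) (t : ℝ) : |S.indicator f t| ≤ |f t| := by
  by_cases h : t ∈ S
  · rw [indicator_of_mem h]
  · rw [indicator_of_notMem h, abs_zero]; exact abs_nonneg _

theorem integrable_of_Phi_zero_lt_top {f : ℝ → ℝ} (hf : AEStronglyMeasurable f mHalf)
    (h : Phi f 0 < ∞) : Integrable f mHalf :=
  memLp_one_iff_integrable.1 ⟨hf, by rwa [← Phi_zero]⟩

theorem integrable_scaledCut {x : L0} (hx : MemL1 x) {s : ℝ} (hs : 0 < s) :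
    Integrable (scaledCut x s) mHalf := by
  refine integrable_of_Phi_zero_lt_top (measurable_scaledCut x s).aestronglyMeasurable ?_
  rw [Phi_scaledCut x hs, mul_zero]
  exact (Phi_mono (ae_of_all _ fun t => abs_indicator_le _ _ _) _).trans_lt
    (Phi_lt_top (integrable_rearrR hx) le_rfl)

/-- Increasing `s` raises the level `s c` and shrinks the window `[0, 1/s]` seen by the excess; both
decrease it. -/
theorem EN_scaledCut_antitoneOn (hE : IsFullySymmetric ι) (hL1 : ∀ z : E, MemL1 (ι z)) {x : L0}
    (hx : MemL1 x) : AntitoneOn (fun s => EN ι (scaledCut x s)) (Ioi 0) := by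
  intro r hr s hs hrs
  refine EN_le_of_Phi hE hL1 (integrable_scaledCut hx hs) fun c hc => ?_
  rw [Phi_scaledCut x hs, Phi_scaledCut x hr]
  refine (Phi_antitone _ (mul_le_mul_of_nonneg_right hrs hc.le)).trans (Phi_mono ?_ _)
  refine ae_of_all _ fun t => ?_
  have hsub : Icc (0 : ℝ) s⁻¹ ⊆ Icc 0 r⁻¹ := Icc_subset_Icc le_rfl (inv_anti₀ hr hrs)
  by_cases h : t ∈ Icc (0 : ℝ) s⁻¹
  · rw [indicator_of_mem h, indicator_of_mem (hsub h)]
  · rw [indicator_of_notMem h, abs_zero]; exact abs_nonneg _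

theorem EN_rearrR (hE : IsFullySymmetric ι) (hL1 : ∀ z : E, MemL1 (ι z)) (x : E) :
    EN ι (rearrR (ι x)) ≤ ‖x‖ₑ :=
  (EN_le_of_Phi hE hL1 (integrable_rearrR (hL1 x)) fun _ hc =>
    (Phi_rearrR (hL1 x) hc.le).le).trans (EN_le_of_ae (ae_eq_refl _))

theorem EN_scaledCut_le (hE : IsFullySymmetric ι) (hL1 : ∀ z : E, MemL1 (ι z)) (x : E) {s : ℝ}
    (hs : 1 ≤ s) : EN ι (scaledCut (ι x) s) ≤ ‖x‖ₑ := by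
  refine le_trans (EN_le_of_Phi hE hL1 (integrable_scaledCut (hL1 x) (one_pos.trans_le hs))
    fun c hc => ?_) (EN_rearrR hE hL1 x)
  rw [Phi_scaledCut _ (one_pos.trans_le hs)]
  exact (Phi_antitone _ (le_mul_of_one_le_left hc.le hs)).trans
    (Phi_mono (ae_of_all _ fun t => abs_indicator_le _ _ _) _)

theorem tendsto_phiFinQuot (hE : IsFullySymmetric ι) (hL1 : ∀ z : E, MemL1 (ι z)) (x : E) :
    Tendsto (phiFinQuot ι (ι x)) atTop (𝓝 (phiFin ι (ι x))) ∧ phiFin ι (ι x) < ∞ ∧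
      ∀ s, 0 < s → phiFin ι (ι x) ≤ EN ι (scaledCut (ι x) s) := by
  -- Freezing the parameter below `1` gives a function antitone on all of `ℝ`, whose limit is its
  -- infimum.
  set ψ : ℝ → ℝ≥0∞ := fun s => EN ι (scaledCut (ι x) (max s 1)) with hψ
  have hpos : ∀ s : ℝ, 0 < max s 1 := fun s => one_pos.trans_le (le_max_right _ _)
  have hanti : Antitone ψ := fun r s h =>
    EN_scaledCut_antitoneOn hE hL1 (hL1 x) (hpos r) (hpos s) (max_le_max h le_rfl)
  have heq : phiFinQuot ι (ι x) =ᶠ[atTop] ψ := by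
    filter_upwards [eventually_ge_atTop 1] with s hs
    rw [phiFinQuot_eq _ (one_pos.trans_le hs), hψ]
    simp only [max_eq_left hs]
  have hlim : Tendsto (phiFinQuot ι (ι x)) atTop (𝓝 (⨅ s, ψ s)) :=
    (tendsto_atTop_iInf hanti).congr' heq.symm
  have hphi : phiFin ι (ι x) = ⨅ s, ψ s := hlim.limUnder_eq
  rw [hphi]
  refine ⟨hlim, ((iInf_le ψ 1).trans ?_).trans_lt (enorm_lt_top (x := x)), fun s hs => (iInf_le ψ s).trans ?_⟩
  · exact EN_scaledCut_le hE hL1 x (le_max_right _ _)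
  · exact EN_scaledCut_antitoneOn hE hL1 (hL1 x) hs (hpos s) (le_max_left _ _)

end

/-! ### Bounded elements, and the excess of convex combinations -/

section

variable {E : Type*} [NormedAddCommGroup E] [NormedSpace ℝ E] {ι : E →ₗ[ℝ] L0}

theorem EN_mono_of_nonneg (hE : IsSymmetric ι) {f g : ℝ → ℝ} (hf : AEStronglyMeasurable f mHalf)
    (h : ∀ t, 0 < t → 0 ≤ f t ∧ f t ≤ g t) : EN ι f ≤ EN ι g :=
  EN_mono hE hf (ae_pos.mono fun t ht => by
    rw [abs_of_nonneg (h t ht).1]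
    exact (h t ht).2.trans (le_abs_self _))

/-- A Chebyshev bound: `x^* / x^*(b)` is at least `1` on `(0, b]`. -/
theorem EN_indicator_le (hE : IsFullySymmetric ι) (hL1 : ∀ z : E, MemL1 (ι z)) (x : E) {b : ℝ}
    (hb : 0 < b) (hf : 0 < rearrR (ι x) b) :
    EN ι ((Icc 0 b).indicator fun _ => 1) ≤ ENNReal.ofReal (rearrR (ι x) b)⁻¹ * ‖x‖ₑ := by
  refine le_trans ?_ (mul_le_mul_right (EN_rearrR hE hL1 x) _)
  rw [← EN_const_mul (inv_pos.2 hf)]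
  refine EN_mono_of_nonneg hE.toIsSymmetric
    (measurable_const.indicator measurableSet_Icc).aestronglyMeasurable fun t ht => ?_
  refine ⟨indicator_nonneg (fun _ _ => zero_le_one) _, ?_⟩
  by_cases h : t ∈ Icc 0 b
  · rw [indicator_of_mem h, inv_mul_eq_div, one_le_div hf]
    exact rearrR_antitoneOn (hL1 x) ht hb h.2
  · rw [indicator_of_notMem h]
    exact mul_nonneg (inv_pos.2 hf).le (rearrR_nonneg _ _)

/-- The interval `[0, b]` may be shorter than `[0, 1]`. For `s ≥ 1` with `1/s ≤ b`, the function
`s⁻¹ σ_s(x^*)` is at least `s⁻¹ x^*(b) > 0` on `(0, 1]`. -/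
theorem EN_indicator_one_lt_top (hE : IsFullySymmetric ι) (hL1 : ∀ z : E, MemL1 (ι z)) (x : E)
    {b : ℝ} (hb : 0 < b) (hf : 0 < rearrR (ι x) b) :
    EN ι ((Icc (0 : ℝ) 1).indicator fun _ => 1) < ∞ := by
  set s := max 1 b⁻¹ with hs
  have hs1 : 1 ≤ s := le_max_left _ _
  have hs0 : 0 < s := one_pos.trans_le hs1
  have hsb : s⁻¹ ≤ b := by
    rw [inv_le_comm₀ hs0 hb]; exact le_max_right _ _
  refine lt_of_le_of_lt (b := ENNReal.ofReal (s / rearrR (ι x) b) * EN ι (scaledCut (ι x) s)) ?_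
    (ENNReal.mul_lt_top ENNReal.ofReal_lt_top
      ((EN_scaledCut_le hE hL1 x hs1).trans_lt (enorm_lt_top (x := x))))
  rw [← EN_const_mul (div_pos hs0 hf)]
  refine EN_mono_of_nonneg hE.toIsSymmetric
    (measurable_const.indicator measurableSet_Icc).aestronglyMeasurable fun t ht => ?_
  refine ⟨indicator_nonneg (fun _ _ => zero_le_one) _, ?_⟩
  by_cases h : t ∈ Icc (0 : ℝ) 1
  · have h1 : t / s ∈ Icc 0 s⁻¹ := by
      refine ⟨by positivity, ?_⟩
      rw [inv_eq_one_div]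
      exact div_le_div_of_nonneg_right h.2 hs0.le
    have h2 : rearrR (ι x) b ≤ rearrR (ι x) (t / s) :=
      rearrR_antitoneOn (hL1 x) (div_pos ht hs0) hb (h1.2.trans hsb)
    rw [indicator_of_mem h, scaledCut, indicator_of_mem h1]
    have : s / rearrR (ι x) b * (s⁻¹ * rearrR (ι x) (t / s)) =
        rearrR (ι x) (t / s) / rearrR (ι x) b := by field_simp
    rw [this, one_le_div hf]
    exact h2
  · rw [indicator_of_notMem h]
    exact mul_nonneg (div_pos hs0 hf).le (scaledCut_nonneg _ hs0 _)

/-- A bound `B` on `x^*` bounds the truncated dilations by `(B / s) χ_[0,1]`, whose norm tends to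
zero. -/
theorem phiFin_eq_zero_of_bounded (hE : IsFullySymmetric ι) (hL1 : ∀ z : E, MemL1 (ι z)) (x : E)
    {B : ℝ} (hB : ∀ t, 0 < t → rearrR (ι x) t ≤ B) : phiFin ι (ι x) = 0 := by
  obtain ⟨-, -, hle⟩ := tendsto_phiFinQuot hE hL1 x
  by_cases hpos : ∃ b, 0 < b ∧ 0 < rearrR (ι x) b
  · obtain ⟨b, hb, hfb⟩ := hpos
    have hfin := EN_indicator_one_lt_top hE hL1 x hb hfb
    have hB0 : 0 < B := hfb.trans_le (hB b hb)
    have hbd : ∀ s, 0 < s → phiFin ι (ι x) ≤ ENNReal.ofReal (B / s) *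
        EN ι ((Icc (0 : ℝ) 1).indicator fun _ => 1) := by
      intro s hs
      refine (hle s hs).trans ?_
      rw [← EN_const_mul (div_pos hB0 hs)]
      refine EN_mono_of_nonneg hE.toIsSymmetric (measurable_scaledCut _ _).aestronglyMeasurable
        fun t ht => ⟨scaledCut_nonneg _ hs _, ?_⟩
      rw [scaledCut_eq _ hs, dilRearrCutFun]
      by_cases h : t ∈ Icc (0 : ℝ) 1
      · rw [indicator_of_mem h, indicator_of_mem h, mul_one, div_eq_inv_mul]
        exact mul_le_mul_of_nonneg_left (hB _ (div_pos ht hs)) (inv_pos.2 hs).le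
      · rw [indicator_of_notMem h, indicator_of_notMem h]; simp
    have hlim : Tendsto (fun s : ℝ => ENNReal.ofReal (B / s) *
        EN ι ((Icc (0 : ℝ) 1).indicator fun _ => 1)) atTop (𝓝 0) := by
      have h1 : Tendsto (fun s : ℝ => ENNReal.ofReal (B / s)) atTop (𝓝 (ENNReal.ofReal 0)) :=
        ENNReal.tendsto_ofReal (tendsto_const_nhds.div_atTop tendsto_id)
      have := ENNReal.Tendsto.mul_const h1 (Or.inr hfin.ne)
      simpa using this
    exact le_antisymm (ge_of_tendsto hlim ((eventually_gt_atTop 0).mono hbd)) zero_le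
  · push Not at hpos
    refine le_antisymm ((hle 1 one_pos).trans ?_) zero_le
    rw [← EN_zero (ι := ι)]
    refine EN_mono_of_nonneg hE.toIsSymmetric (measurable_scaledCut _ _).aestronglyMeasurable
      fun t ht => ⟨scaledCut_nonneg _ one_pos _, ?_⟩
    rw [scaledCut_eq _ one_pos, dilRearrCutFun]
    by_cases h : t ∈ Icc (0 : ℝ) 1
    · rw [indicator_of_mem h, dilation]
      simpa [rearrR] using hpos _ ht
    · rw [indicator_of_notMem h]; simp

theorem Phi_eq_add {f : ℝ → ℝ} (hf : AEMeasurable f mHalf) {c d : ℝ} (hd : 0 ≤ d) :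
    Phi f c = Phi f (c + d) + ∫⁻ t, ENNReal.ofReal (min (max (|f t| - c) 0) d) ∂mHalf := by
  unfold Phi
  rw [← lintegral_add_left']
  · refine lintegral_congr fun t => ?_
    rcases le_total (|f t|) c with h | h
    · rw [max_eq_right (by linarith), min_eq_left hd, ENNReal.ofReal_of_nonpos (by linarith),
        ENNReal.ofReal_of_nonpos (by linarith)]
      simp
    · rw [max_eq_left (by linarith)]
      rcases le_total (|f t| - c) d with h' | h'
      · rw [min_eq_left h', ENNReal.ofReal_of_nonpos (p := |f t| - (c + d)) (by linarith), zero_add]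
      · rw [min_eq_right h', ← ENNReal.ofReal_add (by linarith) hd]
        congr 1; ring
  · exact ((continuous_abs.measurable.comp_aemeasurable hf).sub_const _).ennreal_ofReal

/-- The distribution function is minus the right derivative of the excess: the difference quotients
over steps `1/(n+1)` increase to it. -/
theorem dist_eq_of_Phi_eq {f g : ℝ → ℝ} (hf : Integrable f mHalf) (hg : Integrable g mHalf)
    (h : ∀ c, 0 ≤ c → Phi f c = Phi g c) {c : ℝ} (hc : 0 ≤ c) :
    mHalf {t | c < |f t|} = mHalf {t | c < |g t|} := by
  set q : (ℝ → ℝ) → ℕ → ℝ≥0∞ := fun f n =>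
    ∫⁻ t, ENNReal.ofReal (min (max (|f t| - c) 0) (1 / ((n : ℝ) + 1))) ∂mHalf with hq
  have key : ∀ f : ℝ → ℝ, Integrable f mHalf → Tendsto (fun n : ℕ => ENNReal.ofReal ((n : ℝ) + 1) *
      q f n) atTop (𝓝 (mHalf {t | c < |f t|})) := by
    intro f hf
    have hm : AEMeasurable (fun t => |f t|) mHalf := hf.abs.1.aemeasurable
    have e1 : mHalf {t | c < |f t|} = ∫⁻ t, (Ioi c).indicator (fun _ => 1) |f t| ∂mHalf := by
      have hns : NullMeasurableSet {t | c < |f t|} mHalf := nullMeasurableSet_lt aemeasurable_const hm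
      rw [← lintegral_indicator_one₀ hns]
      rfl
    have e2 : ∀ n : ℕ, ENNReal.ofReal ((n : ℝ) + 1) * q f n =
        ∫⁻ t, ENNReal.ofReal (min (((n : ℝ) + 1) * max (|f t| - c) 0) 1) ∂mHalf := by
      intro n
      have hn : (0 : ℝ) < n + 1 := by positivity
      rw [hq, ← lintegral_const_mul' _ _ ENNReal.ofReal_ne_top]
      refine lintegral_congr fun t => ?_
      rw [← ENNReal.ofReal_mul hn.le, mul_min_of_nonneg _ _ hn.le, mul_one_div_cancel hn.ne']
    rw [e1]
    simp only [e2]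
    refine lintegral_tendsto_of_tendsto_of_monotone (fun n => ?_) ?_ ?_
    · exact ((((hm.sub_const c).max aemeasurable_const).const_mul _).min
        aemeasurable_const).ennreal_ofReal
    · refine ae_of_all _ fun t a b hab => ENNReal.ofReal_le_ofReal (min_le_min ?_ le_rfl)
      gcongr
    · refine ae_of_all _ fun t => ?_
      by_cases ht : c < |f t|
      · rw [indicator_of_mem (show |f t| ∈ Ioi c from ht)]
        refine tendsto_const_nhds.congr' ?_
        obtain ⟨N, hN⟩ := exists_nat_gt (1 / (|f t| - c))
        filter_upwards [eventually_ge_atTop N] with n hn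
        have hpos : 0 < |f t| - c := sub_pos.2 ht
        rw [max_eq_left hpos.le, min_eq_right, ENNReal.ofReal_one]
        rw [div_lt_iff₀ hpos] at hN
        have : (N : ℝ) ≤ n := by exact_mod_cast hn
        nlinarith
      · rw [indicator_of_notMem (show |f t| ∉ Ioi c from ht)]
        refine tendsto_const_nhds.congr fun n => ?_
        rw [max_eq_right (by linarith)]
        simp
  refine tendsto_nhds_unique (key f hf) ((key g hg).congr fun n => ?_)
  congr 1
  have hn : (0 : ℝ) ≤ 1 / ((n : ℝ) + 1) := by positivity
  have e1 := Phi_eq_add hf.1.aemeasurable (c := c) hn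
  have e2 := Phi_eq_add hg.1.aemeasurable (c := c) hn
  rw [h c hc, e2, h _ (add_nonneg hc hn)] at e1
  exact (ENNReal.add_right_inj (Phi_lt_top hg (add_nonneg hc hn)).ne).1 e1

/-- A convex combination of `N` functions equimeasurable with `f` dominates `N⁻¹ σ_N f`. -/
theorem Phi_mul_card_le {κ : Type*} [Fintype κ] {f : ℝ → ℝ} (hf : Integrable f mHalf)
    {w : κ → ℝ} {z : κ → ℝ → ℝ} (hw : ∀ i, 0 ≤ w i) (hw1 : ∑ i, w i = 1)
    (hz : ∀ i, Integrable (z i) mHalf) (hz0 : ∀ i, ∀ᵐ t ∂mHalf, 0 ≤ z i t)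
    (hPhi : ∀ i c, 0 ≤ c → Phi (z i) c = Phi f c) {c : ℝ} (hc : 0 < c) :
    Phi f (Fintype.card κ * c) ≤ Phi (fun t => ∑ i, w i * z i t) c := by
  set N : ℝ := ((Fintype.card κ : ℕ) : ℝ) with hN
  have hne : Nonempty κ := by
    by_contra hemp
    rw [not_nonempty_iff] at hemp
    simp at hw1
  have hNpos : 0 < N := by rw [hN]; exact_mod_cast Fintype.card_pos
  have hNc : 0 < N * c := mul_pos hNpos hc
  have hW : Integrable (fun t => ∑ i, w i * z i t) mHalf :=
    integrable_finsetSum _ fun i _ => (hz i).const_mul _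
  have hW0 : ∀ᵐ t ∂mHalf, 0 ≤ ∑ i, w i * z i t := by
    filter_upwards [ae_all_iff.2 hz0] with t ht
    exact Finset.sum_nonneg fun i _ => mul_nonneg (hw i) (ht i)
  rw [Phi_eq_ofReal hW hW0 hc.le, Phi_eq_ofReal_abs hf hNc.le]
  refine ENNReal.ofReal_le_ofReal ?_
  have hdist : ∀ i, mHalf {t | N * c < |z i t|} = mHalf {t | N * c < |f t|} := fun i =>
    dist_eq_of_Phi_eq (hz i) hf (hPhi i) hNc.le
  set d : ℝ := (mHalf {t | N * c < |f t|}).toReal with hd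
  have hPR : ∀ i, PhiR (z i) (N * c) = PhiR (fun t => |f t|) (N * c) := by
    intro i
    have := hPhi i (N * c) hNc.le
    rwa [Phi_eq_ofReal (hz i) (hz0 i) hNc.le, Phi_eq_ofReal_abs hf hNc.le,
      ENNReal.ofReal_eq_ofReal_iff (PhiR_nonneg _ _) (PhiR_nonneg _ _)] at this
  choose g hgm hg using fun i => (hz i).1.aemeasurable
  set S : κ → Set ℝ := fun i => {t | N * c < g i t} with hS
  have hSm : ∀ i, MeasurableSet (S i) := fun i => measurableSet_lt measurable_const (hgm i)
  have hSd : ∀ i, mHalf (S i) = mHalf {t | N * c < |f t|} := by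
    intro i
    rw [← hdist i]
    refine measure_congr ?_
    filter_upwards [hg i, hz0 i] with t h1 h2
    refine propext ?_
    change N * c < g i t ↔ N * c < |z i t|
    rw [abs_of_nonneg h2, h1]
  have hfin : mHalf {t | N * c < |f t|} ≠ ∞ := (mHalf_gt_lt_top hf hNc).ne
  set A := ⋃ i, S i with hA
  have hAm : MeasurableSet A := MeasurableSet.iUnion hSm
  have hAle : mHalf A ≤ Fintype.card κ * mHalf {t | N * c < |f t|} := by
    refine (measure_iUnion_fintype_le _ _).trans ?_
    simp [hSd]
  have hAfin : mHalf A ≠ ∞ := ne_top_of_le_ne_top (ENNReal.mul_ne_top (by simp) hfin) hAle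
  have hAreal : (mHalf A).toReal ≤ N * d := by
    have := ENNReal.toReal_mono (ENNReal.mul_ne_top (by simp) hfin) hAle
    rwa [ENNReal.toReal_mul, ENNReal.toReal_natCast] at this
  have h1 : ∫ t in A, (∑ i, w i * z i t - c) ∂mHalf ≤ PhiR (fun t => ∑ i, w i * z i t) c := by
    refine le_trans (setIntegral_mono (g := fun t => max (∑ i, w i * z i t - c) 0)
      (hW.integrableOn.sub (integrableOn_const hAfin))
      (integrable_excess hW hc.le).integrableOn fun t => le_max_left _ _) ?_
    exact setIntegral_le_integral (integrable_excess hW hc.le)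
      (ae_of_all _ fun t => le_max_right _ _)
  have h2 : ∫ t in A, (∑ i, w i * z i t - c) ∂mHalf =
      ∑ i, w i * ∫ t in A, z i t ∂mHalf - c * (mHalf A).toReal := by
    rw [integral_sub hW.integrableOn (integrableOn_const hAfin),
      integral_finsetSum _ fun i _ => ((hz i).const_mul _).integrableOn]
    simp only [integral_const_mul]
    rw [setIntegral_const, measureReal_def, smul_eq_mul, mul_comm c]
  have h3 : ∀ i, PhiR (fun t => |f t|) (N * c) + N * c * d ≤ ∫ t in A, z i t ∂mHalf := by
    intro i
    have e1 : ∫ t in S i, z i t ∂mHalf ≤ ∫ t in A, z i t ∂mHalf :=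
      setIntegral_mono_set (hz i).integrableOn (ae_restrict_of_ae (hz0 i))
        (LE.le.eventuallyLE (subset_iUnion S i))
    refine le_trans (le_of_eq ?_) e1
    have hSfin : mHalf (S i) ≠ ∞ := by rw [hSd]; exact hfin
    have e2 : ∫ t in S i, (z i t - N * c) ∂mHalf = PhiR (z i) (N * c) := by
      rw [PhiR, ← integral_indicator (hSm i)]
      refine integral_congr_ae ?_
      filter_upwards [hg i] with t ht
      by_cases hts : t ∈ S i
      · have : N * c < g i t := hts
        rw [indicator_of_mem hts, max_eq_left (by rw [ht]; linarith)]
      · have : ¬ N * c < g i t := hts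
        rw [indicator_of_notMem hts, max_eq_right (by rw [ht]; linarith)]
    rw [integral_sub (hz i).integrableOn (integrableOn_const hSfin), setIntegral_const,
      measureReal_def, hSd, smul_eq_mul, hPR] at e2
    linarith
  have h4 : PhiR (fun t => |f t|) (N * c) + N * c * d ≤ ∑ i, w i * ∫ t in A, z i t ∂mHalf := by
    calc PhiR (fun t => |f t|) (N * c) + N * c * d
        = ∑ i, w i * (PhiR (fun t => |f t|) (N * c) + N * c * d) := by
          rw [← Finset.sum_mul, hw1, one_mul]
      _ ≤ _ := Finset.sum_le_sum fun i _ => mul_le_mul_of_nonneg_left (h3 i) (hw i)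
  have h5 : c * (mHalf A).toReal ≤ N * c * d := by
    calc c * (mHalf A).toReal ≤ c * (N * d) := mul_le_mul_of_nonneg_left hAreal hc.le
      _ = _ := by ring
  linarith

theorem Phi_excess {g : ℝ → ℝ} (hg : ∀ t, 0 ≤ g t) {M c : ℝ} (hc : 0 ≤ c) :
    Phi (fun t => max (g t - M) 0) c = Phi g (c + M) := by
  refine lintegral_congr fun t => ?_
  rw [abs_of_nonneg (le_max_right _ _), abs_of_nonneg (hg t)]
  beta_reduce
  rcases le_total (g t - M) 0 with h | h
  · rw [max_eq_right h, ENNReal.ofReal_of_nonpos (by linarith),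
      ENNReal.ofReal_of_nonpos (by linarith)]
  · rw [max_eq_left h]; congr 1; ring

end

/-! ### Necessity of `φ_fin(x) = 0` -/

section

variable {E : Type*} [NormedAddCommGroup E] [NormedSpace ℝ E] {ι : E →ₗ[ℝ] L0}

/-- Averaging `f` over `(0, 1)` does not increase the excess. -/
theorem exists_bounded_majorized {x : L0} (hx : MemL1 x) :
    ∃ (y : ℝ → ℝ) (M : ℝ), 0 < M ∧ Integrable y mHalf ∧ (∀ t, 0 ≤ y t) ∧ (∀ t, 0 < t → y t ≤ M) ∧
      (∀ c, 0 ≤ c → Phi y c ≤ Phi x c) ∧ Phi y 0 = Phi x 0 := by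
  set f := rearrR x with hf
  have hfi : Integrable f mHalf := integrable_rearrR hx
  have hf0 := rearrR_nonneg x
  have hI : Ioo (0 : ℝ) 1 ⊆ Ioi 0 := Ioo_subset_Ioi_self
  have hvol : mHalf (Ioo (0 : ℝ) 1) = 1 := by
    rw [Measure.restrict_apply measurableSet_Ioo, inter_eq_self_of_subset_left hI]
    simp
  set a := ∫ t in Ioo (0 : ℝ) 1, f t ∂mHalf with ha
  have ha0 : 0 ≤ a := setIntegral_nonneg measurableSet_Ioo fun t _ => hf0 t
  classical
  set y : ℝ → ℝ := (Ioo (0 : ℝ) 1).piecewise (fun _ => a) f with hy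
  have hy0 : ∀ t, 0 ≤ y t := fun t => by
    by_cases h : t ∈ Ioo (0 : ℝ) 1
    · rw [hy, piecewise_eq_of_mem _ _ _ h]; exact ha0
    · rw [hy, piecewise_eq_of_notMem _ _ _ h]; exact hf0 t
  have hyi : Integrable y mHalf :=
    Integrable.piecewise measurableSet_Ioo (integrableOn_const (by rw [hvol]; simp))
      hfi.integrableOn
  have hsplit : ∀ (g : ℝ → ℝ) c, Phi g c = ∫⁻ t in Ioo (0 : ℝ) 1, ENNReal.ofReal (|g t| - c) ∂mHalf +
      ∫⁻ t in (Ioo (0 : ℝ) 1)ᶜ, ENNReal.ofReal (|g t| - c) ∂mHalf := fun g c =>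
    (lintegral_add_compl _ measurableSet_Ioo).symm
  have hout : ∀ c, ∫⁻ t in (Ioo (0 : ℝ) 1)ᶜ, ENNReal.ofReal (|y t| - c) ∂mHalf =
      ∫⁻ t in (Ioo (0 : ℝ) 1)ᶜ, ENNReal.ofReal (|f t| - c) ∂mHalf := fun c =>
    setLIntegral_congr_fun measurableSet_Ioo.compl fun t ht => by
      simp only [hy, piecewise_eq_of_notMem _ _ _ ht]
  have hin : ∀ c, ∫⁻ t in Ioo (0 : ℝ) 1, ENNReal.ofReal (|y t| - c) ∂mHalf =
      ENNReal.ofReal (a - c) := fun c => by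
    rw [setLIntegral_congr_fun (g := fun _ => ENNReal.ofReal (a - c)) measurableSet_Ioo fun t ht => by
      simp only [hy, piecewise_eq_of_mem _ _ _ ht, abs_of_nonneg ha0]]
    rw [setLIntegral_const, hvol, mul_one]
  have hfin : ∀ c, 0 ≤ c → ∫⁻ t in Ioo (0 : ℝ) 1, ENNReal.ofReal (|f t| - c) ∂mHalf =
      ENNReal.ofReal (∫ t in Ioo (0 : ℝ) 1, max (f t - c) 0 ∂mHalf) := fun c hc => by
    rw [ofReal_integral_eq_lintegral_ofReal (integrable_excess hfi hc).integrableOn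
      (ae_of_all _ fun t => le_max_right _ _)]
    refine lintegral_congr fun t => ?_
    rw [abs_of_nonneg (hf0 t), ENNReal.ofReal_max, ENNReal.ofReal_zero, max_eq_left zero_le]
  -- The summand `1` makes the bound positive also when `f` vanishes.
  refine ⟨y, max a (f 1) + 1, ?_, hyi, hy0, fun t ht => ?_, fun c hc => ?_, ?_⟩
  · have := le_max_left a (f 1); linarith
  · by_cases h : t ∈ Ioo (0 : ℝ) 1
    · rw [hy, piecewise_eq_of_mem _ _ _ h]
      have := le_max_left a (f 1); linarith
    · rw [hy, piecewise_eq_of_notMem _ _ _ h]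
      have h1 : 1 ≤ t := by
        by_contra! h1; exact h ⟨ht, h1⟩
      have h2 := rearrR_antitoneOn hx (show (1 : ℝ) ∈ Ioi 0 from one_pos (α := ℝ)) ht h1
      have := le_max_right a (f 1); linarith
  · rw [← Phi_rearrR hx hc, ← hf, hsplit y, hsplit f, hout, hin, hfin c hc]
    refine add_le_add_left (ENNReal.ofReal_le_ofReal ?_) _
    -- Jensen's inequality on an interval of measure one.
    have h1 : ∫ t in Ioo (0 : ℝ) 1, (f t - c) ∂mHalf = a - c := by
      rw [integral_sub hfi.integrableOn (integrableOn_const (by rw [hvol]; simp)), setIntegral_const,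
        measureReal_def, hvol]
      simp [ha]
    rw [← h1]
    exact setIntegral_mono (hfi.integrableOn.sub (integrableOn_const (by rw [hvol]; simp)))
      (integrable_excess hfi hc).integrableOn fun t => le_max_left _ _
  · rw [← Phi_rearrR hx le_rfl, ← hf, hsplit y, hsplit f, hout, hin, hfin 0 le_rfl]
    have : ∀ t, max (f t) 0 = f t := fun t => max_eq_left (hf0 t)
    simp only [sub_zero, this, ha]

/-- A bounded element `y ≤ M` of the orbit is approximated by a combination `w` of `N` extreme
points, and `w` has at least the excess of `N⁻¹ σ_N(x^*)`. Whatever of the latter exceeds `M` is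
charged to `w - y`; the remainder is bounded by `M` and is negligible on a short interval when `x^*`
is unbounded. -/
theorem phiFin_eq_zero_of_OmegaPrime_eq (hE : IsFullySymmetric ι) (hL1 : ∀ z : E, MemL1 (ι z))
    (x : E) (h : OmegaPrime (ι x) = QPrime ι (ι x)) : phiFin ι (ι x) = 0 := by
  set f := rearrR (ι x) with hf
  have hfi : Integrable f mHalf := integrable_rearrR (hL1 x)
  have hf0 := rearrR_nonneg (ι x)
  by_cases hbdd : ∃ B, ∀ t, 0 < t → f t ≤ B
  · obtain ⟨B, hB⟩ := hbdd
    exact phiFin_eq_zero_of_bounded hE hL1 x hB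
  push Not at hbdd
  obtain ⟨-, -, hle⟩ := tendsto_phiFinQuot hE hL1 x
  obtain ⟨y, M, hM, hyi, hy0, hyM, hyPhi, hyPhi0⟩ := exists_bounded_majorized (hL1 x)
  have hmem := mk_mem_OmegaPrime (hL1 x) hyi (ae_of_all _ hy0) (fun c hc => hyPhi c hc.le) hyPhi0
  rw [h] at hmem
  obtain ⟨z, hz, hzy⟩ := hmem
  have hzy' : ⇑(ι z) =ᵐ[mHalf] y := by rw [hzy]; exact AEEqFun.coeFn_mk _ _
  refine le_antisymm (ENNReal.le_of_forall_pos_le_add fun δ hδ _ => ?_) zero_le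
  rw [zero_add]
  have hδ' : (0 : ℝ) < δ / 2 := by positivity
  obtain ⟨w, hw, hwz⟩ := Metric.mem_closure_iff.1 hz (δ / 2) hδ'
  obtain ⟨κ, _, lam, u, hlam, hlam1, hu, hwu⟩ := mem_convexHull_iff_exists_fintype.1 hw
  have hne : Nonempty κ := by
    by_contra hemp
    rw [not_nonempty_iff] at hemp
    simp at hlam1
  set N : ℝ := ((Fintype.card κ : ℕ) : ℝ) with hN
  have hNpos : 0 < N := by rw [hN]; exact_mod_cast Fintype.card_pos
  have hN1 : 1 ≤ N := by rw [hN]; exact_mod_cast Fintype.card_pos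
  have huΩ : ∀ i, ι (u i) ∈ OmegaPrime (ι x) := fun i => extremePoints_subset (hu i)
  have hWcoe : ⇑(ι w) =ᵐ[mHalf] fun t => ∑ i, lam i * ι (u i) t := by
    rw [← hwu, map_sum]
    have : ∀ s : Finset κ, ⇑(∑ i ∈ s, ι (lam i • u i)) =ᵐ[mHalf]
        fun t => ∑ i ∈ s, lam i * ι (u i) t := by
      classical
      intro s
      induction s using Finset.induction_on with
      | empty =>
        simp only [Finset.sum_empty]
        exact AEEqFun.coeFn_zero
      | insert a s ha ih =>
        simp only [Finset.sum_insert ha, map_smul] at ih ⊢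
        filter_upwards [ih, AEEqFun.coeFn_add (lam a • ι (u a)) (∑ i ∈ s, lam i • ι (u i)),
          AEEqFun.coeFn_smul (lam a) (ι (u a))] with t h1 h2 h3
        rw [h2, Pi.add_apply, h3, h1]
        rfl
    exact this _
  have hPhiw : ∀ c, 0 < c → Phi f (N * c) ≤ Phi (ι w) c := fun c hc => by
    rw [Phi_congr hWcoe]
    refine Phi_mul_card_le hfi hlam hlam1 (fun i => hL1 (u i))
      (fun i => ((mem_OmegaPrime_iff (hL1 x)).1 (huΩ i)).1) (fun i c hc => ?_) hc
    rw [Phi_eq_of_mem_extremePoints (hL1 x) (hu i) hc, hf, Phi_rearrR (hL1 x) hc]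
  set v : ℝ → ℝ := fun t => max (N⁻¹ * f (t / N) - M) 0 with hv
  have hgm : Measurable fun t => N⁻¹ * f (t / N) :=
    ((measurable_rearrR _).comp (measurable_id.div_const N)).const_mul _
  have hgnn : ∀ t, 0 ≤ N⁻¹ * f (t / N) := fun t => mul_nonneg (inv_pos.2 hNpos).le (hf0 _)
  have hvm : AEStronglyMeasurable v mHalf :=
    ((hgm.sub_const M).max measurable_const).aestronglyMeasurable
  have hPhiv : ∀ c, 0 ≤ c → Phi v c = Phi f (N * (c + M)) := fun c hc => by
    rw [hv, Phi_excess hgnn hc, Phi_dilation f hNpos]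
  have hvi : Integrable v mHalf := by
    refine integrable_of_Phi_zero_lt_top hvm ?_
    rw [hPhiv 0 le_rfl, zero_add]
    exact Phi_lt_top hfi (mul_pos hNpos hM).le
  have hvle : EN ι v ≤ ENNReal.ofReal (δ / 2) := by
    have h1 : EN ι v ≤ EN ι (ι (w - z)) := by
      refine EN_le_of_Phi hE hL1 hvi fun c hc => ?_
      rw [hPhiv c hc.le]
      refine (hPhiw (c + M) (by linarith)).trans (lintegral_mono_ae ?_)
      filter_upwards [coe_sub' w z, hzy', ae_pos] with t h1 h2 h3
      refine ENNReal.ofReal_le_ofReal ?_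
      rw [h1, h2]
      have e1 := hyM t h3
      have e2 := abs_sub_abs_le_abs_sub (ι w t) (y t)
      rw [abs_of_nonneg (hy0 t)] at e2
      linarith
    refine h1.trans ((EN_le_of_ae (ae_eq_refl _)).trans ?_)
    rw [← ofReal_norm, norm_sub_rev, ← dist_eq_norm]
    exact ENNReal.ofReal_le_ofReal hwz.le
  -- Unboundedness gives a `b` with `x^*(b)` so large that `M ‖χ_[0,b]‖ ≤ M ‖x‖ / x^*(b) ≤ δ / 2`.
  obtain ⟨b, hb, hfb⟩ := hbdd (max 1 (M * ‖x‖ / (δ / 2)))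
  have hfb1 : 0 < f b := one_pos.trans ((le_max_left _ _).trans_lt hfb)
  have hfb2 : M * ‖x‖ / f b ≤ δ / 2 := by
    have := (le_max_right _ _).trans_lt hfb
    rw [div_lt_iff₀ hδ'] at this
    rw [div_le_iff₀ hfb1]
    linarith
  -- A further dilation by `k` compresses `[0, 1]` into `[0, b]`, so the cut at parameter `N k` is
  -- bounded by `k⁻¹ σ_k H`.
  set k := max 1 b⁻¹ with hk
  have hk1 : 1 ≤ k := le_max_left _ _
  have hk0 : 0 < k := one_pos.trans_le hk1
  have hkb : k⁻¹ ≤ b := by rw [inv_le_comm₀ hk0 hb]; exact le_max_right _ _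
  set H : ℝ → ℝ := fun t => v t + M * (Icc 0 b).indicator (fun _ => 1) t with hH
  have hHm : AEStronglyMeasurable H mHalf :=
    hvm.add ((measurable_const.indicator measurableSet_Icc).aestronglyMeasurable.const_mul M)
  have hH0 : ∀ t, 0 ≤ H t := fun t =>
    add_nonneg (le_max_right _ _) (mul_nonneg hM.le (indicator_nonneg (fun _ _ => zero_le_one) _))
  have hNk : 0 < N * k := mul_pos hNpos hk0
  have hcut : EN ι (scaledCut (ι x) (N * k)) ≤ EN ι H := by
    refine EN_le_of_Phi hE hL1 (integrable_scaledCut (hL1 x) hNk) fun c hc => ?_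
    have h1 : Phi (scaledCut (ι x) (N * k)) c ≤ Phi (fun t => k⁻¹ * H (t / k)) c := by
      refine Phi_mono (ae_pos.mono fun t ht => ?_) c
      rw [abs_of_nonneg (scaledCut_nonneg _ hNk _),
        abs_of_nonneg (mul_nonneg (inv_pos.2 hk0).le (hH0 _)), scaledCut]
      by_cases hm : t / (N * k) ∈ Icc 0 (N * k)⁻¹
      · have htk : t / k ∈ Icc 0 b := by
          refine ⟨by positivity, le_trans ?_ hkb⟩
          have := hm.2
          rw [inv_eq_one_div, div_le_div_iff_of_pos_right hNk] at this
          rw [inv_eq_one_div]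
          exact div_le_div_of_nonneg_right this hk0.le
        rw [indicator_of_mem hm, hH]
        simp only [indicator_of_mem htk]
        have e1 := le_max_left (N⁻¹ * f (t / k / N) - M) 0
        have e2 : t / (N * k) = t / k / N := by rw [div_div, mul_comm]
        rw [mul_inv, mul_comm N⁻¹, mul_assoc, e2]
        refine mul_le_mul_of_nonneg_left ?_ (inv_pos.2 hk0).le
        simp only [hv]
        linarith
      · rw [indicator_of_notMem hm, mul_zero]
        exact mul_nonneg (inv_pos.2 hk0).le (hH0 _)
    rw [Phi_dilation H hk0] at h1
    exact h1.trans (Phi_antitone _ (le_mul_of_one_le_left hc.le hk1))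
  calc phiFin ι (ι x) ≤ EN ι (scaledCut (ι x) (N * k)) := hle _ hNk
    _ ≤ EN ι H := hcut
    _ ≤ EN ι v + EN ι (fun t => M * (Icc 0 b).indicator (fun _ => 1) t) := EN_add_le _ _
    _ ≤ ENNReal.ofReal (δ / 2) + ENNReal.ofReal (δ / 2) := by
        refine add_le_add hvle ?_
        rw [EN_const_mul hM]
        refine (mul_le_mul_right (EN_indicator_le hE hL1 x hb hfb1) _).trans ?_
        rw [← ofReal_norm, ← ENNReal.ofReal_mul (inv_pos.2 hfb1).le,
          ← ENNReal.ofReal_mul hM.le]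
        refine ENNReal.ofReal_le_ofReal (le_trans (le_of_eq ?_) hfb2)
        field_simp
    _ = δ := by
        rw [← ENNReal.ofReal_add hδ'.le hδ'.le, add_halves, ENNReal.ofReal_coe_nnreal]

end

/-! ### Finite-dimensional weak majorization -/

theorem sum_mul_nonneg_of_partial_sums {b d : ℕ → ℝ} (hb : Antitone b) (hb0 : ∀ j, 0 ≤ b j) {N : ℕ}
    (hd : ∀ i ≤ N, 0 ≤ ∑ j ∈ Finset.range i, d j) : 0 ≤ ∑ j ∈ Finset.range N, b j * d j := by
  -- Abel summation: replacing the weights of an initial segment by their smallest one decreases the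
  -- sum, as partial sums of `d` are nonnegative.
  have key : ∀ n, n + 1 ≤ N →
      b n * ∑ j ∈ Finset.range (n + 1), d j ≤ ∑ j ∈ Finset.range (n + 1), b j * d j := by
    intro n
    induction n with
    | zero => intro _; simp
    | succ n ih =>
      intro hn
      rw [Finset.sum_range_succ _ (n + 1), Finset.sum_range_succ _ (n + 1), mul_add]
      refine add_le_add_left (le_trans ?_ (ih (by omega))) _
      exact mul_le_mul_of_nonneg_right (hb (Nat.le_succ n)) (hd _ (by omega))
  cases N with
  | zero => simp
  | succ n => exact (mul_nonneg (hb0 n) (hd _ le_rfl)).trans (key n le_rfl)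

/-- Weak form of Rado's theorem: a decreasing vector weakly majorized by `x` is dominated by a
convex combination of the permutations of `x`. -/
theorem exists_weights_of_partial_sums_le {N : ℕ} {x y : ℕ → ℝ} (hy : Antitone y)
    (h : ∀ i ≤ N, ∑ j ∈ Finset.range i, y j ≤ ∑ j ∈ Finset.range i, x j) :
    ∃ lam : Equiv.Perm (Fin N) → ℝ, (∀ π, 0 ≤ lam π) ∧ ∑ π, lam π = 1 ∧
      ∀ j : Fin N, y j ≤ ∑ π, lam π * x (π j) := by
  set P : Equiv.Perm (Fin N) → Fin N → ℝ := fun π j => x (π j) with hP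
  set S := convexHull ℝ (range P) with hS
  by_cases hdis : Disjoint S (Ici fun j : Fin N => y j)
  · exfalso
    have hSc : IsCompact S := (finite_range P).isCompact_convexHull ℝ
    -- Separate the hull of the permutations of `x` from the orthant above `y`. A contradiction
    -- follows by comparing the value of the functional at `y` with that at one suitable
    -- permutation.
    obtain ⟨φ, u, v, hu, huv, hv⟩ := geometric_hahn_banach_compact_closed (convex_convexHull ℝ _)
      hSc (convex_Ici _) isClosed_Ici hdis
    set a : Fin N → ℝ := fun j => φ (Pi.single j 1) with ha
    have hφ : ∀ w : Fin N → ℝ, φ w = ∑ j, a j * w j := by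
      intro w
      conv_lhs => rw [pi_eq_sum_univ' w]
      rw [map_sum]
      refine Finset.sum_congr rfl fun j _ => ?_
      rw [map_smul, smul_eq_mul, mul_comm, ha]
    have ha0 : ∀ j, 0 ≤ a j := by
      intro j
      by_contra! hneg
      -- Moving by `K` along the `j`-th axis stays in the orthant and lowers the functional exactly
      -- to `v`, which the strict separation forbids.
      set K := (φ (fun j => y j) - v) / (-(a j)) with hK
      have hy0 : v < φ (fun j => y j) := hv _ (mem_Ici.2 le_rfl)
      have hK0 : 0 ≤ K := div_nonneg (by linarith) (by linarith)
      have := hv ((fun j : Fin N => y j) + K • Pi.single j 1) (by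
        refine mem_Ici.2 (le_add_of_nonneg_right ?_)
        exact smul_nonneg hK0 (Pi.single_nonneg.2 zero_le_one))
      rw [map_add, map_smul, smul_eq_mul] at this
      change v < _ + K * a j at this
      have e : K * a j = v - φ (fun j => y j) := by
        rw [hK]
        have : a j ≠ 0 := hneg.ne
        field_simp
        ring
      linarith
    -- With coefficients in decreasing order, the rearrangement inequality applies to the decreasing
    -- `y`, and the partial-sum hypothesis then applies through Abel summation.
    set σ := Tuple.sort (fun j => -(a j)) with hσ
    have hanti : Antitone (a ∘ σ) := by
      have := Tuple.monotone_sort (fun j => -(a j))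
      intro i j hij
      have := this hij
      simp only [Function.comp_apply] at this ⊢
      linarith
    have h1 : ∑ j, a j * y j ≤ ∑ j, a (σ j) * y j := by
      have hmv : Monovary (a ∘ σ) (fun j : Fin N => y j) := by
        intro i j hij
        have : j ≤ i := by
          by_contra! hlt
          exact absurd (hy (show (i : ℕ) ≤ j from hlt.le)) (not_le.2 hij)
        exact hanti this
      have := hmv.sum_comp_perm_mul_le_sum_mul (σ := σ⁻¹)
      simpa using this
    have h2 : ∑ j, a (σ j) * y j ≤ ∑ j, a (σ j) * x j := by
      set b : ℕ → ℝ := fun j => if hj : j < N then a (σ ⟨j, hj⟩) else 0 with hb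
      have hb0 : ∀ j, 0 ≤ b j := fun j => by
        simp only [hb]; split_ifs
        · exact ha0 _
        · exact le_rfl
      have hbanti : Antitone b := by
        intro i j hij
        by_cases hj : j < N
        · have hi : i < N := lt_of_le_of_lt hij hj
          simp only [hb, hi, hj, dif_pos]
          exact hanti (show (⟨i, hi⟩ : Fin N) ≤ ⟨j, hj⟩ from hij)
        · have : b j = 0 := by simp [hb, hj]
          rw [this]; exact hb0 i
      have := sum_mul_nonneg_of_partial_sums (d := fun j => x j - y j) hbanti hb0 (N := N)
        fun i hi => by
          rw [Finset.sum_sub_distrib]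
          exact sub_nonneg.2 (h i hi)
      rw [← Fin.sum_univ_eq_sum_range (fun j => b j * (x j - y j))] at this
      have e : ∀ j : Fin N, b j = a (σ j) := fun j => by simp [hb]
      simp only [e, mul_sub, Finset.sum_sub_distrib] at this
      linarith
    have h3 : ∑ j, a (σ j) * x j = φ (P σ⁻¹) := by
      rw [hφ]
      refine Fintype.sum_equiv σ _ _ fun j => ?_
      simp [hP]
    have h4 := hu (P σ⁻¹) (subset_convexHull ℝ _ (mem_range_self _))
    have h5 := hv (fun j => y j) (mem_Ici.2 le_rfl)
    rw [hφ] at h5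
    linarith
  · rw [not_disjoint_iff] at hdis
    obtain ⟨w, hw, hwy⟩ := hdis
    rw [hS, ← image_univ, ← Finset.coe_univ, ← Finset.coe_image] at hw
    rw [Finset.mem_convexHull'] at hw
    obtain ⟨c, hc0, hc1, hcw⟩ := hw
    classical
    -- Several permutations may produce the same vector; its whole weight goes to one chosen
    -- representative.
    choose! g hg using fun v (hv : v ∈ Finset.univ.image P) => Finset.mem_image.1 hv
    have hinj : ∀ v ∈ Finset.univ.image P, ∀ v' ∈ Finset.univ.image P, g v = g v' → v = v' := by
      intro v hv v' hv' e
      rw [← (hg v hv).2, ← (hg v' hv').2, e]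
    refine ⟨fun π => if π ∈ (Finset.univ.image P).image g then c (P π) else 0, fun π => ?_, ?_, ?_⟩
    · simp only; split_ifs
      · exact hc0 _ (Finset.mem_image_of_mem _ (Finset.mem_univ _))
      · exact le_rfl
    · rw [Finset.sum_ite_mem, Finset.univ_inter, Finset.sum_image hinj, ← hc1]
      exact Finset.sum_congr rfl fun v hv => by rw [(hg v hv).2]
    · intro j
      have hj : y j ≤ w j := hwy j
      refine hj.trans (le_of_eq ?_)
      simp only [ite_mul, zero_mul]
      rw [Finset.sum_ite_mem, Finset.univ_inter, Finset.sum_image hinj, ← hcw, Finset.sum_apply]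
      refine Finset.sum_congr rfl fun v hv => ?_
      rw [(hg v hv).2, Pi.smul_apply, smul_eq_mul]
      congr 1
      conv_lhs => rw [← (hg v hv).2]

/-- Reserve `k a` of the `m` indices for each `a`; any remaining index is sent to an arbitrary
element. -/
theorem exists_map_of_card_fiber {α : Type*} [Fintype α] [Nonempty α] [DecidableEq α] (k : α → ℕ)
    {m : ℕ} (h : ∑ a, k a ≤ m) :
    ∃ p : Fin m → α, ∀ a, k a ≤ (Finset.univ.filter fun i => p i = a).card := by
  have hcard : Fintype.card (Σ a, Fin (k a)) ≤ Fintype.card (Fin m) := by simpa using h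
  obtain ⟨e⟩ := Function.Embedding.nonempty_of_card_le hcard
  refine ⟨fun i => if hi : ∃ s, e s = i then hi.choose.1 else Classical.arbitrary α, fun a => ?_⟩
  have : (Finset.univ.image fun j : Fin (k a) => e ⟨a, j⟩) ⊆
      Finset.univ.filter fun i => (if hi : ∃ s, e s = i then hi.choose.1 else
        Classical.arbitrary α) = a := by
    intro i hi
    obtain ⟨j, -, rfl⟩ := Finset.mem_image.1 hi
    have hex : ∃ s, e s = e ⟨a, j⟩ := ⟨_, rfl⟩
    rw [Finset.mem_filter]
    refine ⟨Finset.mem_univ _, ?_⟩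
    rw [dif_pos hex, e.injective hex.choose_spec]
  refine le_trans (le_of_eq ?_) (Finset.card_le_card this)
  rw [Finset.card_image_of_injective]
  · simp
  · intro i j hij
    simpa using e.injective hij

/-- Weak Rado with a prescribed number of equally weighted permutations. -/
theorem exists_perms_of_partial_sums_le {N : ℕ} {x y : ℕ → ℝ} (hy : Antitone y)
    (hx : ∀ j, 0 ≤ x j)
    (h : ∀ i ≤ N, ∑ j ∈ Finset.range i, y j ≤ ∑ j ∈ Finset.range i, x j) (n : ℕ) :
    ∃ p : Fin (n + N.factorial) → Equiv.Perm (Fin N),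
      ∀ j : Fin N, n * y j ≤ ∑ i, x (p i j) := by
  classical
  obtain ⟨lam, h0, h1, h2⟩ := exists_weights_of_partial_sums_le hy h
  -- Rounding each weight `n λ_π` up costs at most one per permutation, hence `N!` in total. The
  -- resulting count does not depend on the weights, so it can be the same for all blocks.
  obtain ⟨p, hp⟩ := exists_map_of_card_fiber (fun π => ⌈n * lam π⌉₊) (m := n + N.factorial) (by
    have e : (∑ π, (⌈n * lam π⌉₊ : ℝ)) ≤ n + N.factorial := by
      calc (∑ π, (⌈n * lam π⌉₊ : ℝ)) ≤ ∑ π : Equiv.Perm (Fin N), (n * lam π + 1) :=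
            Finset.sum_le_sum fun π _ =>
              (Nat.ceil_lt_add_one (mul_nonneg (Nat.cast_nonneg _) (h0 π))).le
        _ = _ := by
            rw [Finset.sum_add_distrib, ← Finset.mul_sum, h1, mul_one]
            simp [Fintype.card_perm]
    exact_mod_cast e)
  refine ⟨p, fun j => ?_⟩
  calc n * y j ≤ n * ∑ π, lam π * x (π j) :=
        mul_le_mul_of_nonneg_left (h2 j) (Nat.cast_nonneg _)
    _ = ∑ π, (n * lam π) * x (π j) := by
        rw [Finset.mul_sum]; exact Finset.sum_congr rfl fun π _ => by ring
    _ ≤ ∑ π, ((Finset.univ.filter fun i => p i = π).card : ℝ) * x (π j) := by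
        refine Finset.sum_le_sum fun π _ => mul_le_mul_of_nonneg_right ?_ (hx _)
        exact (Nat.le_ceil _).trans (by exact_mod_cast hp π)
    _ = ∑ i, x (p i j) := by
        rw [← Finset.sum_fiberwise Finset.univ p]
        refine Finset.sum_congr rfl fun π _ => ?_
        rw [← nsmul_eq_mul, ← Finset.sum_const]
        refine Finset.sum_congr rfl fun i hi => ?_
        rw [(Finset.mem_filter.1 hi).2]

/-! ### Parts of a function, transports, and the smallness criterion -/

section

/-- `z` is a nonnegative function whose distribution is, over positive values, dominated by that
of `f`: up to equimeasurability, `z` is the restriction of `f` to a part of its domain. -/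
structure IsPart (f z : ℝ → ℝ) : Prop where
  measurable : Measurable z
  nonneg : ∀ t, 0 ≤ z t
  dist_le : ∀ s s', 0 < s → mHalf {t | s < z t ∧ z t ≤ s'} ≤ mHalf {t | s < f t ∧ f t ≤ s'}

theorem IsPart.refl {f : ℝ → ℝ} (hf : Measurable f) (h0 : ∀ t, 0 ≤ f t) : IsPart f f :=
  ⟨hf, h0, fun _ _ _ => le_rfl⟩

theorem measure_gt_eq_iSup (z : ℝ → ℝ) (s : ℝ) :
    mHalf {t | s < z t} = ⨆ n : ℕ, mHalf {t | s < z t ∧ z t ≤ n} := by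
  have hU : {t | s < z t} = ⋃ n : ℕ, {t | s < z t ∧ z t ≤ n} := by
    ext t
    simp only [mem_ofPred_eq, mem_iUnion]
    exact ⟨fun h => (exists_nat_ge (z t)).imp fun n hn => ⟨h, hn⟩, fun ⟨n, h, _⟩ => h⟩
  have hmono : Monotone fun n : ℕ => {t | s < z t ∧ z t ≤ n} := fun a b hab t ht =>
    ⟨ht.1, ht.2.trans (by exact_mod_cast hab)⟩
  rw [hU, hmono.measure_iUnion]

theorem IsPart.measure_gt_le {f z : ℝ → ℝ} (h : IsPart f z) {s : ℝ} (hs : 0 < s) :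
    mHalf {t | s < z t} ≤ mHalf {t | s < f t} := by
  rw [measure_gt_eq_iSup, measure_gt_eq_iSup]
  exact iSup_mono fun n => h.dist_le s n hs

theorem IsPart.Phi_le {f z : ℝ → ℝ} (h : IsPart f z) (hf : Measurable f) (hf0 : ∀ t, 0 ≤ f t) {c : ℝ}
    (hc : 0 ≤ c) : Phi z c ≤ Phi f c :=
  Phi_le_of_dist h.measurable.aemeasurable hf.aemeasurable (fun s hs => by
    simp only [abs_of_nonneg (h.nonneg _), abs_of_nonneg (hf0 _)]
    exact h.measure_gt_le hs) hc

theorem IsPart.integrable {f z : ℝ → ℝ} (h : IsPart f z) (hf : Measurable f) (hf0 : ∀ t, 0 ≤ f t)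
    (hfi : Integrable f mHalf) : Integrable z mHalf :=
  integrable_of_Phi_zero_lt_top h.measurable.aestronglyMeasurable
    ((h.Phi_le hf hf0 le_rfl).trans_lt (Phi_lt_top hfi le_rfl))

theorem IsPart.indicator {f z : ℝ → ℝ} (h : IsPart f z) {S : Set ℝ} (hS : MeasurableSet S) :
    IsPart f (S.indicator z) := by
  refine ⟨h.measurable.indicator hS, fun t => indicator_nonneg (fun t _ => h.nonneg t) t,
    fun s s' hs => (measure_mono fun t ht => ?_).trans (h.dist_le s s' hs)⟩
  by_cases hts : t ∈ S
  · simpa [indicator_of_mem hts] using ht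
  · have h1 : s < S.indicator z t := ht.1
    rw [indicator_of_notMem hts] at h1
    linarith

/-- `T` maps the measure on `Y` to a measure dominated by Lebesgue measure on `(0, ∞)`. -/
structure IsTransport (Y : Set ℝ) (T : ℝ → ℝ) : Prop where
  measurableSet : MeasurableSet Y
  measurable : Measurable T
  map_le : (mHalf.restrict Y).map T ≤ mHalf

theorem IsTransport.measure_le {Y : Set ℝ} {T : ℝ → ℝ} (h : IsTransport Y T) {B : Set ℝ}
    (hB : MeasurableSet B) : mHalf (T ⁻¹' B ∩ Y) ≤ mHalf B := by
  have := h.map_le B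
  rwa [Measure.map_apply h.measurable hB, Measure.restrict_apply (h.measurable hB)] at this

theorem IsPart.comp {f z : ℝ → ℝ} (h : IsPart f z) {Y : Set ℝ} {T : ℝ → ℝ} (hT : IsTransport Y T) :
    IsPart f (Y.indicator fun t => z (T t)) := by
  refine ⟨(h.measurable.comp hT.measurable).indicator hT.measurableSet,
    fun t => indicator_nonneg (fun t _ => h.nonneg _) t, fun s s' hs => ?_⟩
  have hB : MeasurableSet {t | s < z t ∧ z t ≤ s'} :=
    (measurableSet_lt measurable_const h.measurable).inter
      (measurableSet_le h.measurable measurable_const)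
  refine ((measure_mono fun t ht => ?_).trans (hT.measure_le hB)).trans (h.dist_le s s' hs)
  by_cases hts : t ∈ Y
  · refine ⟨?_, hts⟩
    simpa [indicator_of_mem hts] using ht
  · have h1 : s < Y.indicator (fun t => z (T t)) t := ht.1
    rw [indicator_of_notMem hts] at h1
    linarith

/-- Piecewise translations with disjoint cells and disjoint images are transports. -/
theorem exists_isTransport {κ : Type*} [Countable κ] {Y : κ → Set ℝ} {c : κ → ℝ}
    (hYm : ∀ i, MeasurableSet (Y i)) (hYd : Pairwise (Function.onFun Disjoint Y))
    (hXd : ∀ i j, i ≠ j → ∀ t ∈ Y i, ∀ t' ∈ Y j, t + c i ≠ t' + c j)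
    (hXpos : ∀ i, ∀ t ∈ Y i, 0 < t + c i) :
    ∃ T, IsTransport (⋃ i, Y i) T ∧ ∀ i, ∀ t ∈ Y i, T t = t + c i := by
  rcases isEmpty_or_nonempty κ with hκ | hκ
  · refine ⟨id, ⟨MeasurableSet.iUnion hYm, measurable_id, ?_⟩, fun i => (hκ.false i).elim⟩
    simp only [iUnion_of_empty, Measure.restrict_empty, Measure.map_zero]
    exact Measure.zero_le _
  obtain ⟨T, hTm, hT⟩ := exists_measurable_piecewise Y hYm (fun i t => t + c i)
    (fun i => measurable_id.add_const _) (fun i j hij t ht =>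
      absurd ht.2 (disjoint_left.1 (hYd hij) ht.1))
  refine ⟨T, ⟨MeasurableSet.iUnion hYm, hTm, ?_⟩, fun i t ht => hT i ht⟩
  refine Measure.le_intro fun B hB _ => ?_
  rw [Measure.map_apply hTm hB, Measure.restrict_apply (hTm hB), inter_iUnion]
  refine (measure_iUnion_le _).trans ?_
  -- The sets `X i` are the translated cells. By their disjointness the measures of the pieces of
  -- `B` they cut out add up to at most the measure of `B`.
  set X : κ → Set ℝ := fun i => (fun t => t - c i) ⁻¹' Y i with hX
  have hXm : ∀ i, MeasurableSet (X i) := fun i => (measurable_id.sub_const _) (hYm i)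
  have hXd' : Pairwise (Function.onFun Disjoint fun i => B ∩ X i ∩ Ioi 0) := by
    intro i j hij
    refine disjoint_left.2 fun t ht ht' => ?_
    exact hXd i j hij _ ht.1.2 _ ht'.1.2 (by ring)
  calc ∑' i, mHalf (T ⁻¹' B ∩ Y i) ≤ ∑' i, volume (B ∩ X i ∩ Ioi 0) := by
        refine ENNReal.tsum_le_tsum fun i => ?_
        rw [← measure_preimage_add_right volume (c i) (B ∩ X i ∩ Ioi 0)]
        refine (Measure.restrict_apply_le _ _).trans (measure_mono fun t ht => ?_)
        have h1 : T t = t + c i := hT i ht.2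
        have h2 : T t ∈ B := ht.1
        refine ⟨⟨?_, ?_⟩, ?_⟩
        · change t + c i ∈ B
          rw [← h1]; exact h2
        · change t + c i - c i ∈ Y i
          rw [add_sub_cancel_right]; exact ht.2
        · exact hXpos i t ht.2
    _ = volume (⋃ i, B ∩ X i ∩ Ioi 0) :=
        (measure_iUnion hXd' fun i => (hB.inter (hXm i)).inter measurableSet_Ioi).symm
    _ ≤ volume (B ∩ Ioi 0) := measure_mono (iUnion_subset fun i t ht => ⟨ht.1.1, ht.2⟩)
    _ = mHalf B := (Measure.restrict_apply hB).symm

/-- Functions that are constant on the cells of a countable disjoint family. -/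
theorem exists_piecewise_const {κ : Type*} [Countable κ] {I : κ → Set ℝ}
    (hIm : ∀ i, MeasurableSet (I i)) (hId : Pairwise (Function.onFun Disjoint I)) {a : κ → ℝ}
    (ha : ∀ i, 0 ≤ a i) :
    ∃ e : ℝ → ℝ, Measurable e ∧ (∀ t, 0 ≤ e t) ∧ (∀ i, ∀ t ∈ I i, e t = a i) ∧
      ∀ c, 0 ≤ c → Phi e c = ∑' i, ENNReal.ofReal (a i - c) * mHalf (I i) := by
  obtain ⟨e, hem, he⟩ := exists_measurable_piecewise
    (fun i : Option κ => i.elim (⋃ i, I i)ᶜ I)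
    (fun i => by cases i with
      | none => exact (MeasurableSet.iUnion hIm).compl
      | some i => exact hIm i)
    (fun i (_ : ℝ) => i.elim 0 a) (fun i => measurable_const) (fun i j hij t ht => by
      cases i with
      | none => cases j with
        | none => exact absurd rfl hij
        | some j => exact absurd (mem_iUnion_of_mem j ht.2) ht.1
      | some i => cases j with
        | none => exact absurd (mem_iUnion_of_mem i ht.1) ht.2
        | some j => exact absurd ht.2 (disjoint_left.1 (hId fun h => hij (congrArg some h)) ht.1))
  have he1 : ∀ i, ∀ t ∈ I i, e t = a i := fun i t ht => he (some i) ht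
  have he0 : ∀ t, t ∉ ⋃ i, I i → e t = 0 := fun t ht => he none ht
  have hnn : ∀ t, 0 ≤ e t := fun t => by
    by_cases ht : t ∈ ⋃ i, I i
    · obtain ⟨i, hi⟩ := mem_iUnion.1 ht
      rw [he1 i t hi]; exact ha i
    · rw [he0 t ht]
  refine ⟨e, hem, hnn, he1, fun c hc => ?_⟩
  have h1 : Phi e c = ∫⁻ t in ⋃ i, I i, ENNReal.ofReal (|e t| - c) ∂mHalf := by
    rw [Phi, ← lintegral_add_compl _ (MeasurableSet.iUnion hIm)]
    rw [setLIntegral_congr_fun (s := (⋃ i, I i)ᶜ) (g := fun _ => 0)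
      (MeasurableSet.iUnion hIm).compl fun t ht => by
        simp only [he0 t ht, abs_zero]
        exact ENNReal.ofReal_of_nonpos (by linarith)]
    simp
  rw [h1, lintegral_iUnion hIm hId]
  refine tsum_congr fun i => ?_
  rw [setLIntegral_congr_fun (g := fun _ => ENNReal.ofReal (a i - c)) (hIm i) fun t ht => by
    simp only [he1 i t ht, abs_of_nonneg (ha i)]]
  rw [setLIntegral_const]

theorem exists_ofReal_mul_le {a ε : ℝ≥0∞} (ha : a < ∞) (hε : 0 < ε) :
    ∃ δ : ℝ, 0 < δ ∧ ENNReal.ofReal δ * a ≤ ε := by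
  have h1 : Tendsto (fun d : ℝ => ENNReal.ofReal d * a) (𝓝[>] 0) (𝓝 0) := by
    have h2 : Tendsto (fun d : ℝ => ENNReal.ofReal d) (𝓝[>] 0) (𝓝 (ENNReal.ofReal 0)) :=
      (ENNReal.continuous_ofReal.tendsto 0).mono_left nhdsWithin_le_nhds
    have := ENNReal.Tendsto.mul_const h2 (Or.inr ha.ne)
    simpa using this
  have h3 := (tendsto_order.1 h1).2 ε hε
  obtain ⟨d, hd, hd'⟩ := (h3.and self_mem_nhdsWithin).exists
  exact ⟨d, hd', hd.le⟩

variable {E : Type*} [NormedAddCommGroup E] [NormedSpace ℝ E] {ι : E →ₗ[ℝ] L0}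

theorem Phi_indicator_one {c : ℝ} (hc : 0 ≤ c) :
    Phi ((Icc (0 : ℝ) 1).indicator fun _ => 1) c = ENNReal.ofReal (1 - c) := by
  unfold Phi
  have : ∀ t, ENNReal.ofReal (|(Icc (0 : ℝ) 1).indicator (fun _ => (1 : ℝ)) t| - c) =
      (Icc (0 : ℝ) 1).indicator (fun _ => ENNReal.ofReal (1 - c)) t := fun t => by
    by_cases h : t ∈ Icc (0 : ℝ) 1
    · simp [indicator_of_mem h]
    · rw [indicator_of_notMem h, indicator_of_notMem h, abs_zero]
      exact ENNReal.ofReal_of_nonpos (by linarith)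
  simp only [this]
  rw [lintegral_indicator_const measurableSet_Icc, Measure.restrict_apply measurableSet_Icc]
  have : Icc (0 : ℝ) 1 ∩ Ioi 0 = Ioc 0 1 := by
    ext t; simp only [mem_inter_iff, mem_Icc, mem_Ioi, mem_Ioc]
    constructor
    · rintro ⟨⟨_, h⟩, h'⟩; exact ⟨h', h⟩
    · rintro ⟨h', h⟩; exact ⟨⟨h'.le, h⟩, h'⟩
  rw [this, Real.volume_Ioc]
  simp

/-- A function with modulus and integral both at most `b` is submajorized by `b χ_[0,1]`: for `c <
b` one has `(|v| - c)₊ ≤ ((b - c) / b) |v|`. -/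
theorem EN_le_of_bounded (hE : IsFullySymmetric ι) (hL1 : ∀ z : E, MemL1 (ι z)) {v : ℝ → ℝ}
    (hv : Integrable v mHalf) {b : ℝ} (hb : 0 < b) (hvb : ∀ t, |v t| ≤ b)
    (hv1 : Phi v 0 ≤ ENNReal.ofReal b) :
    EN ι v ≤ ENNReal.ofReal b * EN ι ((Icc (0 : ℝ) 1).indicator fun _ => 1) := by
  rw [← EN_const_mul hb]
  refine EN_le_of_Phi hE hL1 hv fun c hc => ?_
  have h1 : Phi (fun t => b * (Icc (0 : ℝ) 1).indicator (fun _ => 1) t) c =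
      ENNReal.ofReal (b - c) := by
    have h2 : Phi (fun t => b * (Icc (0 : ℝ) 1).indicator (fun _ => 1) t) c =
        ENNReal.ofReal b * Phi ((Icc (0 : ℝ) 1).indicator fun _ => 1) (c / b) := by
      unfold Phi
      rw [← lintegral_const_mul' _ _ ENNReal.ofReal_ne_top]
      refine lintegral_congr fun t => ?_
      rw [← ENNReal.ofReal_mul hb.le, abs_mul, abs_of_pos hb, mul_sub, mul_div_cancel₀ _ hb.ne']
    rw [h2, Phi_indicator_one (div_nonneg hc.le hb.le), ← ENNReal.ofReal_mul hb.le, mul_sub, mul_one,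
      mul_div_cancel₀ _ hb.ne']
  rw [h1]
  rcases le_or_gt b c with hbc | hbc
  · have : Phi v c = 0 := by
      rw [Phi, lintegral_eq_zero_of_ae_eq_zero]
      exact ae_of_all _ fun t => ENNReal.ofReal_of_nonpos (by linarith [hvb t])
    rw [this]; exact zero_le
  · have h3 : Phi v c ≤ ENNReal.ofReal ((b - c) / b) * Phi v 0 := by
      unfold Phi
      rw [← lintegral_const_mul' _ _ ENNReal.ofReal_ne_top]
      refine lintegral_mono fun t => ?_
      have hbc' : 0 ≤ (b - c) / b := div_nonneg (by linarith) hb.le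
      rw [← ENNReal.ofReal_mul hbc', sub_zero]
      refine ENNReal.ofReal_le_ofReal ?_
      rw [div_mul_eq_mul_div, le_div_iff₀ hb]
      nlinarith [hvb t]
    refine h3.trans ((mul_le_mul_right hv1 _).trans_eq ?_)
    rw [← ENNReal.ofReal_mul (div_nonneg (by linarith) hb.le), div_mul_cancel₀ _ hb.ne']

/-- If `φ_fin(x) = 0`, functions submajorized by `n⁻¹ σ_n(x^*)` with small integral have small
norm. -/
theorem exists_EN_le_of_phiFin_eq_zero (hE : IsFullySymmetric ι) (hL1 : ∀ z : E, MemL1 (ι z)) (x : E)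
    (hphi : phiFin ι (ι x) = 0) (hone : EN ι ((Icc (0 : ℝ) 1).indicator fun _ => 1) < ∞) {ε : ℝ≥0∞}
    (hε : 0 < ε) :
    ∃ (n₀ : ℕ) (δ : ℝ), 0 < n₀ ∧ 0 < δ ∧ ∀ (r : ℝ) (v : ℝ → ℝ), n₀ ≤ r → Measurable v →
      (∀ t, 0 ≤ v t) → (∀ c, 0 ≤ c → Phi v c ≤ Phi (rearrR (ι x)) (r * c)) →
      Phi v 0 ≤ ENNReal.ofReal δ → EN ι v ≤ ε := by
  set f := rearrR (ι x) with hf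
  have hfi : Integrable f mHalf := integrable_rearrR (hL1 x)
  have hf0 := rearrR_nonneg (ι x)
  obtain ⟨hlim, -, -⟩ := tendsto_phiFinQuot hE hL1 x
  rw [hphi] at hlim
  obtain ⟨δ, hδ0, hδ⟩ := exists_ofReal_mul_le hone (ENNReal.half_pos hε.ne')
  -- `f (1 / r) / r ≤ ∫_0^{1/r} f → 0`
  have hsmall : ∀ᶠ r : ℝ in atTop, r⁻¹ * f r⁻¹ ≤ δ := by
    have h1 : Tendsto (fun r : ℝ => ∫⁻ t in Ioc 0 r⁻¹, ENNReal.ofReal (f t) ∂mHalf) atTop (𝓝 0) := by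
      refine tendsto_setLIntegral_zero ?_ ?_
      · have := Phi_lt_top hfi (le_refl 0)
        unfold Phi at this
        have habs : ∀ t, |f t| = f t := fun t => abs_of_nonneg (hf0 t)
        simp only [sub_zero, habs] at this
        exact this.ne
      · have h2 : Tendsto (fun r : ℝ => ENNReal.ofReal r⁻¹) atTop (𝓝 (ENNReal.ofReal 0)) :=
          ENNReal.tendsto_ofReal tendsto_inv_atTop_zero
        rw [ENNReal.ofReal_zero] at h2
        refine tendsto_of_tendsto_of_tendsto_of_le_of_le tendsto_const_nhds h2
          (fun _ => zero_le) fun r => ?_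
        refine (Measure.restrict_apply_le _ _).trans_eq ?_
        rw [Real.volume_Ioc, sub_zero]
    have h3 := (tendsto_order.1 h1).2 (ENNReal.ofReal δ) (by simpa using hδ0)
    filter_upwards [h3, eventually_gt_atTop 0] with r hr hr0
    have hri : 0 < r⁻¹ := inv_pos.2 hr0
    have h4 : ENNReal.ofReal (r⁻¹ * f r⁻¹) ≤ ∫⁻ t in Ioc 0 r⁻¹, ENNReal.ofReal (f t) ∂mHalf := by
      have h5 : ∫⁻ t in Ioc 0 r⁻¹, ENNReal.ofReal (f r⁻¹) ∂mHalf ≤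
          ∫⁻ t in Ioc 0 r⁻¹, ENNReal.ofReal (f t) ∂mHalf :=
        setLIntegral_mono' measurableSet_Ioc fun t ht =>
          ENNReal.ofReal_le_ofReal (rearrR_antitoneOn (hL1 x) ht.1 hri ht.2)
      refine le_trans (le_of_eq ?_) h5
      rw [setLIntegral_const, Measure.restrict_apply measurableSet_Ioc,
        inter_eq_self_of_subset_left Ioc_subset_Ioi_self, Real.volume_Ioc, sub_zero,
        ENNReal.ofReal_mul hri.le, mul_comm]
    exact (ENNReal.ofReal_le_ofReal_iff hδ0.le).1 (h4.trans hr.le)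
  have hquot := (tendsto_order.1 hlim).2 (ε / 2) (ENNReal.half_pos hε.ne')
  obtain ⟨R, hR⟩ := eventually_atTop.1 (hsmall.and hquot)
  obtain ⟨n₀, hn₀⟩ := exists_nat_gt (max R 0)
  refine ⟨n₀, δ, by exact_mod_cast (le_max_right R 0).trans_lt hn₀, hδ0,
    fun r v hr hvm hv0 hvPhi hv1 => ?_⟩
  have hr0 : 0 < r := ((le_max_right R 0).trans_lt hn₀).trans_le hr
  obtain ⟨hr1, hr2⟩ := hR r (((le_max_left R 0).trans_lt hn₀).le.trans hr)
  rw [phiFinQuot_eq _ hr0] at hr2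
  have hvi : Integrable v mHalf := integrable_of_Phi_zero_lt_top hvm.aestronglyMeasurable
    (hv1.trans_lt ENNReal.ofReal_lt_top)
  -- The lower part `min v δ` is bounded by `δ` with integral at most `δ`. The upper part will be
  -- submajorized by the truncated dilation, whose norm is already small.
  have hsum : v = fun t => max (v t - δ) 0 + min (v t) δ := by
    ext t
    rcases le_total (v t) δ with h | h
    · rw [max_eq_right (by linarith), min_eq_left h, zero_add]
    · rw [max_eq_left (by linarith), min_eq_right h]; ring
  rw [hsum]
  refine (EN_add_le _ _).trans ((add_le_add ?_ ?_).trans_eq (ENNReal.add_halves ε))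
  · refine le_trans (EN_le_of_Phi hE hL1 (integrable_excess hvi hδ0.le) fun c hc => ?_) hr2.le
    rw [Phi_excess hv0 hc.le, Phi_scaledCut _ hr0]
    refine (hvPhi _ (by linarith)).trans ?_
    -- Beyond `1/r` the values of `f` are at most `r δ`, so the excess at level `r (c + δ)` sees
    -- only the window `[0, 1/r]`.
    refine lintegral_mono_ae (ae_pos.mono fun t ht => ENNReal.ofReal_le_ofReal_iff'.2 ?_)
    by_cases h : t ∈ Icc 0 r⁻¹
    · left
      rw [indicator_of_mem h]
      nlinarith
    · right
      have h1 : r⁻¹ ≤ t := by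
        by_contra! h1; exact h ⟨le_of_lt ht, h1.le⟩
      have h2 := rearrR_antitoneOn (hL1 x) (show r⁻¹ ∈ Ioi (0 : ℝ) from inv_pos.2 hr0) ht h1
      rw [abs_of_nonneg (hf0 t)]
      have h3 : f r⁻¹ ≤ r * δ := by
        have := mul_le_mul_of_nonneg_left hr1 hr0.le
        rwa [← mul_assoc, mul_inv_cancel₀ hr0.ne', one_mul] at this
      have : 0 ≤ r * c := mul_nonneg hr0.le hc.le
      have h4 : f t ≤ f r⁻¹ := h2
      linarith
  · refine le_trans (EN_le_of_bounded hE hL1 ?_ hδ0 (fun t => ?_) ?_) hδ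
    · exact hvi.mono (hvm.min measurable_const).aestronglyMeasurable (ae_of_all _ fun t => by
        rw [Real.norm_of_nonneg (le_min (hv0 t) hδ0.le), Real.norm_of_nonneg (hv0 t)]
        exact min_le_left _ _)
    · rw [abs_of_nonneg (le_min (hv0 t) hδ0.le)]; exact min_le_right _ _
    · refine (Phi_mono (ae_of_all _ fun t => ?_) _).trans hv1
      rw [abs_of_nonneg (le_min (hv0 t) hδ0.le), abs_of_nonneg (hv0 t)]
      exact min_le_left _ _

end

/-! ### Concave primitives, the point `reach`, and sampling on a block -/

section

/-- Nonnegative integrable functions which are non-increasing on `(0, ∞)`. -/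
structure Dec (f : ℝ → ℝ) : Prop where
  measurable : Measurable f
  nonneg : ∀ t, 0 ≤ f t
  antitoneOn : AntitoneOn f (Ioi 0)
  integrable : Integrable f mHalf

/-- The primitive `t ↦ ∫_0^t f` on the semi-axis. -/
def primitive (f : ℝ → ℝ) (t : ℝ) : ℝ := ∫ s in (0 : ℝ)..t, f s ∂mHalf

@[simp] theorem primitive_zero (f : ℝ → ℝ) : primitive f 0 = 0 := by simp [primitive]

theorem primitive_sub {f : ℝ → ℝ} (hf : Integrable f mHalf) (a b : ℝ) :
    primitive f b - primitive f a = ∫ s in a..b, f s ∂mHalf :=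
  intervalIntegral.integral_interval_sub_left hf.intervalIntegrable hf.intervalIntegrable

theorem continuous_primitive {f : ℝ → ℝ} (hf : Integrable f mHalf) : Continuous (primitive f) :=
  intervalIntegral.continuous_primitive (fun _ _ => hf.intervalIntegrable) 0

theorem mHalf_Ioc {a b : ℝ} (ha : 0 ≤ a) : mHalf (Ioc a b) = ENNReal.ofReal (b - a) := by
  rw [Measure.restrict_apply measurableSet_Ioc, inter_eq_self_of_subset_left, Real.volume_Ioc]
  exact fun t ht => ha.trans_lt ht.1

theorem intervalIntegral_const_mHalf {a b : ℝ} (ha : 0 ≤ a) (hab : a ≤ b) (c : ℝ) :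
    ∫ _ in a..b, c ∂mHalf = (b - a) * c := by
  rw [intervalIntegral.integral_of_le hab, setIntegral_const, measureReal_def, mHalf_Ioc ha,
    ENNReal.toReal_ofReal (by linarith), smul_eq_mul]

namespace Dec

variable {f : ℝ → ℝ}

theorem monotone_primitive (hf : Dec f) : Monotone (primitive f) := fun a b hab => by
  rw [← sub_nonneg, primitive_sub hf.integrable]
  exact intervalIntegral.integral_nonneg_of_forall hab hf.nonneg

theorem primitive_sub_le (hf : Dec f) {a b : ℝ} (ha : 0 < a) (hab : a ≤ b) :
    primitive f b - primitive f a ≤ (b - a) * f a := by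
  rw [primitive_sub hf.integrable, ← intervalIntegral_const_mHalf ha.le hab]
  refine intervalIntegral.integral_mono_on hab hf.integrable.intervalIntegrable
    intervalIntegrable_const fun t ht => ?_
  exact hf.antitoneOn ha (ha.trans_le ht.1) ht.1

theorem le_primitive_sub (hf : Dec f) {a b : ℝ} (ha : 0 ≤ a) (hab : a ≤ b) :
    (b - a) * f b ≤ primitive f b - primitive f a := by
  rw [primitive_sub hf.integrable, ← intervalIntegral_const_mHalf ha hab,
    intervalIntegral.integral_of_le hab, intervalIntegral.integral_of_le hab]
  refine setIntegral_mono_on (integrableOn_const (by rw [mHalf_Ioc ha]; exact ENNReal.ofReal_ne_top)) hf.integrable.integrableOn measurableSet_Ioc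
    fun t ht => ?_
  exact hf.antitoneOn (ha.trans_lt ht.1) ((ha.trans_lt ht.1).trans_le ht.2) ht.2

/-- The primitive of a decreasing function is concave: slopes of chords from a fixed left end
decrease. -/
theorem chord_left (hf : Dec f) {a b c : ℝ} (ha : 0 ≤ a) (hab : a ≤ b) (hbc : b ≤ c) :
    (primitive f c - primitive f a) * (b - a) ≤ (primitive f b - primitive f a) * (c - a) := by
  rcases hab.eq_or_lt with rfl | hab
  · simp
  have h1 := hf.le_primitive_sub ha hab.le
  have h2 := hf.primitive_sub_le (ha.trans_lt hab) hbc
  nlinarith [mul_le_mul_of_nonneg_left h1 (sub_nonneg.2 hbc),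
    mul_le_mul_of_nonneg_left h2 (sub_nonneg.2 hab.le)]

theorem chord_right (hf : Dec f) {a b c : ℝ} (ha : 0 ≤ a) (hab : a ≤ b) (hbc : b ≤ c) :
    (primitive f c - primitive f b) * (c - a) ≤ (primitive f c - primitive f a) * (c - b) := by
  nlinarith [hf.chord_left ha hab hbc]

end Dec

/-- The first point at which the primitive of `f` reaches the value `∫_0^p g`. -/
def reach (f g : ℝ → ℝ) (p : ℝ) : ℝ := sInf {s | 0 ≤ s ∧ primitive g p ≤ primitive f s}

section Reach

variable {f g : ℝ → ℝ}

theorem reach_mem (hf : Dec f) 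
    (hfg : ∀ t, 0 ≤ t → primitive g t ≤ primitive f t) {p : ℝ} (hp : 0 ≤ p) :
    reach f g p ∈ {s | 0 ≤ s ∧ primitive g p ≤ primitive f s} := by
  refine IsClosed.csInf_mem ?_ ⟨p, hp, hfg p hp⟩ ⟨0, fun s hs => hs.1⟩
  exact isClosed_Ici.inter (isClosed_le continuous_const (continuous_primitive hf.integrable))

theorem reach_nonneg (hf : Dec f) 
    (hfg : ∀ t, 0 ≤ t → primitive g t ≤ primitive f t) {p : ℝ} (hp : 0 ≤ p) : 0 ≤ reach f g p := (reach_mem hf hfg hp).1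

theorem reach_le (hfg : ∀ t, 0 ≤ t → primitive g t ≤ primitive f t) {p : ℝ} (hp : 0 ≤ p) : reach f g p ≤ p :=
  csInf_le ⟨0, fun _ hs => hs.1⟩ ⟨hp, hfg p hp⟩

theorem reach_mono (hg : Dec g)
    (hfg : ∀ t, 0 ≤ t → primitive g t ≤ primitive f t) {p q : ℝ} (hp : 0 ≤ p) (hpq : p ≤ q) : reach f g p ≤ reach f g q :=
  csInf_le_csInf ⟨0, fun _ hs => hs.1⟩ ⟨q, hp.trans hpq, hfg q (hp.trans hpq)⟩
    fun _ hs => ⟨hs.1, (hg.monotone_primitive hpq).trans hs.2⟩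

theorem primitive_reach (hf : Dec f) (hg : Dec g)
    (hfg : ∀ t, 0 ≤ t → primitive g t ≤ primitive f t) {p : ℝ} (hp : 0 ≤ p) : primitive f (reach f g p) = primitive g p := by
  refine le_antisymm ?_ (reach_mem hf hfg hp).2
  have h0 : primitive f 0 ≤ primitive g p := by
    rw [primitive_zero, ← primitive_zero g]; exact hg.monotone_primitive hp
  obtain ⟨s, hs, hs'⟩ := intermediate_value_Icc hp
    (continuous_primitive hf.integrable).continuousOn ⟨h0, hfg p hp⟩
  rw [← hs']
  exact hf.monotone_primitive (csInf_le ⟨0, fun _ h => h.1⟩ ⟨hs.1, hs'.ge⟩)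

/-- Increments of `∫ g` right of `r > p` are controlled by increments of `∫ f` right of the point
`s` with `∫_0^s f = ∫_0^p g`. -/
theorem primitive_sub_le_reach (hf : Dec f) (hg : Dec g)
    (hfg : ∀ t, 0 ≤ t → primitive g t ≤ primitive f t) {p q r u : ℝ} (hp : 0 ≤ p) (hpr : p < r) (hu : 0 ≤ u)
    (hq : r + u ≤ q) :
    primitive g (r + u) - primitive g r ≤
      r / (r - p) * (primitive f (min (reach f g p + u) (reach f g q)) -
        primitive f (reach f g p)) := by
  have hr : 0 < r := hp.trans_lt hpr
  have hrp : 0 < r - p := sub_pos.2 hpr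
  have h1 : 1 ≤ r / (r - p) := by rw [one_le_div hrp]; linarith
  set s := reach f g p
  have hs0 : 0 ≤ s := reach_nonneg hf hfg hp
  have hs : primitive f s = primitive g p := primitive_reach hf hg hfg hp
  have hpr' : primitive g p ≤ primitive g r := hg.monotone_primitive hpr.le
  have hru : primitive g r ≤ primitive g (r + u) := hg.monotone_primitive (by linarith)
  -- If the window of `f` already reaches the value `∫_0^{r+u} g`, its increment exceeds that of `g`
  -- over `[p, r + u]`, so no factor is lost.
  have simple : ∀ w, primitive g (r + u) ≤ primitive f w →
      primitive g (r + u) - primitive g r ≤ r / (r - p) * (primitive f w - primitive f s) := by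
    intro w hw
    rw [hs]
    nlinarith
  rcases le_total (reach f g q) (s + u) with h | h
  · rw [min_eq_right h]
    refine simple _ ?_
    rw [primitive_reach hf hg hfg (by linarith)]
    exact hg.monotone_primitive hq
  · rw [min_eq_left h]
    have hw := primitive_reach hf hg hfg (p := r + u) (by linarith)
    set w := reach f g (r + u)
    have hwle : w ≤ r + u := reach_le hfg (by linarith)
    rcases le_total w (s + u) with hws | hws
    · exact simple _ (hw.ge.trans (hf.monotone_primitive hws))
    -- Otherwise compare slopes. Concavity of `∫ f` on `[s, w]`, with `w ≤ r + u`, and of `∫ g` on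
    -- `[p, r + u]` gives the ratio `(r + u) / (r + u - p)`, which is at most `r / (r - p)`.
    · have c1 := hf.chord_left (a := s) (b := s + u) (c := w) hs0 (by linarith) hws
      have c2 := hg.chord_right (a := p) (b := r) (c := r + u) hp hpr.le (by linarith)
      rw [hw, hs] at c1
      rw [hs, div_mul_eq_mul_div, le_div_iff₀ hrp]
      have e1 : (s + u - s) = u := by ring
      have e2 : r + u - r = u := by ring
      rw [e1] at c1
      rw [e2] at c2
      set A := primitive g (r + u) - primitive g r
      set B := primitive g (r + u) - primitive g p
      set D := primitive f (s + u) - primitive g p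
      have hD : 0 ≤ D := by
        have := hf.monotone_primitive (show s ≤ s + u by linarith)
        simp only [D]; linarith
      have hA : 0 ≤ A := by simp only [A]; linarith
      have c3 : A * (r + u - p) ≤ D * (r + u) := by
        refine c2.trans (c1.trans ?_)
        exact mul_le_mul_of_nonneg_left (by linarith) hD
      have hru0 : 0 < r + u := by linarith
      have c4 : A * (r - p) * (r + u) ≤ r * D * (r + u) := by
        have : A * (r - p) * (r + u) ≤ A * (r + u - p) * r := by
          nlinarith [mul_nonneg (mul_nonneg hA hu) hp]
        nlinarith
      exact le_of_mul_le_mul_right c4 hru0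

end Reach

/-- Means over initial segments of a decreasing sequence decrease with the length. -/
theorem sum_range_mul_le_of_antitone {a : ℕ → ℝ} (ha : Antitone a) {i n : ℕ} (hin : i ≤ n) :
    (i : ℝ) * ∑ j ∈ Finset.range n, a j ≤ n * ∑ j ∈ Finset.range i, a j := by
  rcases Nat.eq_zero_or_pos i with rfl | hi
  · simp
  have h1 : (i : ℝ) * a (i - 1) ≤ ∑ j ∈ Finset.range i, a j := by
    have := Finset.card_nsmul_le_sum (Finset.range i) a (a (i - 1)) fun j hj =>
      ha (by have := Finset.mem_range.1 hj; omega)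
    simpa using this
  have h2 : ∑ j ∈ Finset.Ico i n, a j ≤ (n - i : ℝ) * a (i - 1) := by
    have := Finset.sum_le_card_nsmul (Finset.Ico i n) a (a (i - 1)) fun j hj =>
      ha (by have := Finset.mem_Ico.1 hj; omega)
    simpa [Nat.cast_sub hin] using this
  have h3 := Finset.sum_range_add_sum_Ico a hin
  have h4 : (0 : ℝ) ≤ n - i := sub_nonneg.2 (by exact_mod_cast hin)
  rw [← h3]
  nlinarith [Nat.cast_nonneg (α := ℝ) i]

/-- Sampled version of the block inequality. -/
theorem mesh_sum_le {g G φ Ψ : ℝ → ℝ} {p : ℝ} (hp : 0 < p) {μ Q n : ℕ} (hμ : 3 ≤ μ) (hn : 0 < n)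
    (hg : AntitoneOn g (Ioi 0)) (hG : ∀ a b, 0 ≤ a → a ≤ b → (b - a) * g b ≤ G b - G a)
    (hφ : AntitoneOn φ (Ioi 0)) (hφ0 : ∀ t, 0 ≤ φ t) (hΨ0 : ∀ t, 0 ≤ t → 0 ≤ Ψ t)
    (hΨ : ∀ a b, 0 < a → a ≤ b → Ψ b - Ψ a ≤ (b - a) * φ a)
    (hblock : ∀ r u, p < r → 0 ≤ u → r + u ≤ Q * p → G (r + u) - G r ≤ r / (r - p) * Ψ u)
    {i : ℕ} (hi : i ≤ n * (Q - μ)) (hμQ : μ < Q) :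
    ∑ j ∈ Finset.range i, g (μ * p + j * (p / n)) ≤
      ((μ - 1 : ℝ) / (μ - 2)) * ∑ j ∈ Finset.range i,
        (φ ((j + 1) * (p / n)) + if j < n then Ψ (p / n) / p else 0) := by
  rcases Nat.eq_zero_or_pos i with rfl | hi0
  · simp
  have hμ' : (3 : ℝ) ≤ μ := by exact_mod_cast hμ
  have hn' : (1 : ℝ) ≤ n := by exact_mod_cast hn
  set h := p / n with hh
  have hh0 : 0 < h := by positivity
  have hnh : n * h = p := by rw [hh]; field_simp
  have hhp : h ≤ p := by nlinarith
  -- This is `r / (r - p)` at `r = (μ - 1) p`, hence a bound for all larger `r`.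
  set C : ℝ := (μ - 1 : ℝ) / (μ - 2) with hC
  have hC0 : 0 ≤ C := div_nonneg (by linarith) (by linarith)
  have hCr : ∀ r, (μ - 1) * p ≤ r → r / (r - p) ≤ C := by
    intro r hr
    have : 0 < r - p := by nlinarith
    rw [hC, div_le_div_iff₀ this (by linarith)]
    nlinarith
  -- the primitive is controlled by right end sums
  have hsum' : ∀ k : ℕ, Ψ ((k + 1) * h) ≤ Ψ h + h * ∑ j ∈ Finset.range k, φ ((j + 1) * h) := by
    intro k
    induction k with
    | zero => simp
    | succ k ih =>
      have h1 := hΨ ((k + 1) * h) ((k + 1 + 1) * h) (by positivity) (by nlinarith)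
      have h2 : ((k : ℝ) + 1 + 1) * h - (k + 1) * h = h := by ring
      rw [h2] at h1
      rw [Finset.sum_range_succ, mul_add]
      push_cast
      linarith
  have hsum : ∀ k : ℕ, 0 < k → Ψ (k * h) ≤ Ψ h + h * ∑ j ∈ Finset.range k, φ ((j + 1) * h) := by
    intro k hk
    obtain ⟨k, rfl⟩ : ∃ k', k = k' + 1 := ⟨k - 1, by omega⟩
    rw [Finset.sum_range_succ, mul_add]
    have h3 := mul_nonneg hh0.le (hφ0 ((k + 1) * h))
    have := hsum' k
    push_cast
    linarith
  have hφa : Antitone fun j : ℕ => φ ((j + 1) * h) := fun a b hab =>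
    hφ (show (0 : ℝ) < _ by positivity) (show (0 : ℝ) < _ by positivity) (by gcongr)
  set S := ∑ j ∈ Finset.range i, φ ((j + 1) * h) with hS
  have hS0 : 0 ≤ S := Finset.sum_nonneg fun j _ => hφ0 _
  have hiN : (i : ℝ) * h ≤ (Q - μ) * p := by
    have : (i : ℝ) ≤ n * (Q - μ) := by
      have h1 : ((n * (Q - μ) : ℕ) : ℝ) = n * (Q - μ) := by
        push_cast [Nat.cast_sub hμQ.le]; ring
      rw [← h1]; exact_mod_cast hi
    calc (i : ℝ) * h ≤ n * (Q - μ) * h := by gcongr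
      _ = (Q - μ) * p := by rw [← hnh]; ring
  rw [Finset.sum_add_distrib, ← hS]
  rw [← mul_le_mul_iff_right₀ hh0]
  rcases le_or_gt n i with hni | hin
  -- Right-endpoint sums of `φ` miss the first cell. Its contribution `Ψ h` is repaid in `n` equal
  -- shares, as `n h = p`; spreading it over a length `p` keeps the correction flat.
  · have e1 : ∑ j ∈ Finset.range i, (if j < n then Ψ h / p else 0) = Ψ h / h := by
      rw [← Finset.sum_filter, Finset.sum_const, nsmul_eq_mul]
      have : (Finset.range i).filter (· < n) = Finset.range n := by
        ext j; simp; omega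
      rw [this, Finset.card_range, ← hnh]
      field_simp
    rw [e1]
    have e2 : h * (C * (S + Ψ h / h)) = C * (Ψ h + h * S) := by field_simp; ring
    rw [e2]
    -- Each sample of `g` is compared with the cell on its left, so integration starts at `μ p - h`,
    -- which is still at least `(μ - 1) p`.
    have t1 : h * ∑ j ∈ Finset.range i, g (μ * p + j * h) ≤ G (μ * p - h + i * h) - G (μ * p - h) := by
      have : G (μ * p - h + i * h) - G (μ * p - h) =
          ∑ j ∈ Finset.range i, (G (μ * p - h + (j + 1 : ℕ) * h) - G (μ * p - h + j * h)) := by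
        rw [Finset.sum_range_sub (fun j : ℕ => G (μ * p - h + j * h))]; simp
      rw [this, Finset.mul_sum]
      refine Finset.sum_le_sum fun j _ => ?_
      have := hG (μ * p - h + j * h) (μ * p - h + (j + 1 : ℕ) * h) (by
        have : 0 ≤ (j : ℝ) * h := by positivity
        nlinarith) (by push_cast; nlinarith)
      refine le_trans (le_of_eq ?_) this
      push_cast
      congr 1
      · ring
      · congr 1; ring
    refine t1.trans ((hblock _ _ (by nlinarith) (by positivity) (by nlinarith)).trans ?_)
    have hr : (μ - 1) * p ≤ μ * p - h := by nlinarith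
    have h0 : 0 ≤ Ψ (i * h) := hΨ0 _ (by positivity)
    exact (mul_le_mul_of_nonneg_right (hCr _ hr) h0).trans
      (mul_le_mul_of_nonneg_left (hsum i hi0) hC0)
  -- With fewer than `n` samples only some shares of the correction are present. All samples are
  -- bounded by `g (μ p)`, which is controlled by `Ψ p`, and a shorter mean of `φ` is at least the
  -- mean over `n` cells.
  · have e1 : ∑ j ∈ Finset.range i, (if j < n then Ψ h / p else 0) = i * (Ψ h / p) := by
      rw [Finset.sum_congr rfl fun j hj => if_pos ((Finset.mem_range.1 hj).trans hin)]
      simp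
    rw [e1]
    have hi1 : (1 : ℝ) ≤ i := by exact_mod_cast hi0
    have t1 : ∑ j ∈ Finset.range i, g (μ * p + j * h) ≤ i * g (μ * p) := by
      have := Finset.sum_le_card_nsmul (Finset.range i) (fun j : ℕ => g (μ * p + j * h)) (g (μ * p))
        fun j _ => hg (show (0 : ℝ) < _ by positivity) (show (0 : ℝ) < _ by positivity)
          (by have : 0 ≤ (j : ℝ) * h := by positivity
              linarith)
      simpa using this
    have t2 : p * g (μ * p) ≤ C * Ψ p := by
      have h1 := hG ((μ - 1) * p) (μ * p) (by nlinarith) (by nlinarith)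
      have e2 : (μ : ℝ) * p - (μ - 1) * p = p := by ring
      rw [e2] at h1
      have hQ : (μ : ℝ) ≤ Q := by exact_mod_cast hμQ.le
      have h2 := hblock ((μ - 1) * p) p (by nlinarith) hp.le (by nlinarith)
      have e3 : ((μ : ℝ) - 1) * p + p = μ * p := by ring
      rw [e3] at h2
      exact h1.trans (h2.trans (mul_le_mul_of_nonneg_right (hCr _ le_rfl) (hΨ0 _ hp.le)))
    have t3 := hsum n hn
    rw [hnh] at t3
    have t4 := sum_range_mul_le_of_antitone hφa hin.le
    beta_reduce at t4
    rw [← hS] at t4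
    set T := ∑ j ∈ Finset.range n, φ ((j + 1) * h)
    have t5 : (i : ℝ) * Ψ p ≤ i * Ψ h + p * S := by
      have : (i : ℝ) * (h * T) ≤ p * S := by
        rw [← hnh]
        nlinarith [mul_le_mul_of_nonneg_left t4 hh0.le]
      nlinarith [mul_le_mul_of_nonneg_left t3 (zero_le_one.trans hi1)]
    have t6 : p * (∑ j ∈ Finset.range i, g (μ * p + j * h)) ≤ C * (i * Ψ h + p * S) := by
      calc p * (∑ j ∈ Finset.range i, g (μ * p + j * h)) ≤ p * (i * g (μ * p)) := by gcongr
        _ = i * (p * g (μ * p)) := by ring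
        _ ≤ i * (C * Ψ p) := by gcongr
        _ = C * (i * Ψ p) := by ring
        _ ≤ _ := by gcongr
    have e4 : C * (i * Ψ h + p * S) = p * (C * (S + i * (Ψ h / p))) := by field_simp; ring
    rw [e4] at t6
    exact mul_le_mul_of_nonneg_left (le_of_mul_le_mul_left t6 hp) hh0.le

end

/-! ### Geometric sequences of blocks -/

section

/-- The function `v ↦ f (s + v)`, cut off where `s + v` exceeds `s'`. -/
def shiftCut (f : ℝ → ℝ) (s s' v : ℝ) : ℝ := if s + v ≤ s' then f (s + v) else 0

/-- The integral of `shiftCut f s s'` over `(0, u)`. -/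
def shiftCutPrim (f : ℝ → ℝ) (s s' u : ℝ) : ℝ := primitive f (min (s + u) s') - primitive f s

theorem shiftCut_nonneg {f : ℝ → ℝ} (hf : Dec f) (s s' v : ℝ) : 0 ≤ shiftCut f s s' v := by
  unfold shiftCut; split_ifs
  exacts [hf.nonneg _, le_rfl]

theorem antitoneOn_shiftCut {f : ℝ → ℝ} (hf : Dec f) {s s' : ℝ} (hs : 0 ≤ s) :
    AntitoneOn (shiftCut f s s') (Ioi 0) := by
  intro a ha b hb hab
  have ha' : 0 < a := ha
  unfold shiftCut
  split_ifs with h1 h2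
  · exact hf.antitoneOn (show 0 < s + a by linarith) (show 0 < s + b by linarith) (by linarith)
  · exact absurd (by linarith) h2
  · exact hf.nonneg _
  · exact le_rfl

theorem shiftCutPrim_nonneg {f : ℝ → ℝ} (hf : Dec f) {s s' u : ℝ} (hss : s ≤ s') (hu : 0 ≤ u) :
    0 ≤ shiftCutPrim f s s' u :=
  sub_nonneg.2 (hf.monotone_primitive (le_min (by linarith) hss))

theorem monotone_shiftCutPrim {f : ℝ → ℝ} (hf : Dec f) (s s' : ℝ) :
    Monotone (shiftCutPrim f s s') := fun a b hab =>
  sub_le_sub_right (hf.monotone_primitive (min_le_min_right _ (by linarith))) _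

theorem shiftCutPrim_sub_le {f : ℝ → ℝ} (hf : Dec f) {s s' a b : ℝ} (hs : 0 ≤ s) (ha : 0 < a)
    (hab : a ≤ b) :
    shiftCutPrim f s s' b - shiftCutPrim f s s' a ≤ (b - a) * shiftCut f s s' a := by
  unfold shiftCutPrim shiftCut
  split_ifs with h
  · rw [min_eq_left h, sub_sub_sub_cancel_right]
    refine (hf.primitive_sub_le (show 0 < s + a by linarith) (le_min (by linarith) h)).trans ?_
    exact mul_le_mul_of_nonneg_right (by linarith [min_le_left (s + b) s']) (hf.nonneg _)
  · rw [min_eq_right (by linarith), min_eq_right (by linarith)]; simp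

theorem ofReal_shiftCutPrim {f : ℝ → ℝ} (hf : Dec f) {s s' u : ℝ} (hss : s ≤ s') (hu : 0 ≤ u) :
    ENNReal.ofReal (shiftCutPrim f s s' u) =
      ∫⁻ t in Ioc s (min (s + u) s'), ENNReal.ofReal (f t) ∂mHalf := by
  rw [shiftCutPrim, primitive_sub hf.integrable,
    intervalIntegral.integral_of_le (le_min (by linarith) hss),
    ofReal_integral_eq_lintegral_ofReal hf.integrable.integrableOn (ae_of_all _ hf.nonneg)]

theorem ofReal_shiftCutPrim_sub_le {f : ℝ → ℝ} (hf : Dec f) {s s' u c : ℝ} (hs : 0 ≤ s) (hss : s ≤ s')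
    (hu : 0 ≤ u) (hc : 0 ≤ c) :
    ENNReal.ofReal (shiftCutPrim f s s' u - c * u) ≤
      ∫⁻ t in Ioc s (min (s + u) s'), ENNReal.ofReal (|f t| - c) ∂mHalf := by
  rw [ENNReal.ofReal_sub _ (by positivity), ofReal_shiftCutPrim hf hss hu]
  refine tsub_le_iff_right.2 ?_
  calc ∫⁻ t in Ioc s (min (s + u) s'), ENNReal.ofReal (f t) ∂mHalf
      ≤ ∫⁻ t in Ioc s (min (s + u) s'), (ENNReal.ofReal (|f t| - c) + ENNReal.ofReal c) ∂mHalf := by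
        refine lintegral_mono fun t => ?_
        rw [abs_of_nonneg (hf.nonneg t)]
        refine (ENNReal.ofReal_le_ofReal (by linarith)).trans (ENNReal.ofReal_add_le (p := f t - c))
    _ = _ + ENNReal.ofReal c * mHalf (Ioc s (min (s + u) s')) := by
        rw [lintegral_add_right _ measurable_const, setLIntegral_const]
    _ ≤ _ := by
        gcongr
        rw [mHalf_Ioc hs, ← ENNReal.ofReal_mul hc]
        refine ENNReal.ofReal_le_ofReal ?_
        exact mul_le_mul_of_nonneg_left (by linarith [min_le_left (s + u) s']) hc

/-- On one block the samples of `g` are dominated, up to a constant and a small correction, by an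
average of rearranged samples of the corresponding portion of `f`. -/
theorem exists_perms_block {f g : ℝ → ℝ} (hf : Dec f) (hg : Dec g)
    (hfg : ∀ t, 0 ≤ t → primitive g t ≤ primitive f t) {p : ℝ} (hp : 0 < p) {μ Q n : ℕ}
    (hμ : 3 ≤ μ) (hμQ : μ < Q) (hn : 0 < n) (m : ℕ) :
    ∃ π : Fin (m + (n * (Q - μ)).factorial) → Equiv.Perm (Fin (n * (Q - μ))),
      ∀ j : Fin (n * (Q - μ)), (m : ℝ) * g (μ * p + j * (p / n)) ≤ ((μ - 1 : ℝ) / (μ - 2)) *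
        ∑ i, (shiftCut f (reach f g p) (reach f g (Q * p)) (((π i j : ℕ) + 1 : ℝ) * (p / n)) +
          if (π i j : ℕ) < n then
            shiftCutPrim f (reach f g p) (reach f g (Q * p)) (p / n) / p else 0) := by
  have hμ' : (3 : ℝ) ≤ μ := by exact_mod_cast hμ
  have hn' : (0 : ℝ) < n := by exact_mod_cast hn
  have hQ1 : (1 : ℝ) ≤ Q := by exact_mod_cast (by omega : 1 ≤ Q)
  have hC0 : 0 < (μ - 1 : ℝ) / (μ - 2) := div_pos (by linarith) (by linarith)
  set C := (μ - 1 : ℝ) / (μ - 2) with hC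
  have hs := reach_nonneg hf hfg hp.le
  have hss := reach_mono hg hfg hp.le (show p ≤ Q * p by nlinarith)
  set s := reach f g p
  set s' := reach f g (Q * p)
  have hy : Antitone fun j : ℕ => g (μ * p + j * (p / n)) / C := fun a b hab =>
    div_le_div_of_nonneg_right (hg.antitoneOn (show (0 : ℝ) < _ by positivity)
      (show (0 : ℝ) < _ by positivity) (by gcongr)) hC0.le
  obtain ⟨π, hπ⟩ := exists_perms_of_partial_sums_le (N := n * (Q - μ)) (y := fun j : ℕ =>
    g (μ * p + j * (p / n)) / C) (x := fun j : ℕ => shiftCut f s s' ((j + 1) * (p / n)) +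
      if j < n then shiftCutPrim f s s' (p / n) / p else 0) hy
    (fun j => add_nonneg (shiftCut_nonneg hf _ _ _) (by
      split_ifs
      · exact div_nonneg (shiftCutPrim_nonneg hf hss (by positivity)) hp.le
      · exact le_rfl))
    (fun i hi => by
      rw [← Finset.sum_div, div_le_iff₀' hC0]
      exact mesh_sum_le hp hμ hn hg.antitoneOn (fun a b ha hab => hg.le_primitive_sub ha hab)
        (antitoneOn_shiftCut hf hs) (shiftCut_nonneg hf s s')
        (fun t ht => shiftCutPrim_nonneg hf hss ht)
        (fun a b ha hab => shiftCutPrim_sub_le hf hs ha hab)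
        (fun r u hr hu hru => primitive_sub_le_reach hf hg hfg hp.le hr hu hru) hi hμQ) m
  refine ⟨π, fun j => ?_⟩
  have := hπ j
  rwa [← mul_div_assoc, div_le_iff₀' hC0] at this

theorem ne_of_mem_Ioc {κ : Type*} [LinearOrder κ] {a b : κ → ℝ} (h : ∀ k l, k < l → b k ≤ a l)
    {k l : κ} (hkl : k ≠ l) {t t' : ℝ} (ht : t ∈ Ioc (a k) (b k)) (ht' : t' ∈ Ioc (a l) (b l)) :
    t ≠ t' := by
  rcases lt_or_gt_of_ne hkl with h' | h'
  · exact (ht.2.trans_lt ((h k l h').trans_lt ht'.1)).ne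
  · exact (ht'.2.trans_lt ((h l k h').trans_lt ht.1)).ne'

section Blocks

variable {f g : ℝ → ℝ} {β : ℝ} {μ Q : ℕ}

/-- A part of `f` which on each block `(μ β Q^k, β Q^(k+1)]` imitates `f` right of the point where
`∫ f` reaches `∫_0^{β Q^k} g`. -/
theorem exists_part_shiftCut (hf : Dec f) (hg : Dec g)
    (hfg : ∀ t, 0 ≤ t → primitive g t ≤ primitive f t) (hβ : 0 < β) (hμ : 3 ≤ μ) (hμQ : μ < Q) :
    ∃ z, IsPart f z ∧ ∀ (k : ℤ) (v : ℝ), 0 < v → v ≤ (Q - μ) * (β * Q ^ k) →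
      shiftCut f (reach f g (β * Q ^ k)) (reach f g (β * Q ^ (k + 1))) v ≤
        z (μ * (β * Q ^ k) + v) := by
  have hQ : (1 : ℝ) < Q := by exact_mod_cast (by omega : 1 < Q)
  have hQ0 : (Q : ℝ) ≠ 0 := by positivity
  have hμ1 : (1 : ℝ) ≤ μ := by exact_mod_cast (by omega : 1 ≤ μ)
  set p : ℤ → ℝ := fun k => β * Q ^ k with hp
  have hp0 : ∀ k, 0 < p k := fun k => by positivity
  have hpm : Monotone p := fun k l h => by
    simp only [hp]; gcongr; exact hQ.le
  have hpQ : ∀ k, p (k + 1) = Q * p k := fun k => by simp only [hp]; rw [zpow_add_one₀ hQ0]; ring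
  set s : ℤ → ℝ := fun k => reach f g (p k) with hs
  have hs0 : ∀ k, 0 ≤ s k := fun k => reach_nonneg hf hfg (hp0 k).le
  have hsm : Monotone s := fun k l h => reach_mono hg hfg (hp0 k).le (hpm h)
  have ho1 : ∀ k l : ℤ, k < l → min (p (k + 1)) (μ * p k + (s (k + 1) - s k)) ≤ μ * p l :=
    fun k l h => (min_le_left _ _).trans ((hpm h).trans (by nlinarith [hp0 l]))
  have ho2 : ∀ k l : ℤ, k < l → s (k + 1) ≤ s l := fun k l h => hsm h
  have hmem : ∀ k, ∀ t ∈ Ioc (μ * p k) (min (p (k + 1)) (μ * p k + (s (k + 1) - s k))),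
      t + (s k - μ * p k) ∈ Ioc (s k) (s (k + 1)) := fun k t ht =>
    ⟨by linarith [ht.1], by linarith [ht.2.trans (min_le_right _ _)]⟩
  -- Block `k` is translated by `s k - μ p k`; truncating its length at `s (k + 1) - s k` keeps its
  -- image inside `(s k, s (k + 1)]`, so the images are disjoint.
  obtain ⟨T, hT, hTv⟩ := exists_isTransport
    (Y := fun k => Ioc (μ * p k) (min (p (k + 1)) (μ * p k + (s (k + 1) - s k))))
    (c := fun k => s k - μ * p k) (fun _ => measurableSet_Ioc)
    (fun k l h => disjoint_left.2 fun t ht ht' => ne_of_mem_Ioc ho1 h ht ht' rfl)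
    (fun k l h t ht t' ht' => ne_of_mem_Ioc ho2 h (hmem k t ht) (hmem l t' ht'))
    (fun k t ht => (hs0 k).trans_lt (hmem k t ht).1)
  refine ⟨_, (IsPart.refl hf.measurable hf.nonneg).comp hT, fun k v hv hvp => ?_⟩
  change shiftCut f (s k) (s (k + 1)) v ≤ _
  unfold shiftCut
  split_ifs with h
  · have ht : μ * p k + v ∈ Ioc (μ * p k) (min (p (k + 1)) (μ * p k + (s (k + 1) - s k))) := by
      refine ⟨by linarith, le_min ?_ (by linarith)⟩
      rw [hpQ]; change v ≤ (Q - μ) * p k at hvp; linarith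
    change f (s k + v) ≤ indicator _ _ (μ * p k + v)
    rw [indicator_of_mem (mem_iUnion_of_mem k ht), hTv k _ ht]
    refine le_of_eq (congrArg f ?_)
    ring
  · exact indicator_nonneg (fun t _ => hf.nonneg _) _

/-- The terms come from pieces of `f` over disjoint intervals of length at most `β Q^k / n`. The sum
is the excess of the correction term, so this says that the correction is submajorized by `n⁻¹ σ_n
f`. -/
theorem tsum_ofReal_shiftCutPrim_sub_le (hf : Dec f) (hg : Dec g)
    (hfg : ∀ t, 0 ≤ t → primitive g t ≤ primitive f t) (hβ : 0 < β) (hQ : 1 < Q) {n : ℕ}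
    (hn : 0 < n) {c : ℝ} (hc : 0 ≤ c) :
    ∑' k : ℤ, ENNReal.ofReal (shiftCutPrim f (reach f g (β * Q ^ k)) (reach f g (β * Q ^ (k + 1)))
      (β * Q ^ k / n) - c * (β * Q ^ k)) ≤ Phi f (n * c) := by
  have hQ' : (1 : ℝ) < Q := by exact_mod_cast hQ
  have hn' : (0 : ℝ) < n := by exact_mod_cast hn
  set p : ℤ → ℝ := fun k => β * Q ^ k with hp
  have hp0 : ∀ k, 0 < p k := fun k => by positivity
  have hpm : Monotone p := fun k l h => by
    simp only [hp]; gcongr; exact hQ'.le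
  set s : ℤ → ℝ := fun k => reach f g (p k) with hs
  have hs0 : ∀ k, 0 ≤ s k := fun k => reach_nonneg hf hfg (hp0 k).le
  have hsm : Monotone s := fun k l h => reach_mono hg hfg (hp0 k).le (hpm h)
  set A : ℤ → Set ℝ := fun k => Ioc (s k) (min (s k + p k / n) (s (k + 1))) with hA
  have hAd : Pairwise (Function.onFun Disjoint A) := fun k l h =>
    disjoint_left.2 fun t ht ht' => ne_of_mem_Ioc (a := s)
      (b := fun k => min (s k + p k / n) (s (k + 1))) (fun k l (h : k < l) => (min_le_right _ _).trans (hsm h)) h ht ht' rfl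
  calc ∑' k, ENNReal.ofReal (shiftCutPrim f (s k) (s (k + 1)) (p k / n) - c * p k)
      ≤ ∑' k, ∫⁻ t in A k, ENNReal.ofReal (|f t| - n * c) ∂mHalf := by
        refine ENNReal.tsum_le_tsum fun k => ?_
        have := ofReal_shiftCutPrim_sub_le hf (hs0 k) (hsm (by omega : k ≤ k + 1))
          (u := p k / n) (c := n * c) (div_nonneg (hp0 k).le hn'.le) (by positivity)
        refine le_trans (le_of_eq ?_) this
        congr 2
        field_simp
    _ = ∫⁻ t in ⋃ k, A k, ENNReal.ofReal (|f t| - n * c) ∂mHalf :=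
        (lintegral_iUnion (fun k => measurableSet_Ioc) hAd _).symm
    _ ≤ Phi f (n * c) := setLIntegral_le_lintegral _ _

/-- The integral of the correction tends to zero as the mesh is refined, by dominated convergence
with the terms for `n = 1` as majorant. -/
theorem tendsto_tsum_ofReal_shiftCutPrim (hf : Dec f) (hg : Dec g)
    (hfg : ∀ t, 0 ≤ t → primitive g t ≤ primitive f t) (hβ : 0 < β) (hQ : 1 < Q) :
    Tendsto (fun n : ℕ => ∑' k : ℤ, ENNReal.ofReal (shiftCutPrim f (reach f g (β * Q ^ k))
      (reach f g (β * Q ^ (k + 1))) (β * Q ^ k / n))) atTop (𝓝 0) := by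
  have hQ' : (1 : ℝ) < Q := by exact_mod_cast hQ
  have hp0 : ∀ k : ℤ, 0 < β * (Q : ℝ) ^ k := fun k => by positivity
  have hss : ∀ k : ℤ, reach f g (β * Q ^ k) ≤ reach f g (β * Q ^ (k + 1)) := fun k =>
    reach_mono hg hfg (hp0 k).le (by gcongr; exacts [hQ'.le, by omega])
  set Ψ : ℤ → ℝ → ℝ := fun k => shiftCutPrim f (reach f g (β * Q ^ k))
    (reach f g (β * Q ^ (k + 1))) with hΨ
  have hΨ0 : ∀ k u, 0 ≤ u → 0 ≤ Ψ k u := fun k u hu => shiftCutPrim_nonneg hf (hss k) hu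
  have hsum : Summable fun k => Ψ k (β * Q ^ k) := by
    have h1 := tsum_ofReal_shiftCutPrim_sub_le hf hg hfg hβ hQ (n := 1) one_pos (le_refl 0)
    simp only [Nat.cast_one, div_one, zero_mul, sub_zero, mul_zero] at h1
    have h2 := (h1.trans_lt (Phi_lt_top hf.integrable le_rfl)).ne
    have h3 := ENNReal.summable_toReal h2
    refine h3.congr fun k => ?_
    exact ENNReal.toReal_ofReal (hΨ0 k _ (hp0 k).le)
  have hlim : Tendsto (fun n : ℕ => ∑' k : ℤ, Ψ k (β * Q ^ k / n)) atTop (𝓝 (∑' _ : ℤ, (0 : ℝ))) := by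
    refine tendsto_tsum_of_dominated_convergence hsum (fun k => ?_) ?_
    · have hc : Continuous (Ψ k) := by
        have := continuous_primitive hf.integrable
        simp only [hΨ]
        unfold shiftCutPrim
        fun_prop
      have h0 : Ψ k 0 = 0 := by simp [hΨ, shiftCutPrim, min_eq_left (hss k)]
      have := (hc.tendsto 0).comp (tendsto_const_div_atTop_nhds_zero_nat (β * (Q : ℝ) ^ k))
      rwa [h0] at this
    · filter_upwards [eventually_ge_atTop 1] with n hn k
      have hn' : (1 : ℝ) ≤ n := by exact_mod_cast hn
      rw [Real.norm_of_nonneg (hΨ0 k _ (div_nonneg (hp0 k).le (by linarith)))]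
      exact monotone_shiftCutPrim hf _ _ (div_le_self (hp0 k).le hn')
  rw [tsum_zero] at hlim
  have h4 := ENNReal.tendsto_ofReal hlim
  rw [ENNReal.ofReal_zero] at h4
  refine h4.congr' ?_
  filter_upwards [eventually_ge_atTop 1] with n hn
  have hn' : (1 : ℝ) ≤ n := by exact_mod_cast hn
  refine ENNReal.ofReal_tsum_of_nonneg (fun k => hΨ0 k _ (div_nonneg (hp0 k).le (by linarith))) ?_
  exact Summable.of_nonneg_of_le (fun k => hΨ0 k _ (div_nonneg (hp0 k).le (by linarith)))
    (fun k => monotone_shiftCutPrim hf _ _ (div_le_self (hp0 k).le hn')) hsum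

end Blocks

end

/-! ### Domination on one system of blocks -/

section

variable {E : Type*} [NormedAddCommGroup E] [NormedSpace ℝ E] {ι : E →ₗ[ℝ] L0}

theorem average_mem_convexHull {M : ℕ} (hM : 0 < M) {S : Set (ℝ → ℝ)} {z : Fin M → ℝ → ℝ}
    (hz : ∀ i, z i ∈ convexHull ℝ S) :
    (fun t => (M : ℝ)⁻¹ * ∑ i, z i t) ∈ convexHull ℝ S := by
  have hM' : (M : ℝ) ≠ 0 := by positivity
  have := (convex_convexHull ℝ S).sum_mem (t := Finset.univ) (w := fun _ : Fin M => (M : ℝ)⁻¹)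
    (fun _ _ => by positivity) (by simp [hM']) fun i _ => hz i
  convert this using 1
  ext t
  simp [Finset.sum_apply, Finset.mul_sum]

theorem EN_average_le {M : ℕ} (hM : 0 < M) {v : Fin M → ℝ → ℝ} {η : ℝ≥0∞} (hv : ∀ i, EN ι (v i) ≤ η) :
    EN ι (fun t => (M : ℝ)⁻¹ * ∑ i, v i t) ≤ η := by
  have hM' : (0 : ℝ) < M := by exact_mod_cast hM
  rw [EN_const_mul (inv_pos.2 hM')]
  calc ENNReal.ofReal (M : ℝ)⁻¹ * EN ι (fun t => ∑ i, v i t)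
      ≤ ENNReal.ofReal (M : ℝ)⁻¹ * (M * η) := by
        gcongr
        refine (EN_sum_le _ _).trans ((Finset.sum_le_sum fun i _ => hv i).trans_eq ?_)
        simp
    _ = η := by
        rw [← mul_assoc, ENNReal.ofReal_inv_of_pos hM', ENNReal.ofReal_natCast,
          ENNReal.inv_mul_cancel (by simpa using hM.ne') (ENNReal.natCast_ne_top M), one_mul]

/-- With `m` large, the `N` surplus permutations caused by rounding weigh only a fraction `ε` of the
total. -/
theorem exists_rounding (N : ℕ) {ε : ℝ} (hε : 0 < ε) :
    ∃ m : ℕ, 0 < m ∧ (1 - ε) * ((m + N : ℕ) : ℝ) ≤ m := by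
  obtain ⟨m, hm⟩ := exists_nat_gt (N / ε)
  have h0 : (0 : ℝ) ≤ N / ε := by positivity
  refine ⟨m, by exact_mod_cast h0.trans_lt hm, ?_⟩
  rw [div_lt_iff₀ hε] at hm
  push_cast
  nlinarith [Nat.cast_nonneg (α := ℝ) m, mul_nonneg hε.le (Nat.cast_nonneg (α := ℝ) N)]

/-- The cells of mesh `p_k / n` of the blocks `(μ p_k, Q p_k]`, permuted inside each block, give
transports. -/
theorem exists_isTransport_perm {β : ℝ} (hβ : 0 < β) {μ Q n : ℕ} (hμ : 3 ≤ μ) (hμQ : μ < Q)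
    (hn : 0 < n) (π : ℤ → Equiv.Perm (Fin (n * (Q - μ)))) :
    ∃ T, IsTransport (⋃ i : ℤ × Fin (n * (Q - μ)), Ioc (μ * (β * Q ^ i.1) + i.2 * (β * Q ^ i.1 / n))
        (μ * (β * Q ^ i.1) + (i.2 + 1) * (β * Q ^ i.1 / n))) T ∧
      ∀ (k : ℤ) (j : Fin (n * (Q - μ))), ∀ t ∈ Ioc (μ * (β * Q ^ k) + j * (β * Q ^ k / n))
        (μ * (β * Q ^ k) + (j + 1) * (β * Q ^ k / n)),
        T t ∈ Ioc (μ * (β * Q ^ k) + (π k j : ℕ) * (β * Q ^ k / n))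
          (μ * (β * Q ^ k) + ((π k j : ℕ) + 1) * (β * Q ^ k / n)) := by
  have hn' : (0 : ℝ) < n := by exact_mod_cast hn
  have hQ : (1 : ℝ) < Q := by exact_mod_cast (by omega : 1 < Q)
  have hQ0 : (Q : ℝ) ≠ 0 := by positivity
  have hμ1 : (1 : ℝ) ≤ μ := by exact_mod_cast (by omega : 1 ≤ μ)
  set p : ℤ → ℝ := fun k => β * Q ^ k with hp
  have hp0 : ∀ k, 0 < p k := fun k => by positivity
  have hpm : Monotone p := fun k l h => by
    simp only [hp]; gcongr; exact hQ.le
  have hpQ : ∀ k, p (k + 1) = Q * p k := fun k => by simp only [hp]; rw [zpow_add_one₀ hQ0]; ring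
  set a : ℤ × Fin (n * (Q - μ)) → ℝ := fun i => μ * p i.1 + i.2 * (p i.1 / n) with ha
  set b : ℤ × Fin (n * (Q - μ)) → ℝ := fun i => μ * p i.1 + (i.2 + 1) * (p i.1 / n) with hb
  have hbp : ∀ i, b i ≤ p (i.1 + 1) := fun i => by
    have h1 : ((i.2 : ℕ) : ℝ) + 1 ≤ n * (Q - μ) := by
      rw [← Nat.cast_sub hμQ.le]
      exact_mod_cast i.2.2
    rw [hpQ]
    have h2 : (((i.2 : ℕ) : ℝ) + 1) * (p i.1 / n) ≤ n * (Q - μ) * (p i.1 / n) := by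
      have := (div_pos (hp0 i.1) hn').le
      gcongr
    have h3 : n * (Q - μ) * (p i.1 / n) = (Q - μ) * p i.1 := by field_simp
    simp only [hb]
    linarith
  have hap : ∀ i, p i.1 ≤ a i := fun i => by
    have h2 : 0 ≤ ((i.2 : ℕ) : ℝ) * (p i.1 / n) := by
      have := (div_pos (hp0 i.1) hn').le
      positivity
    have := hp0 i.1
    simp only [ha]
    nlinarith
  have hdisj : ∀ i j, i ≠ j → ∀ t ∈ Ioc (a i) (b i), ∀ t' ∈ Ioc (a j) (b j), t ≠ t' := by
    rintro ⟨k, i⟩ ⟨l, j⟩ hij t ht t' ht'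
    rcases eq_or_ne k l with rfl | hkl
    · refine ne_of_mem_Ioc (a := fun i => a (k, i)) (b := fun i => b (k, i)) (fun i j h => ?_)
        (fun h : i = j => hij (by rw [h])) ht ht'
      have h1 : ((i : ℕ) : ℝ) + 1 ≤ (j : ℕ) := by exact_mod_cast h
      have := (div_pos (hp0 k) hn').le
      simp only [ha, hb]
      gcongr
    · exact ne_of_mem_Ioc (a := p) (b := fun k => p (k + 1)) (fun k l h => hpm h) hkl
        ⟨(hap _).trans_lt ht.1, ht.2.trans (hbp _)⟩ ⟨(hap _).trans_lt ht'.1, ht'.2.trans (hbp _)⟩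
  have hmem : ∀ i : ℤ × Fin (n * (Q - μ)), ∀ t ∈ Ioc (a i) (b i),
      t + (((π i.1 i.2 : ℕ) : ℝ) - i.2) * (p i.1 / n) ∈ Ioc (a (i.1, π i.1 i.2)) (b (i.1, π i.1 i.2)) := by
    intro i t ht
    have h1 := ht.1
    have h2 := ht.2
    simp only [ha, hb] at h1 h2 ⊢
    constructor <;> linarith
  obtain ⟨T, hT, hTv⟩ := exists_isTransport (Y := fun i => Ioc (a i) (b i))
    (c := fun i => (((π i.1 i.2 : ℕ) : ℝ) - i.2) * (p i.1 / n)) (fun _ => measurableSet_Ioc)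
    (fun i j h => disjoint_left.2 fun t ht ht' => hdisj i j h t ht t ht' rfl)
    (fun i j h t ht t' ht' => by
      refine hdisj _ _ (fun he => h ?_) _ (hmem i t ht) _ (hmem j t' ht')
      obtain ⟨k, i⟩ := i
      obtain ⟨l, j⟩ := j
      obtain ⟨h1, h2⟩ := Prod.mk.inj he
      dsimp only at h1 h2
      subst h1
      rw [(π k).injective h2])
    (fun i t ht => (hp0 _).trans_le (hap _) |>.trans (hmem i t ht).1)
  refine ⟨T, hT, fun k j t ht => ?_⟩
  rw [hTv (k, j) t ht]
  exact hmem (k, j) t ht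

/-- The permutations of the individual blocks are glued into transports, and the resulting parts of
`x^*` are averaged. The initial piece of each block, up to `μ` times its left end, remains
uncovered. -/
theorem exists_average_ge_on_blocks (hE : IsFullySymmetric ι) (hL1 : ∀ z : E, MemL1 (ι z)) (x : E)
    (hphi : phiFin ι (ι x) = 0) (hone : EN ι ((Icc (0 : ℝ) 1).indicator fun _ => 1) < ∞)
    {g : ℝ → ℝ} (hg : Dec g) (hf : Dec (rearrR (ι x)))
    (hfg : ∀ t, 0 ≤ t → primitive g t ≤ primitive (rearrR (ι x)) t) {β : ℝ} (hβ : 0 < β) {μ Q : ℕ}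
    (hμ : 3 ≤ μ) (hμQ : μ < Q) {ε : ℝ} (hε : 0 < ε) {η : ℝ≥0∞} (hη : 0 < η) :
    ∃ u ∈ convexHull ℝ {z | IsPart (rearrR (ι x)) z}, ∃ e : ℝ → ℝ, Measurable e ∧ (∀ t, 0 ≤ e t) ∧
      EN ι e ≤ η ∧ (∀ t, 0 ≤ u t) ∧ ∀ (k : ℤ) (t : ℝ), μ * (β * Q ^ k) < t → t ≤ β * Q ^ (k + 1) →
        (1 - ε) * g t ≤ ((μ - 1 : ℝ) / (μ - 2)) * (u t + e t) := by
  set f := rearrR (ι x) with hfdef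
  have hQ : (1 : ℝ) < Q := by exact_mod_cast (by omega : 1 < Q)
  have hQ0 : (Q : ℝ) ≠ 0 := by positivity
  have hμ3 : (3 : ℝ) ≤ μ := by exact_mod_cast hμ
  have hμQ' : (μ : ℝ) + 1 ≤ Q := by exact_mod_cast hμQ
  have hC0 : 0 ≤ (μ - 1 : ℝ) / (μ - 2) := div_nonneg (by linarith) (by linarith)
  set C := (μ - 1 : ℝ) / (μ - 2)
  set p : ℤ → ℝ := fun k => β * Q ^ k with hp
  have hp0 : ∀ k, 0 < p k := fun k => by positivity
  have hpm : Monotone p := fun k l h => by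
    simp only [hp]; gcongr; exact hQ.le
  have hpQ : ∀ k, p (k + 1) = Q * p k := fun k => by simp only [hp]; rw [zpow_add_one₀ hQ0]; ring
  set s : ℤ → ℝ := fun k => reach f g (p k) with hs
  have hs0 : ∀ k, 0 ≤ s k := fun k => reach_nonneg hf hfg (hp0 k).le
  have hsm : Monotone s := fun k l h => reach_mono hg hfg (hp0 k).le (hpm h)
  have hss : ∀ k, s k ≤ s (k + 1) := fun k => hsm (by omega)
  obtain ⟨n₀, δ, hn₀, hδ, hsmall⟩ := exists_EN_le_of_phiFin_eq_zero hE hL1 x hphi hone hη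
  -- The mesh is fine enough that the correction has integral below `δ` and is flattened by a factor
  -- at least `n₀`, as the smallness criterion requires.
  obtain ⟨n, hnδ, hnn⟩ := (((tendsto_order.1 (tendsto_tsum_ofReal_shiftCutPrim hf hg hfg hβ
    (by omega : 1 < Q))).2 (ENNReal.ofReal δ) (ENNReal.ofReal_pos.2 hδ)).and
      (eventually_ge_atTop n₀)).exists
  have hn : 0 < n := hn₀.trans_le hnn
  have hn' : (0 : ℝ) < n := by exact_mod_cast hn
  obtain ⟨z, hz, hzv⟩ := exists_part_shiftCut hf hg hfg hβ hμ hμQ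
  set Ψ : ℤ → ℝ := fun k => shiftCutPrim f (s k) (s (k + 1)) (p k / n) with hΨ
  have hΨ0 : ∀ k, 0 ≤ Ψ k := fun k => shiftCutPrim_nonneg hf (hss k) (div_pos (hp0 k) hn').le
  -- the correction term
  obtain ⟨e, hem, he0, hev, hePhi⟩ := exists_piecewise_const
    (I := fun k => Ioc (μ * p k) (μ * p k + p k)) (a := fun k => Ψ k / p k)
    (fun _ => measurableSet_Ioc) (fun k l h => disjoint_left.2 fun t ht ht' =>
      ne_of_mem_Ioc (a := fun k => μ * p k) (b := fun k => μ * p k + p k) (fun k l (h : k < l) => by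
        have := hpm (show k + 1 ≤ l from h)
        rw [hpQ] at this
        nlinarith [hp0 k, hp0 l]) h ht ht' rfl) (fun k => div_nonneg (hΨ0 k) (hp0 k).le)
  have hePhi' : ∀ c, 0 ≤ c → Phi e c = ∑' k, ENNReal.ofReal (Ψ k - c * p k) := fun c hc => by
    rw [hePhi c hc]
    refine tsum_congr fun k => ?_
    have := hp0 k
    rw [mHalf_Ioc (by positivity), add_sub_cancel_left, ← ENNReal.ofReal_mul' (hp0 k).le, sub_mul,
      div_mul_cancel₀ _ (hp0 k).ne']
  have heEN : EN ι e ≤ η := by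
    refine hsmall n e (by exact_mod_cast hnn) hem he0 (fun c hc => ?_) ?_
    · rw [hePhi' c hc]
      exact tsum_ofReal_shiftCutPrim_sub_le hf hg hfg hβ (by omega) hn hc
    · rw [hePhi' 0 le_rfl]
      simp only [zero_mul, sub_zero]
      exact hnδ.le
  -- Every block uses the same number `M` of permutations, so the `i`-th ones of all blocks together
  -- define a single transport.
  obtain ⟨m, hm0, hm⟩ := exists_rounding (n * (Q - μ)).factorial hε
  set M := m + (n * (Q - μ)).factorial with hM
  have hM0 : 0 < M := by omega
  have hM0' : (0 : ℝ) < M := by exact_mod_cast hM0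
  have hblock := fun k : ℤ => exists_perms_block hf hg hfg (hp0 k) hμ hμQ hn m
  choose π hπ using hblock
  have htr := fun i : Fin M => exists_isTransport_perm hβ hμ hμQ hn (fun k => π k i)
  choose T hT hTv using htr
  set W := ⋃ i : ℤ × Fin (n * (Q - μ)), Ioc (μ * (β * Q ^ i.1) + i.2 * (β * Q ^ i.1 / n))
        (μ * (β * Q ^ i.1) + (i.2 + 1) * (β * Q ^ i.1 / n)) with hW
  have heT : ∀ i, IsPart e (W.indicator fun t => e (T i t)) := fun i =>
    (IsPart.refl hem he0).comp (hT i)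
  have hei : Integrable e mHalf := by
    refine integrable_of_Phi_zero_lt_top hem.aestronglyMeasurable ?_
    rw [hePhi' 0 le_rfl]
    simp only [zero_mul, sub_zero]
    exact hnδ.trans ENNReal.ofReal_lt_top
  refine ⟨fun t => (M : ℝ)⁻¹ * ∑ i, W.indicator (fun t => z (T i t)) t,
    average_mem_convexHull hM0 fun i => subset_convexHull ℝ _ (hz.comp (hT i)),
    fun t => (M : ℝ)⁻¹ * ∑ i, W.indicator (fun t => e (T i t)) t, ?_, fun t => ?_,
    EN_average_le hM0 fun i => ?_, fun t => ?_, fun k t ht1 ht2 => ?_⟩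
  · exact (Finset.measurable_sum _ fun i _ => (heT i).measurable).const_mul _
  · exact mul_nonneg (inv_nonneg.2 hM0'.le) (Finset.sum_nonneg fun i _ => (heT i).nonneg t)
  · exact (EN_le_of_Phi hE hL1 ((heT i).integrable hem he0 hei) fun c hc =>
      (heT i).Phi_le hem he0 hc.le).trans heEN
  · exact mul_nonneg (inv_nonneg.2 hM0'.le) (Finset.sum_nonneg fun i _ => (hz.comp (hT i)).nonneg t)
  · change μ * p k < t at ht1
    change t ≤ p (k + 1) at ht2
    have hh : 0 < p k / n := div_pos (hp0 k) hn'
    -- the cell of `t`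
    obtain ⟨j, hj1, hj2⟩ : ∃ j : ℕ, μ * p k + j * (p k / n) < t ∧ t ≤ μ * p k + (j + 1) * (p k / n) := by
      have h0 : 0 < (t - μ * p k) / (p k / n) := div_pos (by linarith) hh
      obtain ⟨j, hj⟩ : ∃ j, ⌈(t - μ * p k) / (p k / n)⌉₊ = j + 1 :=
        ⟨_, (Nat.succ_pred_eq_of_pos (Nat.ceil_pos.2 h0)).symm⟩
      obtain ⟨h1, h2⟩ := (Nat.ceil_eq_iff (Nat.succ_ne_zero j)).1 hj
      refine ⟨j, ?_, ?_⟩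
      · rw [lt_div_iff₀ hh] at h1
        simp only [Nat.add_sub_cancel, Nat.succ_eq_add_one] at h1
        linarith
      · rw [div_le_iff₀ hh] at h2
        push_cast at h2
        linarith
    have hjN : j < n * (Q - μ) := by
      have h1 : (j : ℝ) * (p k / n) < n * (Q - μ) * (p k / n) := by
        have : n * (Q - μ) * (p k / n) = (Q - μ) * p k := by field_simp
        rw [this]
        rw [hpQ] at ht2
        linarith
      have h2 : (j : ℝ) < n * (Q - μ) := lt_of_mul_lt_mul_right h1 hh.le
      rw [← Nat.cast_sub hμQ.le] at h2
      exact_mod_cast h2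
    have htW : t ∈ W := mem_iUnion_of_mem (k, ⟨j, hjN⟩) ⟨hj1, hj2⟩
    have hμp : 0 < μ * p k := by have := hp0 k; positivity
    have h1 : g t ≤ g (μ * p k + j * (p k / n)) :=
      hg.antitoneOn (show (0 : ℝ) < _ by positivity) (hμp.trans ht1) hj1.le
    have h2 := hπ k ⟨j, hjN⟩
    have h3 : ∑ i, (shiftCut f (reach f g (p k)) (reach f g (Q * p k))
          (((π k i ⟨j, hjN⟩ : ℕ) + 1 : ℝ) * (p k / n)) + if (π k i ⟨j, hjN⟩ : ℕ) < n then
            shiftCutPrim f (reach f g (p k)) (reach f g (Q * p k)) (p k / n) / p k else 0) ≤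
        ∑ i, (W.indicator (fun t => z (T i t)) t + W.indicator (fun t => e (T i t)) t) := by
      refine Finset.sum_le_sum fun i _ => ?_
      rw [indicator_of_mem htW, indicator_of_mem htW, ← hpQ k]
      have hTt := hTv i k ⟨j, hjN⟩ t ⟨hj1, hj2⟩
      set j' := π k i ⟨j, hjN⟩
      change T i t ∈ Ioc (μ * p k + (j' : ℕ) * (p k / n)) (μ * p k + ((j' : ℕ) + 1) * (p k / n)) at hTt
      refine add_le_add ?_ ?_
      · have hj' : (((j' : ℕ) : ℝ) + 1) * (p k / n) ≤ (Q - μ) * p k := by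
          have h1 : ((j' : ℕ) : ℝ) + 1 ≤ n * (Q - μ) := by
            rw [← Nat.cast_sub hμQ.le]
            exact_mod_cast j'.2
          calc (((j' : ℕ) : ℝ) + 1) * (p k / n) ≤ n * (Q - μ) * (p k / n) := by gcongr
            _ = _ := by field_simp
        have hv0 : 0 < T i t - μ * p k := by
          have : 0 ≤ ((j' : ℕ) : ℝ) * (p k / n) := by positivity
          linarith [hTt.1]
        -- The transported point lies in the permuted cell, at or before the right end where
        -- `shiftCut` was sampled, and `shiftCut` is decreasing.
        have h5 := hzv k (T i t - μ * p k) hv0 (by linarith [hTt.2])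
        rw [add_sub_cancel] at h5
        refine le_trans ?_ h5
        exact antitoneOn_shiftCut hf (hs0 k) hv0 (hv0.trans_le (by linarith [hTt.2]))
          (by linarith [hTt.2])
      · split_ifs with hjn
        · rw [hev k (T i t) ⟨?_, ?_⟩]
          · have : 0 ≤ ((j' : ℕ) : ℝ) * (p k / n) := by positivity
            linarith [hTt.1]
          · refine hTt.2.trans ?_
            have h6 : ((j' : ℕ) : ℝ) + 1 ≤ n := by exact_mod_cast hjn
            have h7 : (((j' : ℕ) : ℝ) + 1) * (p k / n) ≤ n * (p k / n) := by gcongr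
            rw [mul_div_cancel₀ _ hn'.ne'] at h7
            linarith
        · exact he0 _
    have hgt : 0 ≤ g t := hg.nonneg t
    have h4 : (m : ℝ) * g t ≤ C * ∑ i, (W.indicator (fun t => z (T i t)) t +
        W.indicator (fun t => e (T i t)) t) :=
      (mul_le_mul_of_nonneg_left h1 (Nat.cast_nonneg m)).trans
        (h2.trans (mul_le_mul_of_nonneg_left h3 hC0))
    rw [Finset.sum_add_distrib] at h4
    have h5 : (1 - ε) * g t * M ≤ m * g t := by nlinarith
    rw [← mul_add, ← mul_assoc, mul_comm C, mul_assoc, ← div_eq_inv_mul, le_div_iff₀ hM0']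
    exact h5.trans h4

end

/-! ### Averaging over shifted systems of blocks -/

section

variable {E : Type*} [NormedAddCommGroup E] [NormedSpace ℝ E] {ι : E →ₗ[ℝ] L0}

theorem nonneg_of_mem_convexHull {S : Set (ℝ → ℝ)} (hS : ∀ z ∈ S, ∀ t, 0 ≤ z t) {u : ℝ → ℝ}
    (hu : u ∈ convexHull ℝ S) (t : ℝ) : 0 ≤ u t := by
  have : Convex ℝ {u : ℝ → ℝ | ∀ t, 0 ≤ u t} := fun u hu v hv a b ha hb _ t =>
    add_nonneg (mul_nonneg ha (hu t)) (mul_nonneg hb (hv t))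
  exact convexHull_min (t := {u : ℝ → ℝ | ∀ t, 0 ≤ u t}) hS this hu t

theorem measurable_of_mem_convexHull {S : Set (ℝ → ℝ)} (hS : ∀ z ∈ S, Measurable z) {u : ℝ → ℝ}
    (hu : u ∈ convexHull ℝ S) : Measurable u := by
  have : Convex ℝ {u : ℝ → ℝ | Measurable u} := fun u hu v hv a b _ _ _ =>
    (Measurable.const_smul hu a).add (Measurable.const_smul hv b)
  exact convexHull_min (t := {u : ℝ → ℝ | Measurable u}) hS this hu

/-- If `φ_fin(x) = 0` and `g ≺≺ x^*` is decreasing, then `g` is dominated, up to a small error, by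
an average of parts of `x^*`. -/
theorem exists_average_ge (hE : IsFullySymmetric ι) (hL1 : ∀ z : E, MemL1 (ι z)) (x : E)
    (hphi : phiFin ι (ι x) = 0) (hone : EN ι ((Icc (0 : ℝ) 1).indicator fun _ => 1) < ∞)
    {g : ℝ → ℝ} (hg : Dec g) (hf : Dec (rearrR (ι x)))
    (hfg : ∀ t, 0 ≤ t → primitive g t ≤ primitive (rearrR (ι x)) t) {ε : ℝ} (hε : 0 < ε)
    (hε1 : ε ≤ 1) {η : ℝ≥0∞} (hη : 0 < η) :
    ∃ u ∈ convexHull ℝ {z | IsPart (rearrR (ι x)) z}, ∃ e : ℝ → ℝ, Measurable e ∧ (∀ t, 0 ≤ e t) ∧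
      EN ι e ≤ η ∧ ∀ t, 0 < t → (1 - ε) * g t ≤ u t + e t := by
  -- Three losses of relative size `δ` occur: one system out of `K` is dropped, `(μ - 1) / (μ - 2)`
  -- is at most `1 + δ`, and the domination on blocks carries `1 - δ`.
  set δ := ε / 3 with hδ
  have hδ0 : 0 < δ := by positivity
  obtain ⟨K, hK⟩ := exists_nat_gt (1 / δ)
  rw [div_lt_iff₀ hδ0] at hK
  have hK1 : 1 < K := by
    have : (1 : ℝ) < K := by nlinarith
    exact_mod_cast this
  set μ := K + 2 with hμ
  have hμ3 : 3 ≤ μ := by omega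
  have hμ0 : (0 : ℝ) < μ := by positivity
  have hμ1 : (1 : ℝ) < μ := by exact_mod_cast (by omega : 1 < μ)
  have hμQ : μ < μ ^ K := by
    calc μ = μ ^ 1 := (pow_one _).symm
      _ < μ ^ K := Nat.pow_lt_pow_right (by omega) hK1
  -- All systems have ratio `μ^K` and differ by powers of `μ`. An interval `(μ^l, μ^(l+1)]` is an
  -- uncovered initial piece for exactly one of them, the residue of `l` modulo `K`.
  have hj := fun j : Fin K => exists_average_ge_on_blocks hE hL1 x hphi hone hg hf hfg
    (β := (μ : ℝ) ^ (j : ℕ)) (by positivity) hμ3 hμQ hδ0 hη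
  choose u hu e hem he0 heη hu0 hmain using hj
  have hK0 : (0 : ℝ) < K := by exact_mod_cast (by omega : 0 < K)
  refine ⟨_, average_mem_convexHull (by omega) hu, fun t => (K : ℝ)⁻¹ * ∑ j, e j t,
    (Finset.measurable_sum _ fun i _ => hem i).const_mul _,
    fun t => mul_nonneg (inv_nonneg.2 hK0.le) (Finset.sum_nonneg fun i _ => he0 i t),
    EN_average_le (by omega) heη, fun t ht => ?_⟩
  obtain ⟨l, hl1, hl2⟩ := exists_mem_Ioc_zpow ht hμ1
  have hKz : (0 : ℤ) < K := by exact_mod_cast (by omega : 0 < K)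
  set r : Fin K := ⟨(l % K).toNat, by
    have := Int.emod_lt_of_pos l hKz
    have := Int.emod_nonneg l hKz.ne'
    omega⟩ with hr
  set C := ((μ : ℝ) - 1) / (μ - 2) with hC
  have hCle : C ≤ 1 + δ := by
    have : (μ : ℝ) = K + 2 := by rw [hμ]; push_cast; ring
    rw [hC, this, div_le_iff₀ (by linarith)]
    nlinarith
  have hC0 : 0 ≤ C := div_nonneg (by linarith) (by
    have : (3 : ℝ) ≤ μ := by exact_mod_cast hμ3
    linarith)
  have hgt : 0 ≤ g t := hg.nonneg t
  have hgood : ∀ j : Fin K, j ≠ r → (1 - δ) * g t ≤ C * (u j t + e j t) := by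
    intro j hjr
    set k := (l - 1 - (j : ℕ)) / (K : ℤ) with hk
    have h1 : K * k ≤ l - 1 - (j : ℕ) := Int.mul_ediv_self_le hKz.ne'
    have h2 : l - 1 - (j : ℕ) < K * k + K := Int.lt_mul_ediv_self_add hKz
    have h3 : l - (j : ℕ) ≠ K * (k + 1) := by
      intro h
      refine hjr (Fin.ext ?_)
      have hjl := j.2
      have : l % K = (j : ℕ) := by
        have : l = (j : ℕ) + K * (k + 1) := by linarith
        rw [this, Int.add_mul_emod_self_left]
        exact Int.emod_eq_of_lt (by omega) (by omega)
      change (j : ℕ) = (l % K).toNat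
      rw [this]; simp
    have h4 : l + 1 ≤ (j : ℕ) + K * (k + 1) := by
      have : (K : ℤ) * (k + 1) = K * k + K := by ring
      omega
    have hQ : ∀ i : ℤ, ((μ ^ K : ℕ) : ℝ) ^ i = (μ : ℝ) ^ ((K : ℤ) * i) := fun i => by
      rw [zpow_mul, zpow_natCast]; push_cast; rfl
    refine hmain j k t ?_ ?_
    · rw [hQ, ← zpow_natCast, ← zpow_add₀ hμ0.ne', ← zpow_one_add₀ hμ0.ne']
      exact (zpow_le_zpow_right₀ hμ1.le (by omega)).trans_lt hl1
    · rw [hQ, ← zpow_natCast, ← zpow_add₀ hμ0.ne']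
      exact hl2.trans (zpow_le_zpow_right₀ hμ1.le h4)
  have hsum : (K - 1 : ℝ) * ((1 - δ) * g t) ≤ C * ∑ j, (u j t + e j t) := by
    rw [Finset.mul_sum, ← Finset.add_sum_erase _ _ (Finset.mem_univ r)]
    have h1 := Finset.card_nsmul_le_sum (Finset.univ.erase r) (fun j => C * (u j t + e j t)) _
      fun j hj => hgood j (Finset.ne_of_mem_erase hj)
    rw [Finset.card_erase_of_mem (Finset.mem_univ _), Finset.card_univ, Fintype.card_fin,
      nsmul_eq_mul, Nat.cast_sub hK1.le, Nat.cast_one] at h1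
    have h2 : 0 ≤ C * (u r t + e r t) := mul_nonneg hC0 (add_nonneg (hu0 r t) (he0 r t))
    linarith
  rw [← mul_add, ← Finset.sum_add_distrib]
  set S := ∑ j, (u j t + e j t) with hS
  have hS0 : 0 ≤ S := Finset.sum_nonneg fun j _ => add_nonneg (hu0 j t) (he0 j t)
  rw [← div_eq_inv_mul, le_div_iff₀ hK0]
  have h5 : C * S ≤ (1 + δ) * S := mul_le_mul_of_nonneg_right hCle hS0
  have h6 : (1 - δ) * K ≤ K - 1 := by nlinarith
  have h7 : (1 - δ) * K * ((1 - δ) * g t) ≤ (1 + δ) * S :=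
    (mul_le_mul_of_nonneg_right h6 (mul_nonneg (by linarith) hgt)).trans (hsum.trans h5)
  have h8 : (1 + δ) * ((1 - ε) * g t * K) ≤ (1 - δ) * K * ((1 - δ) * g t) := by
    have : (1 + δ) * (1 - ε) ≤ (1 - δ) * (1 - δ) := by
      have : ε = 3 * δ := by rw [hδ]; ring
      rw [this]; nlinarith
    nlinarith [mul_le_mul_of_nonneg_right this (mul_nonneg hgt hK0.le)]
  exact le_of_mul_le_mul_left (h8.trans h7) (by linarith)

end

/-! ### Transport between a function and its rearrangement -/

theorem ext_of_Iic_of_ne_top {μ ν : Measure ℝ} (hμ : ∀ a, μ (Iic a) ≠ ∞)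
    (h : ∀ a, μ (Iic a) = ν (Iic a)) : μ = ν := by
  refine Measure.ext_of_Ioc' μ ν (fun a b _ => ((measure_mono fun t ht => ht.2).trans_lt
    (hμ b).lt_top).ne) fun a b hab => ?_
  have h1 : Ioc a b = Iic b \ Iic a := by
    ext t; simp only [mem_Ioc, Set.mem_sdiff, mem_Iic, not_le]; exact and_comm
  rw [h1, measure_sdiff (Iic_subset_Iic.2 hab.le) measurableSet_Iic.nullMeasurableSet (hμ a),
    measure_sdiff (Iic_subset_Iic.2 hab.le) measurableSet_Iic.nullMeasurableSet (h a ▸ hμ a), h, h]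

theorem mHalf_Iic (a : ℝ) : mHalf (Iic a) = ENNReal.ofReal a := by
  rw [Measure.restrict_apply measurableSet_Iic, inter_comm, Ioi_inter_Iic, Real.volume_Ioc, sub_zero]

/-- Below the full measure of `A`, the set `{rk A ≤ a}` is squeezed between cuts of `A` of rank `a`
and of rank slightly larger. -/
theorem mHalf_inter_rk_le (A : Set ℝ) {a : ℝ} (ha : 0 ≤ a) :
    mHalf (A ∩ {t | rk A t ≤ a}) = min (ENNReal.ofReal a) (mHalf A) := by
  rcases lt_or_ge (ENNReal.ofReal a) (mHalf A) with h | h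
  · rw [min_eq_left h.le]
    refine le_antisymm (le_of_forall_gt_imp_ge_of_dense fun b hb => ?_) ?_
    · obtain ⟨c, hc0, hc1, hc2⟩ := ENNReal.lt_iff_exists_real_btwn.1 (lt_min hb h)
      obtain ⟨s, -, hs⟩ := exists_rk_eq A hc0 (hc2.trans_le (min_le_right _ _))
      have hac : a < c := (ENNReal.ofReal_lt_ofReal_iff_of_nonneg ha).1 hc1
      calc mHalf (A ∩ {t | rk A t ≤ a}) ≤ mHalf (A ∩ Iio s) := by
            refine measure_mono (inter_subset_inter_right _ fun t ht => ?_)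
            by_contra hts
            have := rk_mono A (not_lt.1 hts)
            have ht' : rk A t ≤ a := ht
            linarith
        _ = ENNReal.ofReal c := by rw [← ofReal_rk, hs]
        _ ≤ b := (hc2.trans_le (min_le_left _ _)).le
    · obtain ⟨s, -, hs⟩ := exists_rk_eq A ha h
      rw [← hs, ofReal_rk]
      exact measure_mono (inter_subset_inter_right _ fun t ht => rk_mono A (le_of_lt ht))
  · rw [min_eq_right h]
    congr 1
    refine inter_eq_left.2 fun t _ => ?_
    refine (ENNReal.ofReal_le_ofReal_iff ha).1 ?_
    rw [ofReal_rk]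
    exact (measure_mono inter_subset_left).trans h

/-- The function `rk A` carries the measure on `A` to Lebesgue measure on an interval. -/
theorem map_rk (A : Set ℝ) :
    (mHalf.restrict A).map (rk A) = mHalf.restrict {t | ENNReal.ofReal t < mHalf A} := by
  have hm : Measurable (rk A) := (continuous_rk A).measurable
  have hleft : ∀ a, (mHalf.restrict A).map (rk A) (Iic a) = min (ENNReal.ofReal a) (mHalf A) := by
    intro a
    rw [Measure.map_apply hm measurableSet_Iic, Measure.restrict_apply (hm measurableSet_Iic),
      inter_comm]
    rcases le_or_gt 0 a with ha | ha
    · exact mHalf_inter_rk_le A ha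
    · have : A ∩ rk A ⁻¹' Iic a = ∅ := by
        ext t
        simp only [mem_inter_iff, mem_preimage, mem_Iic, mem_empty_iff_false, iff_false, not_and]
        intro _ h
        linarith [rk_nonneg A t]
      rw [this, measure_empty, ENNReal.ofReal_of_nonpos ha.le]
      simp
  refine ext_of_Iic_of_ne_top (fun a => ?_) fun a => ?_
  · rw [hleft]
    exact ((min_le_left _ _).trans_lt ENNReal.ofReal_lt_top).ne
  · rw [hleft, Measure.restrict_apply measurableSet_Iic]
    rcases lt_or_ge (ENNReal.ofReal a) (mHalf A) with h | h
    · rw [min_eq_left h.le, inter_eq_self_of_subset_left, mHalf_Iic]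
      exact fun t ht => (ENNReal.ofReal_le_ofReal ht).trans_lt h
    · rw [min_eq_right h, inter_eq_self_of_subset_right, mHalf_ofReal_lt]
      intro t ht
      by_contra hta
      exact (ht.trans_le h).not_ge (ENNReal.ofReal_le_ofReal (not_le.1 hta).le)

theorem IsTransport.mono {Y Y' : Set ℝ} {T : ℝ → ℝ} (h : IsTransport Y T) (hY : MeasurableSet Y')
    (hYY : Y' ⊆ Y) : IsTransport Y' T :=
  ⟨hY, h.measurable, (Measure.map_mono (Measure.restrict_mono hYY le_rfl) h.measurable).trans h.map_le⟩

/-- An integrable function is, up to a factor `θ > 1`, dominated by a transport of its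
rearrangement. -/
theorem exists_transport_rearr {y : L0} (hy : MemL1 y) {θ : ℝ} (hθ : 1 < θ) :
    ∃ T, IsTransport {t | 0 < |y t|} T ∧
      ∀ᵐ t ∂mHalf, 0 < |y t| → 0 < T t ∧ |y t| ≤ θ * rearrR y (T t) := by
  have hθ0 : 0 < θ := by linarith
  have hym : Measurable fun t => |y t| := y.measurable.norm
  set V : ℤ → Set ℝ := fun k => {t | θ ^ k < |y t| ∧ |y t| ≤ θ ^ (k + 1)} with hV
  have hVm : ∀ k, MeasurableSet (V k) := fun k =>
    (measurableSet_lt measurable_const hym).inter (measurableSet_le hym measurable_const)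
  have hfin : ∀ k : ℤ, mHalf {t | θ ^ k < |y t|} < ∞ := fun k =>
    mHalf_gt_lt_top hy (zpow_pos hθ0 k)
  set c : ℤ → ℝ := fun k => (mHalf {t | θ ^ k < |y t|}).toReal with hc
  have hcof : ∀ k, ENNReal.ofReal (c k) = mHalf {t | θ ^ k < |y t|} := fun k =>
    ENNReal.ofReal_toReal (hfin k).ne
  have hc0 : ∀ k, 0 ≤ c k := fun k => ENNReal.toReal_nonneg
  have hcanti : Antitone c := fun k l h => ENNReal.toReal_mono (hfin k).ne
    (measure_mono fun t ht => (zpow_le_zpow_right₀ hθ.le h).trans_lt ht)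
  have hVc : ∀ k, mHalf (V k) = ENNReal.ofReal (c k - c (k + 1)) := by
    intro k
    have h1 : V k = {t | θ ^ k < |y t|} \ {t | θ ^ (k + 1) < |y t|} := by
      ext t; simp [hV]
    have hsub : {t | θ ^ (k + 1) < |y t|} ⊆ {t | θ ^ k < |y t|} := fun t ht =>
      (zpow_le_zpow_right₀ hθ.le (by omega : k ≤ k + 1)).trans_lt ht
    rw [h1, measure_sdiff hsub
      (measurableSet_lt measurable_const hym).nullMeasurableSet (hfin _).ne, ← hcof, ← hcof,
      ENNReal.ofReal_sub _ (hc0 _)]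
  have hVU : ⋃ k, V k = {t | 0 < |y t|} := by
    ext t
    simp only [mem_iUnion, mem_ofPred_eq, hV]
    exact ⟨fun ⟨k, hk, _⟩ => (zpow_pos hθ0 k).trans hk, fun h => exists_mem_Ioc_zpow h hθ⟩
  have hVdisj : ∀ k l, ∀ t ∈ V k, t ∈ V l → k = l := by
    intro k l t hk hl
    have h1 := (zpow_lt_zpow_iff_right₀ hθ).1 (hk.1.trans_le hl.2)
    have h2 := (zpow_lt_zpow_iff_right₀ hθ).1 (hl.1.trans_le hk.2)
    omega
  -- The band `θ^k < |y| ≤ θ^(k+1)` is carried by its rank function to the interval from `c (k + 1)`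
  -- to `c k`, where `y^* > θ^k`; the factor `θ` is the width of the band.
  obtain ⟨T, hTm, hT⟩ := exists_measurable_piecewise V hVm (fun k t => rk (V k) t + c (k + 1))
    (fun k => (continuous_rk _).measurable.add_const _)
    (fun k l hkl t ht => absurd (hVdisj k l t ht.1 ht.2) hkl)
  have htr : IsTransport {t | 0 < |y t|} T := by
    refine ⟨measurableSet_lt measurable_const hym, hTm, Measure.le_intro fun B hB _ => ?_⟩
    rw [Measure.map_apply hTm hB, Measure.restrict_apply (hTm hB), ← hVU, inter_iUnion]
    refine (measure_iUnion_le _).trans ?_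
    have hX : ∀ k, mHalf (T ⁻¹' B ∩ V k) ≤ volume (B ∩ Ioo (c (k + 1)) (c k)) := by
      intro k
      have e1 : T ⁻¹' B ∩ V k = rk (V k) ⁻¹' ((fun t => t + c (k + 1)) ⁻¹' B) ∩ V k := by
        ext t
        refine and_congr_left fun ht => ?_
        simp only [mem_preimage, hT k ht]
      have hB' : MeasurableSet ((fun t => t + c (k + 1)) ⁻¹' B) := (measurable_add_const _) hB
      have hrm : Measurable (rk (V k)) := (continuous_rk _).measurable
      rw [e1, ← Measure.restrict_apply (hrm hB'), ← Measure.map_apply hrm hB', map_rk,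
        Measure.restrict_apply hB', ← measure_preimage_add_right volume (c (k + 1))
          (B ∩ Ioo (c (k + 1)) (c k)), Measure.restrict_apply (hB'.inter (measurableSet_lt
            ENNReal.measurable_ofReal measurable_const))]
      refine measure_mono fun t ht => ⟨ht.1.1, ?_⟩
      have h1 : ENNReal.ofReal t < mHalf (V k) := ht.1.2
      have h2 : 0 < t := ht.2
      rw [hVc, ENNReal.ofReal_lt_ofReal_iff_of_nonneg h2.le] at h1
      exact ⟨by linarith, by linarith⟩
    calc ∑' k, mHalf (T ⁻¹' B ∩ V k) ≤ ∑' k, volume (B ∩ Ioo (c (k + 1)) (c k)) :=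
          ENNReal.tsum_le_tsum hX
      _ = volume (⋃ k, B ∩ Ioo (c (k + 1)) (c k)) := by
          refine (measure_iUnion (fun k l hkl => disjoint_left.2 fun t ht ht' => ?_)
            fun k => hB.inter measurableSet_Ioo).symm
          rcases lt_or_gt_of_ne hkl with h | h
          · have := hcanti (show k + 1 ≤ l from h)
            linarith [ht.2.1, ht'.2.2]
          · have := hcanti (show l + 1 ≤ k from h)
            linarith [ht.2.2, ht'.2.1]
      _ ≤ volume (B ∩ Ioi 0) := measure_mono (iUnion_subset fun k t ht =>
          ⟨ht.1, (hc0 _).trans_lt ht.2.1⟩)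
      _ = mHalf B := (Measure.restrict_apply hB).symm
  refine ⟨T, htr, ?_⟩
  -- Points sent to the ends of these intervals form a null set, as the transport does not increase
  -- measure.
  have hcount : (insert 0 (range c)).Countable := (countable_range c).insert 0
  have hnull : mHalf (T ⁻¹' (insert 0 (range c)) ∩ {t | 0 < |y t|}) = 0 :=
    le_antisymm ((htr.measure_le hcount.measurableSet).trans_eq (hcount.measure_zero _)) zero_le
  filter_upwards [measure_eq_zero_iff_ae_notMem.1 hnull] with t ht hyt
  have hTt : T t ∉ insert 0 (range c) := fun h => ht ⟨h, hyt⟩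
  obtain ⟨k, hk⟩ := mem_iUnion.1 (hVU.symm ▸ hyt : t ∈ ⋃ k, V k)
  have hTk : T t = rk (V k) t + c (k + 1) := hT k hk
  have h0 : 0 < T t := by
    refine lt_of_le_of_ne ?_ fun h => hTt (Or.inl h.symm)
    rw [hTk]; exact add_nonneg (rk_nonneg _ _) (hc0 _)
  have h1 : T t < c k := by
    refine lt_of_le_of_ne ?_ fun h => hTt (Or.inr ⟨k, h.symm⟩)
    have h2 : ENNReal.ofReal (rk (V k) t) ≤ ENNReal.ofReal (c k - c (k + 1)) := by
      rw [ofReal_rk, ← hVc]; exact measure_mono inter_subset_left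
    rw [ENNReal.ofReal_le_ofReal_iff (sub_nonneg.2 (hcanti (by omega)))] at h2
    rw [hTk]; linarith
  have h2 : θ ^ k < rearrR y (T t) := by
    rw [lt_rearrR_iff hy (zpow_pos hθ0 k).le h0, ← hcof]
    exact (ENNReal.ofReal_lt_ofReal_iff_of_nonneg h0.le).2 h1
  have h3 : |y t| ≤ θ ^ (k + 1) := hk.2
  rw [zpow_add_one₀ hθ0.ne', mul_comm] at h3
  exact ⟨h0, h3.trans (mul_le_mul_of_nonneg_left h2.le hθ0.le)⟩

/-! ### Realizing the missing part of a distribution -/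

/-- A set of infinite measure splits into any finite number of sets of infinite measure. -/
theorem exists_disjoint_measure_eq_top {A : Set ℝ} (hA : MeasurableSet A) (hA' : mHalf A = ∞)
    (κ : Type*) [Finite κ] :
    ∃ W : κ → Set ℝ, (∀ i, MeasurableSet (W i)) ∧ (∀ i, W i ⊆ A) ∧
      (∀ i j, i ≠ j → Disjoint (W i) (W j)) ∧ ∀ i, mHalf (W i) = ∞ := by
  cases nonempty_fintype κ
  set L := Fintype.card κ with hL
  set ν := Fintype.equivFin κ
  -- The pieces of `A` are the points whose rank has a given integer part modulo `L`; each contains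
  -- infinitely many unit intervals of rank.
  have hfl : Measurable fun t : ℝ => ⌊t⌋₊ % L :=
    (measurable_from_nat (f := fun n : ℕ => n % L)).comp Nat.measurable_floor
  have hrm : Measurable (rk A) := (continuous_rk _).measurable
  have hB : ∀ i : κ, MeasurableSet {t : ℝ | ⌊t⌋₊ % L = ν i} := fun i =>
    hfl (measurableSet_singleton ((ν i : ℕ)))
  refine ⟨fun i => rk A ⁻¹' {t | ⌊t⌋₊ % L = ν i} ∩ A, fun i => (hrm (hB i)).inter hA,
    fun i => inter_subset_right, fun i j hij => disjoint_left.2 fun t ht ht' => hij ?_, fun i => ?_⟩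
  · have h1 : ⌊rk A t⌋₊ % L = ν i := ht.1
    have h2 : ⌊rk A t⌋₊ % L = ν j := ht'.1
    exact ν.injective (Fin.ext (h1.symm.trans h2))
  · rw [← Measure.restrict_apply (hrm (hB i)), ← Measure.map_apply hrm (hB i), map_rk, hA',
      Measure.restrict_apply (hB i)]
    have hLpos : 0 < L := (Nat.zero_le _).trans_lt (ν i).2
    rw [eq_top_iff]
    calc (∞ : ℝ≥0∞) = ∑' n : ℕ, mHalf (Ico ((ν i + L * n + 1 : ℕ) - 1 : ℝ) (ν i + L * n + 1 : ℕ)) := by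
          rw [eq_comm]
          have : ∀ n : ℕ, mHalf (Ico ((ν i + L * n + 1 : ℕ) - 1 : ℝ) (ν i + L * n + 1 : ℕ)) = 1 := by
            intro n
            rw [measure_congr Ico_ae_eq_Ioc, mHalf_Ioc (by push_cast; ring_nf; positivity)]
            simp
          simp only [this]
          exact ENNReal.tsum_const_eq_top_of_ne_zero one_ne_zero
      _ = mHalf (⋃ n : ℕ, Ico ((ν i + L * n + 1 : ℕ) - 1 : ℝ) (ν i + L * n + 1 : ℕ)) := by
          refine (measure_iUnion (fun m n hmn => disjoint_left.2 fun t ht ht' => hmn ?_)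
            fun _ => measurableSet_Ico).symm
          have h1 := ht.1; have h2 := ht.2; have h3 := ht'.1; have h4 := ht'.2
          push_cast at h1 h2 h3 h4
          have h5 : ν i + L * m < ν i + L * n + 1 := by
            have : ((ν i : ℕ) : ℝ) + L * m < ν i + L * n + 1 := by linarith
            exact_mod_cast this
          have h6 : ν i + L * n < ν i + L * m + 1 := by
            have : ((ν i : ℕ) : ℝ) + L * n < ν i + L * m + 1 := by linarith
            exact_mod_cast this
          have h7 : L * m = L * n := by omega
          exact Nat.eq_of_mul_eq_mul_left hLpos h7
      _ ≤ _ := measure_mono (iUnion_subset fun n t ht => by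
          have h1 := ht.1; have h2 := ht.2
          push_cast at h1 h2
          refine ⟨?_, ENNReal.ofReal_lt_top⟩
          have h0 : 0 ≤ t := by
            have : (0 : ℝ) ≤ (ν i : ℕ) + L * n := by positivity
            linarith
          have : ⌊t⌋₊ = ν i + L * n := by
            rw [Nat.floor_eq_iff h0]; push_cast; constructor <;> linarith
          change ⌊t⌋₊ % L = ν i
          rw [this, Nat.add_mul_mod_self_left, Nat.mod_eq_of_lt (ν i).2])

/-- The part of the distribution of `f` missing from `z` can be realized on any set of infinite
measure. -/
theorem exists_complement {f z : ℝ → ℝ} (hf : Measurable f) (hf0 : ∀ t, 0 ≤ f t)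
    (hfi : Integrable f mHalf) (hz : IsPart f z) {W : Set ℝ} (hW : MeasurableSet W)
    (hW' : mHalf W = ∞) :
    ∃ l : ℝ → ℝ, Measurable l ∧ (∀ t, 0 ≤ l t) ∧ (∀ t, t ∉ W → l t = 0) ∧
      ∀ s, 0 < s → mHalf {t | s < z t} + mHalf {t | s < l t} = mHalf {t | s < f t} := by
  have hfin : ∀ s, 0 < s → mHalf {t | s < f t} < ∞ := fun s hs => by
    have := mHalf_gt_lt_top hfi hs
    simpa only [abs_of_nonneg (hf0 _)] using this
  have hzf : ∀ s, 0 < s → mHalf {t | s < z t} ≤ mHalf {t | s < f t} := fun s hs =>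
    hz.measure_gt_le hs
  set d : ℝ → ℝ≥0∞ := fun s => mHalf {t | s < f t} - mHalf {t | s < z t} with hd
  have hdz : ∀ s, 0 < s → mHalf {t | s < z t} + d s = mHalf {t | s < f t} := fun s hs =>
    add_tsub_cancel_of_le (hzf s hs)
  -- `d` is non-increasing
  have hdanti : ∀ s s', 0 < s → s ≤ s' → d s' ≤ d s := by
    intro s s' hs hss
    -- Monotonicity of `d` requires comparing `z` and `f` on the band between `s` and `s'`, which
    -- domination of superlevel sets alone would not give.
    have split : ∀ g : ℝ → ℝ, Measurable g → mHalf {t | s < g t} =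
        mHalf {t | s < g t ∧ g t ≤ s'} + mHalf {t | s' < g t} := fun g hg => by
      rw [← measure_union]
      · congr 1
        ext t
        simp only [mem_ofPred_eq, mem_union]
        constructor
        · intro h
          rcases le_or_gt (g t) s' with h' | h'
          exacts [Or.inl ⟨h, h'⟩, Or.inr h']
        · rintro (h | h)
          exacts [h.1, hss.trans_lt h]
      · exact disjoint_left.2 fun t ht ht' => not_lt.2 ht.2 ht'
      · exact measurableSet_lt measurable_const hg
    simp only [hd]
    rw [split f hf, split z hz.measurable]
    have h1 := hz.dist_le s s' hs
    have h2 : mHalf {t | s' < z t} ≠ ∞ := ((hzf s' (by linarith)).trans_lt (hfin s' (by linarith))).ne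
    have h3 : mHalf {t | s < z t ∧ z t ≤ s'} ≠ ∞ :=
      (h1.trans_lt ((measure_mono fun t ht => ht.1).trans_lt (hfin s hs))).ne
    refine ENNReal.le_sub_of_add_le_left (ENNReal.add_ne_top.2 ⟨h3, h2⟩) ?_
    rw [add_assoc, add_tsub_cancel_of_le (hzf s' (by linarith))]
    exact add_le_add_left h1 _
  -- and right continuous
  have hdright : ∀ s a, 0 < s → a < d s → ∃ s', s < s' ∧ a < d s' := by
    intro s a hs ha
    have hU : {t | s < f t} = ⋃ n : ℕ, {t | s + 1 / (n + 1 : ℝ) < f t} := by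
      ext t
      simp only [mem_ofPred_eq, mem_iUnion]
      constructor
      · intro h
        obtain ⟨n, hn⟩ := exists_nat_one_div_lt (sub_pos.2 h)
        exact ⟨n, by linarith⟩
      · rintro ⟨n, hn⟩
        have : (0 : ℝ) < 1 / (n + 1) := by positivity
        linarith
    have hmono : Monotone fun n : ℕ => {t | s + 1 / (n + 1 : ℝ) < f t} := fun m n hmn t ht => by
      have : 1 / ((n : ℝ) + 1) ≤ 1 / ((m : ℝ) + 1) := by gcongr
      have ht' : s + 1 / (m + 1 : ℝ) < f t := ht
      change s + 1 / (n + 1 : ℝ) < f t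
      linarith
    have hzs : mHalf {t | s < z t} ≠ ∞ := ((hzf s hs).trans_lt (hfin s hs)).ne
    have h1 : a + mHalf {t | s < z t} < mHalf {t | s < f t} := lt_tsub_iff_right.1 ha
    rw [hU, hmono.measure_iUnion, lt_iSup_iff] at h1
    obtain ⟨n, hn⟩ := h1
    have hn0 : (0 : ℝ) < 1 / (n + 1) := by positivity
    refine ⟨s + 1 / (n + 1 : ℝ), by linarith, lt_tsub_iff_right.2 (lt_of_le_of_lt ?_ hn)⟩
    have hsub : {t | s + 1 / (n + 1 : ℝ) < z t} ⊆ {t | s < z t} := fun t ht =>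
      lt_trans (b := s + 1 / (n + 1 : ℝ)) (by linarith) ht
    exact add_le_add_right (measure_mono hsub) a
  have hdbdd : ∀ a : ℝ, 0 < a → BddAbove {s | 0 < s ∧ ENNReal.ofReal a < d s} := by
    intro a ha
    refine ⟨(Phi f 0).toReal / a, fun s hs => ?_⟩
    have h1 : ENNReal.ofReal s * ENNReal.ofReal a ≤ Phi f 0 := by
      calc ENNReal.ofReal s * ENNReal.ofReal a ≤ ENNReal.ofReal s * mHalf {t | s < f t} := by
            gcongr
            exact hs.2.le.trans tsub_le_self
        _ ≤ ENNReal.ofReal s * mHalf {t | ENNReal.ofReal s ≤ ENNReal.ofReal (|f t| - 0)} := by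
            gcongr with t
            intro h
            rw [sub_zero, abs_of_nonneg (hf0 t)]
            exact ENNReal.ofReal_le_ofReal (le_of_lt h)
        _ ≤ Phi f 0 := mul_meas_ge_le_lintegral (hf.norm.sub_const 0).ennreal_ofReal _
    rw [le_div_iff₀ ha, ← ENNReal.ofReal_le_iff_le_toReal (Phi_lt_top hfi le_rfl).ne,
      ENNReal.ofReal_mul hs.1.le]
    exact h1
  -- The generalized inverse of `d`, evaluated at the rank in `W`. Since `W` has infinite measure,
  -- rank carries it to the whole semi-axis, and monotonicity with right continuity of `d` gives `{l
  -- > s}` the measure `d s`.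
  open Classical in
  set l : ℝ → ℝ := fun t => if t ∈ W ∧ 0 < rk W t then
    sSup {s | 0 < s ∧ ENNReal.ofReal (rk W t) < d s} else 0 with hl
  have hl0 : ∀ t, 0 ≤ l t := fun t => by
    simp only [hl]
    split_ifs
    · exact Real.sSup_nonneg fun s hs => hs.1.le
    · exact le_rfl
  have hlt : ∀ s, 0 < s → {t | s < l t} = rk W ⁻¹' (Ioi 0 ∩ {r | ENNReal.ofReal r < d s}) ∩ W := by
    intro s hs
    ext t
    simp only [mem_ofPred_eq, mem_inter_iff, mem_preimage, mem_Ioi, hl]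
    split_ifs with h
    · constructor
      · intro h1
        have hne : {s | 0 < s ∧ ENNReal.ofReal (rk W t) < d s}.Nonempty := by
          by_contra hne
          rw [not_nonempty_iff_eq_empty.1 hne, Real.sSup_empty] at h1
          linarith
        obtain ⟨s', hs', hss⟩ := exists_lt_of_lt_csSup hne h1
        exact ⟨⟨h.2, hs'.2.trans_le (hdanti s s' hs hss.le)⟩, h.1⟩
      · rintro ⟨⟨-, h1⟩, -⟩
        obtain ⟨s', hss, hs'⟩ := hdright s _ hs h1
        exact hss.trans_le (le_csSup (hdbdd _ h.2) ⟨hs.trans hss, hs'⟩)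
    · exact ⟨fun h1 => absurd h1 (by linarith), fun h1 => absurd ⟨h1.2, h1.1.1⟩ h⟩
  have hrm : Measurable (rk W) := (continuous_rk W).measurable
  have hms : ∀ s, MeasurableSet (Ioi 0 ∩ {r | ENNReal.ofReal r < d s}) := fun s =>
    measurableSet_Ioi.inter (measurableSet_lt ENNReal.measurable_ofReal measurable_const)
  have hlm : Measurable l := by
    refine measurable_of_Ioi fun s => ?_
    rcases lt_trichotomy s 0 with hs | rfl | hs
    · have : l ⁻¹' Ioi s = univ := eq_univ_of_forall fun t => hs.trans_le (hl0 t)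
      rw [this]; exact MeasurableSet.univ
    · have : l ⁻¹' Ioi 0 = ⋃ n : ℕ, {t | 1 / (n + 1 : ℝ) < l t} := by
        ext t
        simp only [mem_preimage, mem_Ioi, mem_iUnion, mem_ofPred_eq]
        refine ⟨fun h => exists_nat_one_div_lt h, fun ⟨n, hn⟩ => lt_trans (by positivity) hn⟩
      rw [this]
      refine MeasurableSet.iUnion fun n => ?_
      rw [hlt _ (by positivity)]
      exact (hrm (hms _)).inter hW
    · change MeasurableSet {t | s < l t}
      rw [hlt s hs]
      exact (hrm (hms _)).inter hW
  refine ⟨l, hlm, hl0, fun t ht => if_neg fun h => ht h.1, fun s hs => ?_⟩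
  rw [← hdz s hs]
  congr 1
  rw [hlt s hs, ← Measure.restrict_apply (hrm (hms s)), ← Measure.map_apply hrm (hms s), map_rk, hW',
    Measure.restrict_apply (hms s)]
  have : mHalf (Ioi 0 ∩ {r | ENNReal.ofReal r < d s} ∩ {t | ENNReal.ofReal t < ∞}) =
      mHalf {t | ENNReal.ofReal t < d s} := by
    refine measure_congr ?_
    filter_upwards [ae_pos] with t ht
    refine propext ⟨fun h => h.1.2, fun h => ⟨⟨ht, h⟩, ENNReal.ofReal_lt_top⟩⟩
  rw [this, mHalf_ofReal_lt]

/-! ### Approximation from below by averages of parts -/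

section

variable {E : Type*} [NormedAddCommGroup E] [NormedSpace ℝ E] {ι : E →ₗ[ℝ] L0}

theorem dec_rearrR {x : L0} (hx : MemL1 x) : Dec (rearrR x) :=
  ⟨measurable_rearrR x, rearrR_nonneg x, rearrR_antitoneOn hx, integrable_rearrR hx⟩

theorem ofReal_primitive {f : ℝ → ℝ} (hf : Dec f) {t : ℝ} (ht : 0 ≤ t) :
    ENNReal.ofReal (primitive f t) = ∫⁻ s in Ioo 0 t, ENNReal.ofReal (f s) := by
  rw [primitive, intervalIntegral.integral_of_le ht, ofReal_integral_eq_lintegral_ofReal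
    hf.integrable.integrableOn (ae_of_all _ hf.nonneg), Measure.restrict_restrict measurableSet_Ioc,
    inter_eq_self_of_subset_left Ioc_subset_Ioi_self]
  exact (setLIntegral_congr Ioo_ae_eq_Ioc).symm

theorem primitive_le_of_submajorized {x y : L0} (hx : MemL1 x) (hy : MemL1 y)
    (h : Submajorized y x) {t : ℝ} (ht : 0 ≤ t) :
    primitive (rearrR y) t ≤ primitive (rearrR x) t := by
  have h0 : 0 ≤ primitive (rearrR x) t := by
    rw [← primitive_zero (rearrR x)]; exact (dec_rearrR hx).monotone_primitive ht
  rw [← ENNReal.ofReal_le_ofReal_iff h0, ofReal_primitive (dec_rearrR hx) ht,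
    ofReal_primitive (dec_rearrR hy) ht, ← lintegral_rearr hx, ← lintegral_rearr hy]
  exact h t ht

/-- The part of an integrable function where it is small has small norm. -/
theorem exists_EN_small_values_le (hE : IsFullySymmetric ι) (hL1 : ∀ z : E, MemL1 (ι z))
    (hone : EN ι ((Icc (0 : ℝ) 1).indicator fun _ => 1) < ∞) {y : L0} (hy : MemL1 y) {η : ℝ≥0∞}
    (hη : 0 < η) :
    ∃ a : ℝ, 0 < a ∧ EN ι ({t | a < |y t|}ᶜ.indicator fun t => |y t|) ≤ η := by
  obtain ⟨b, hb, hbη⟩ := exists_ofReal_mul_le hone hη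
  have hym : Measurable fun t => |y t| := y.measurable.norm
  set v : ℕ → ℝ → ℝ := fun n => {t | 1 / (n + 1 : ℝ) < |y t|}ᶜ.indicator fun t => |y t| with hv
  have hvm : ∀ n, Measurable (v n) := fun n =>
    hym.indicator (measurableSet_lt measurable_const hym).compl
  have hv0 : ∀ n t, 0 ≤ v n t := fun n t => indicator_nonneg (fun t _ => abs_nonneg _) t
  have hvy : ∀ n t, v n t ≤ |y t| := fun n t => indicator_le_self' (fun t _ => abs_nonneg _) t
  have hvle : ∀ n t, v n t ≤ 1 / (n + 1 : ℝ) := fun n t => by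
    by_cases ht : t ∈ {t | 1 / (n + 1 : ℝ) < |y t|}ᶜ
    · simp only [hv]; rw [indicator_of_mem ht]; exact not_lt.1 ht
    · simp only [hv]; rw [indicator_of_notMem ht]; positivity
  have hlim : Tendsto (fun n => Phi (v n) 0) atTop (𝓝 (∫⁻ _, 0 ∂mHalf)) := by
    refine tendsto_lintegral_of_dominated_convergence (fun t => ENNReal.ofReal (|y t| - 0))
      (fun n => ((hvm n).norm.sub_const 0).ennreal_ofReal) (fun n => ae_of_all _ fun t => ?_)
      (Phi_lt_top hy le_rfl).ne (ae_of_all _ fun t => ?_)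
    · refine ENNReal.ofReal_le_ofReal ?_
      rw [abs_of_nonneg (hv0 n t)]
      linarith [hvy n t]
    · have h1 : Tendsto (fun n => v n t) atTop (𝓝 0) :=
        squeeze_zero (fun n => hv0 n t) (fun n => hvle n t) tendsto_one_div_add_atTop_nhds_zero_nat
      have h2 := ENNReal.tendsto_ofReal (h1.abs.sub_const 0)
      simpa using h2
  rw [lintegral_zero] at hlim
  obtain ⟨n, hn1, hn2⟩ := (((tendsto_order.1 hlim).2 (ENNReal.ofReal b) (by simpa using hb)).and
    ((tendsto_order.1 (tendsto_one_div_add_atTop_nhds_zero_nat (𝕜 := ℝ))).2 b hb)).exists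
  refine ⟨1 / (n + 1 : ℝ), by positivity, le_trans (EN_le_of_bounded hE hL1 ?_ hb (fun t => ?_)
    hn1.le) hbη⟩
  · exact integrable_of_Phi_zero_lt_top (hvm n).aestronglyMeasurable
      (hn1.trans ENNReal.ofReal_lt_top)
  · change |v n t| ≤ b
    rw [abs_of_nonneg (hv0 n t)]
    exact (hvle n t).trans hn2.le

/-- Composition with `T` followed by multiplication by `k`. -/
def weightedComp (k T : ℝ → ℝ) : (ℝ → ℝ) →ₗ[ℝ] (ℝ → ℝ) where
  toFun z t := k t * z (T t)
  map_add' z w := by ext t; simp [mul_add]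
  map_smul' c z := by ext t; simp [mul_left_comm]

@[simp] theorem weightedComp_apply (k T z : ℝ → ℝ) (t : ℝ) :
    weightedComp k T z t = k t * z (T t) := rfl

theorem map_mem_convexHull {S S' : Set (ℝ → ℝ)} (L : (ℝ → ℝ) →ₗ[ℝ] (ℝ → ℝ))
    (h : ∀ z ∈ S, L z ∈ convexHull ℝ S') {u : ℝ → ℝ} (hu : u ∈ convexHull ℝ S) :
    L u ∈ convexHull ℝ S' :=
  convexHull_min (t := L ⁻¹' convexHull ℝ S') h ((convex_convexHull ℝ S').linear_preimage L) hu

/-- Multiplying a part by a function with values in `{0, 1/N, …, 1}` gives an average of parts. -/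
theorem step_mul_mem_convexHull {f z : ℝ → ℝ} {V : Set ℝ} {N : ℕ} (hN : 0 < N) {k : ℝ → ℕ}
    (hk : Measurable k) (hkN : ∀ t, k t ≤ N) (hz : IsPart f z ∧ ∀ t, t ∉ V → z t = 0) :
    weightedComp (fun t => k t / N) id z ∈ convexHull ℝ {z | IsPart f z ∧ ∀ t, t ∉ V → z t = 0} := by
  have h := average_mem_convexHull (S := {z | IsPart f z ∧ ∀ t, t ∉ V → z t = 0}) hN
    (z := fun l => {t | (l : ℕ) < k t}.indicator z) fun l => subset_convexHull ℝ _
      ⟨hz.1.indicator (measurableSet_lt measurable_const hk), fun t ht => by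
        by_cases h : t ∈ {t | (l : ℕ) < k t}
        · rw [indicator_of_mem h, hz.2 t ht]
        · rw [indicator_of_notMem h]⟩
  convert h using 1
  ext t
  have h1 : ∑ l : Fin N, {t | (l : ℕ) < k t}.indicator z t = k t * z t := by
    simp only [indicator_apply, mem_ofPred_eq]
    rw [Fin.sum_univ_eq_sum_range (fun l => if l < k t then z t else 0), ← Finset.sum_filter,
      Finset.sum_const, nsmul_eq_mul]
    have : (Finset.range N).filter (· < k t) = Finset.range (k t) := by
      ext l; have := hkN t; simp; omega
    rw [this, Finset.card_range]
  rw [h1, weightedComp_apply, id]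
  ring

/-- Each part is submajorized by `f`, and the condition `EN ι u ≤ EN ι f` is preserved by convex
combinations. -/
theorem EN_le_of_mem_convexHull (hE : IsFullySymmetric ι) (hL1 : ∀ z : E, MemL1 (ι z)) {f u : ℝ → ℝ}
    (hf : Measurable f) (hf0 : ∀ t, 0 ≤ f t) (hfi : Integrable f mHalf)
    (hu : u ∈ convexHull ℝ {z | IsPart f z}) : EN ι u ≤ EN ι f := by
  have hmul : ∀ a : ℝ, 0 ≤ a → ∀ u : ℝ → ℝ, EN ι u ≤ EN ι f →
      EN ι (fun t => a * u t) ≤ ENNReal.ofReal a * EN ι f := by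
    intro a ha u hu
    rcases ha.eq_or_lt with rfl | ha
    · simp [EN_zero]
    · rw [EN_const_mul ha]; exact mul_le_mul_right hu _
  have hconv : Convex ℝ {u : ℝ → ℝ | EN ι u ≤ EN ι f} := by
    intro u hu v hv a b ha hb hab
    refine (EN_add_le (fun t => a * u t) (fun t => b * v t)).trans
      ((add_le_add (hmul a ha u hu) (hmul b hb v hv)).trans_eq ?_)
    rw [← add_mul, ← ENNReal.ofReal_add ha hb, hab, ENNReal.ofReal_one, one_mul]
  refine convexHull_min (t := {u : ℝ → ℝ | EN ι u ≤ EN ι f}) (fun z hz => ?_) hconv hu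
  exact EN_le_of_Phi hE hL1 (hz.integrable hf hf0 hfi) fun c hc => hz.Phi_le hf hf0 hc.le

/-- Rounding down a quotient. -/
theorem exists_step_quotient {a u : ℝ → ℝ} (ha : Measurable a) (ha0 : ∀ t, 0 ≤ a t)
    (hu : Measurable u) (hu0 : ∀ t, 0 ≤ u t) {N : ℕ} (hN : 0 < N) :
    ∃ k : ℝ → ℕ, Measurable k ∧ (∀ t, k t ≤ N) ∧ ∀ t, k t / N * u t ≤ a t ∧
      a t - k t / N * u t ≤ max (a t - u t) 0 + (N : ℝ)⁻¹ * u t := by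
  have hN' : (0 : ℝ) < N := by exact_mod_cast hN
  -- The ratio `a / u` truncated at `1` and rounded down to a multiple of `1/N`; where `u` vanishes
  -- the product with `u` is zero whatever the quotient.
  refine ⟨fun t => min ⌊N * (a t / u t)⌋₊ N, (Nat.measurable_floor.comp
    ((ha.div hu).const_mul _)).min measurable_const, fun t => min_le_right _ _, fun t => ?_⟩
  beta_reduce
  rcases (hu0 t).eq_or_lt with hu | hu
  · rw [← hu]
    simp only [mul_zero, sub_zero, add_zero]
    exact ⟨ha0 t, le_max_left _ _⟩
  have hN1 : 0 ≤ (N : ℝ)⁻¹ * u t := by positivity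
  have hq : 0 ≤ N * (a t / u t) := mul_nonneg hN'.le (div_nonneg (ha0 t) hu.le)
  rcases le_total N ⌊N * (a t / u t)⌋₊ with h | h
  · rw [min_eq_right h, div_self hN'.ne', one_mul]
    refine ⟨?_, (le_max_left _ _).trans (le_add_of_nonneg_right hN1)⟩
    have h1 := (Nat.le_floor_iff hq).1 h
    have h2 : 1 ≤ a t / u t := le_of_mul_le_mul_left (by rwa [mul_one]) hN'
    rwa [one_le_div hu] at h2
  · rw [min_eq_left h]
    have h1 := Nat.floor_le hq
    have h2 := Nat.lt_floor_add_one (N * (a t / u t))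
    have e : a t / u t * u t = a t := div_mul_cancel₀ _ hu.ne'
    have h3 : (⌊N * (a t / u t)⌋₊ : ℝ) / N ≤ a t / u t := by rw [div_le_iff₀' hN']; exact h1
    have h4 : a t / u t ≤ (⌊N * (a t / u t)⌋₊ : ℝ) / N + (N : ℝ)⁻¹ := by
      rw [← one_div, ← add_div, le_div_iff₀' hN']; exact h2.le
    constructor
    · calc _ ≤ a t / u t * u t := mul_le_mul_of_nonneg_right h3 hu.le
        _ = a t := e
    · have h5 := mul_le_mul_of_nonneg_right h4 hu.le
      rw [e, add_mul] at h5
      exact (sub_le_iff_le_add'.2 h5).trans (le_add_of_nonneg_left (le_max_right _ _))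

/-- If `φ_fin(x) = 0`, elements of `Ω'(x)` are approximated from below by averages of parts of
`x^*` with support of finite measure. -/
theorem exists_approx_below (hE : IsFullySymmetric ι) (hL1 : ∀ z : E, MemL1 (ι z)) (x : E)
    (hphi : phiFin ι (ι x) = 0) (hone : EN ι ((Icc (0 : ℝ) 1).indicator fun _ => 1) < ∞) {y : L0}
    (hy : y ∈ OmegaPrime (ι x)) {η : ℝ≥0∞} (hη : 0 < η) :
    ∃ V, MeasurableSet V ∧ mHalf V < ∞ ∧
      ∃ b ∈ convexHull ℝ {z | IsPart (rearrR (ι x)) z ∧ ∀ t, t ∉ V → z t = 0},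
        (∀ t, b t ≤ |y t|) ∧ EN ι (fun t => |y t| - b t) ≤ η := by
  have hy1 : MemL1 y := hy.2.1
  have hyPhi := ((mem_OmegaPrime_iff (hL1 x)).1 hy).2.2.1
  have hf := dec_rearrR (hL1 x)
  set f := rearrR (ι x) with hfdef
  have hym : Measurable fun t => |y t| := y.measurable.norm
  -- One quarter for each error: small values of `y`, the relative loss `δ |y|`, the transported
  -- correction, and rounding. The minimum with `1` keeps the correction in `E` even if `η = ∞`.
  set η' := min (η / 4) 1 with hη'
  have hη'0 : 0 < η' := lt_min (ENNReal.div_pos hη.ne' (by simp)) one_pos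
  obtain ⟨a, ha, haη⟩ := exists_EN_small_values_le hE hL1 hone hy1 hη'0
  set V : Set ℝ := {t | a < |y t|} with hV
  have hVm : MeasurableSet V := measurableSet_lt measurable_const hym
  obtain ⟨δ, hδ, hδx⟩ := exists_ofReal_mul_le (enorm_lt_top (x := x)) hη'0
  set ε := min (δ / 2) (1 / 2) with hε
  have hε0 : 0 < ε := lt_min (by positivity) (by norm_num)
  have hε1 : ε ≤ 1 / 2 := min_le_right _ _
  have hεδ : 2 * ε ≤ δ := by
    have : ε ≤ δ / 2 := min_le_left _ _
    linarith
  obtain ⟨N, hN⟩ := exists_nat_gt δ⁻¹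
  have hN0 : (0 : ℝ) < N := (inv_pos.2 hδ).trans hN
  have hNδ : (N : ℝ)⁻¹ ≤ δ := inv_le_of_inv_le₀ hδ hN.le
  obtain ⟨u, hu, e, hem, he0, heη, hmain⟩ := exists_average_ge hE hL1 x hphi hone (dec_rearrR hy1) hf
    (fun t ht => primitive_le_of_submajorized (hL1 x) hy1 hy.2.2.1 ht) hε0 (by linarith) hη'0
  obtain ⟨T, hT, hTy⟩ := exists_transport_rearr hy1 (θ := 1 + ε) (by linarith)
  have hTV : IsTransport V T := hT.mono hVm fun t ht => ha.trans ht
  -- transport to `V`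
  set u' : ℝ → ℝ := weightedComp (V.indicator 1) T u with hu'
  have hind : ∀ z : ℝ → ℝ, weightedComp (V.indicator 1) T z = V.indicator fun t => z (T t) := by
    intro z; ext t
    by_cases ht : t ∈ V <;> simp [ht]
  have hu'mem : u' ∈ convexHull ℝ {z | IsPart f z ∧ ∀ t, t ∉ V → z t = 0} := by
    refine map_mem_convexHull _ (fun z hz => subset_convexHull ℝ _ ?_) hu
    rw [hind]
    exact ⟨IsPart.comp hz hTV, fun t ht => indicator_of_notMem ht _⟩
  have hu'part : u' ∈ convexHull ℝ {z | IsPart f z} := convexHull_mono (fun z hz => hz.1) hu'mem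
  have hu'm : Measurable u' := measurable_of_mem_convexHull (fun z hz => IsPart.measurable hz) hu'part
  have hu'0 : ∀ t, 0 ≤ u' t := nonneg_of_mem_convexHull (fun z hz => IsPart.nonneg hz) hu'part
  have hei : Integrable e mHalf := by
    obtain ⟨z, hz⟩ := exists_of_EN_lt_top (heη.trans_lt ((min_le_right _ _).trans_lt ENNReal.one_lt_top))
    exact (hL1 z).congr hz
  set e' : ℝ → ℝ := V.indicator fun t => e (T t) with he'
  have he'part : IsPart e e' := (IsPart.refl hem he0).comp hTV
  have he'η : EN ι e' ≤ η' := (EN_le_of_Phi hE hL1 (he'part.integrable hem he0 hei) fun c hc =>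
    he'part.Phi_le hem he0 hc.le).trans heη
  -- The average `u'` may exceed `|y|`. Multiplying it by the rounded ratio brings it below `|y|`,
  -- and such multiples of parts are again averages of parts.
  obtain ⟨k, hkm, hkN, hk⟩ := exists_step_quotient hym (fun t => abs_nonneg (y t)) hu'm hu'0
    (N := N) (by exact_mod_cast hN0)
  set b : ℝ → ℝ := weightedComp (fun t => k t / N) id u' with hb
  have hbt : ∀ t, b t = k t / N * u' t := fun t => rfl
  refine ⟨V, hVm, mHalf_gt_lt_top hy1 ha, b, ?_, fun t => (hk t).1, ?_⟩
  · exact map_mem_convexHull _ (fun z hz => step_mul_mem_convexHull (by exact_mod_cast hN0) hkm hkN hz)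
      hu'mem
  · set v₀ : ℝ → ℝ := Vᶜ.indicator fun t => |y t| with hv₀
    have hbm : Measurable b := ((measurable_from_nat (f := fun n : ℕ => (n : ℝ) / N)).comp hkm).mul hu'm
    have hle : ∀ᵐ t ∂mHalf, |(|y t| - b t)| ≤
        |v₀ t + δ * |y t| + (e' t + (N : ℝ)⁻¹ * u' t)| := by
      filter_upwards [hTy] with t ht
      have h1 := hk t
      have h2 : 0 ≤ (N : ℝ)⁻¹ * u' t := mul_nonneg (inv_nonneg.2 hN0.le) (hu'0 t)
      have h3 : 0 ≤ e' t := he'part.nonneg t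
      have h4 : 0 ≤ v₀ t := indicator_nonneg (fun t _ => abs_nonneg _) t
      have h5 : 0 ≤ δ * |y t| := mul_nonneg hδ.le (abs_nonneg _)
      rw [hbt t, abs_of_nonneg (sub_nonneg.2 h1.1),
        abs_of_nonneg (add_nonneg (add_nonneg h4 h5) (add_nonneg h3 h2))]
      refine h1.2.trans ?_
      by_cases htV : t ∈ V
      · obtain ⟨hT0, hTt⟩ := ht (ha.trans htV)
        have h6 := hmain (T t) hT0
        have e1 : u' t = u (T t) := by rw [hu', hind, indicator_of_mem htV]
        have e2 : e' t = e (T t) := by rw [he', indicator_of_mem htV]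
        rw [← e1, ← e2] at h6
        have h7 : |y t| - u' t ≤ δ * |y t| + e' t := by
          have h8 : (1 - ε) * |y t| ≤ (1 + ε) * (u' t + e' t) := by
            calc (1 - ε) * |y t| ≤ (1 - ε) * ((1 + ε) * rearrR y (T t)) :=
                  mul_le_mul_of_nonneg_left hTt (by linarith)
              _ = (1 + ε) * ((1 - ε) * rearrR y (T t)) := by ring
              _ ≤ _ := mul_le_mul_of_nonneg_left h6 (by linarith)
          have h9 : (1 - 2 * ε) * ((1 + ε) * |y t|) ≤ (1 + ε) * (u' t + e' t) := by
            refine le_trans ?_ h8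
            nlinarith [mul_nonneg (mul_nonneg hε0.le hε0.le) (abs_nonneg (y t))]
          have h10 : (1 - 2 * ε) * |y t| ≤ u' t + e' t :=
            le_of_mul_le_mul_left (by linarith) (show (0 : ℝ) < 1 + ε by linarith)
          nlinarith [mul_le_mul_of_nonneg_right hεδ (abs_nonneg (y t))]
        have : max (|y t| - u' t) 0 ≤ δ * |y t| + e' t := max_le h7 (by positivity)
        linarith
      · have e1 : u' t = 0 := by rw [hu', hind, indicator_of_notMem htV]
        have e2 : v₀ t = |y t| := indicator_of_mem (s := Vᶜ) htV _
        rw [e1, e2, sub_zero, max_eq_left (abs_nonneg _)]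
        linarith
    have hyE : EN ι (fun t => |y t|) ≤ ‖x‖ₑ := by
      refine (EN_le_of_Phi hE hL1 hy1.abs fun c hc => ?_).trans (EN_le_of_ae (ae_eq_refl (⇑(ι x))))
      refine (le_of_eq ?_).trans (hyPhi c hc)
      simp only [Phi, abs_abs]
    have hu'E : EN ι u' ≤ ‖x‖ₑ :=
      (EN_le_of_mem_convexHull hE hL1 hf.measurable hf.nonneg hf.integrable hu'part).trans
        (EN_rearrR hE hL1 x)
    calc EN ι (fun t => |y t| - b t)
        ≤ EN ι (fun t => v₀ t + δ * |y t| + (e' t + (N : ℝ)⁻¹ * u' t)) :=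
          EN_mono hE.toIsSymmetric (hym.sub hbm).aestronglyMeasurable hle
      _ ≤ (EN ι v₀ + EN ι fun t => δ * |y t|) + (EN ι e' + EN ι fun t => (N : ℝ)⁻¹ * u' t) :=
          (EN_add_le _ _).trans (add_le_add (EN_add_le _ _) (EN_add_le _ _))
      _ ≤ (η' + η') + (η' + η') := by
          refine add_le_add (add_le_add haη ?_) (add_le_add he'η ?_)
          · rw [EN_const_mul hδ]
            exact (mul_le_mul_right hyE _).trans hδx
          · rw [EN_const_mul (inv_pos.2 hN0)]
            refine le_trans ?_ hδx
            gcongr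
      _ ≤ (η / 4 + η / 4) + (η / 4 + η / 4) := by
          have := min_le_left (η / 4) 1
          gcongr
      _ = η := by
          rw [← two_mul, ← two_mul, ← mul_assoc]
          norm_num
          exact ENNReal.mul_div_cancel (by simp) (by simp)

end

/-! ### Completion to equimeasurable functions, and sufficiency -/

section

variable {E : Type*} [NormedAddCommGroup E] [NormedSpace ℝ E] {ι : E →ₗ[ℝ] L0}

/-- The two functions have disjoint supports, so their distributions add up to that of `f`. -/
theorem IsPart.Phi_add_complement {f z l : ℝ → ℝ} {V : Set ℝ} (hf : Measurable f)
    (hf0 : ∀ t, 0 ≤ f t) (hz : IsPart f z) (hzV : ∀ t, t ∉ V → z t = 0) (hl : Measurable l)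
    (hl0 : ∀ t, 0 ≤ l t) (hlV : ∀ t, t ∈ V → l t = 0)
    (h : ∀ s, 0 < s → mHalf {t | s < z t} + mHalf {t | s < l t} = mHalf {t | s < f t}) {c : ℝ}
    (hc : 0 ≤ c) : Phi (fun t => z t + l t) c = Phi f c := by
  refine Phi_eq_of_dist (f := fun t => z t + l t) (hz.measurable.add hl).aemeasurable hf.aemeasurable (fun s hs => ?_) hc
  have e1 : ∀ t, |z t + l t| = z t + l t := fun t => abs_of_nonneg (add_nonneg (hz.nonneg t) (hl0 t))
  have e2 : ∀ t, |f t| = f t := fun t => abs_of_nonneg (hf0 t)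
  simp only [e1, e2]
  rw [← h s hs, ← measure_union]
  · congr 1
    ext t
    simp only [mem_ofPred_eq, mem_union]
    by_cases ht : t ∈ V
    · rw [hlV t ht, add_zero]
      exact ⟨Or.inl, fun h => h.elim id fun h => absurd h (by linarith)⟩
    · rw [hzV t ht, zero_add]
      exact ⟨Or.inr, fun h => h.elim (fun h => absurd h (by linarith)) id⟩
  · refine disjoint_left.2 fun t ht ht' => ?_
    have h1 : s < z t := ht
    have h2 : s < l t := ht'
    by_cases htV : t ∈ V
    · rw [hlV t htV] at h2; linarith
    · rw [hzV t htV] at h1; linarith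
  · exact measurableSet_lt measurable_const hl

/-- A weighted sum of functions with disjoint supports and weights at most `1 / R`. -/
theorem Phi_weighted_disjoint_le {κ : Type*} [Fintype κ] {f : ℝ → ℝ} {w : κ → ℝ} {l : κ → ℝ → ℝ}
    {W : κ → Set ℝ} (hW : ∀ p q, p ≠ q → Disjoint (W p) (W q)) (hlW : ∀ p t, t ∉ W p → l p t = 0)
    (hl : ∀ p, Measurable (l p)) (hl0 : ∀ p t, 0 ≤ l p t) (hw0 : ∀ p, 0 ≤ w p) (hw1 : ∑ p, w p = 1)
    {R : ℝ} (hR : ∀ p, w p * R ≤ 1) (hR0 : 0 ≤ R) (hPhi : ∀ p c, 0 ≤ c → Phi (l p) c ≤ Phi f c)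
    {c : ℝ} (hc : 0 ≤ c) : Phi (fun t => ∑ p, w p * l p t) c ≤ Phi f (R * c) := by
  classical
  calc Phi (fun t => ∑ p, w p * l p t) c
      ≤ ∫⁻ t, ∑ p, ENNReal.ofReal (w p) * ENNReal.ofReal (|l p t| - R * c) ∂mHalf := by
        refine lintegral_mono fun t => ?_
        rw [abs_of_nonneg (Finset.sum_nonneg fun p _ => mul_nonneg (hw0 p) (hl0 p t))]
        by_cases ht : ∃ p, t ∈ W p
        · obtain ⟨p, hp⟩ := ht
          have h1 : ∑ q, w q * l q t = w p * l p t := by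
            refine Finset.sum_eq_single p (fun q _ hq => ?_) fun h => absurd (Finset.mem_univ p) h
            rw [hlW q t fun h => disjoint_left.1 (hW q p hq) h hp, mul_zero]
          rw [h1]
          refine le_trans ?_ (Finset.single_le_sum
            (f := fun p => ENNReal.ofReal (w p) * ENNReal.ofReal (|l p t| - R * c))
            (fun _ _ => zero_le) (Finset.mem_univ p))
          rw [← ENNReal.ofReal_mul (hw0 p), abs_of_nonneg (hl0 p t)]
          refine ENNReal.ofReal_le_ofReal ?_
          nlinarith [mul_le_mul_of_nonneg_right (hR p) hc]
        · push Not at ht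
          rw [Finset.sum_eq_zero fun p _ => by rw [hlW p t (ht p), mul_zero],
            ENNReal.ofReal_of_nonpos (by linarith)]
          exact zero_le
    _ = ∑ p, ENNReal.ofReal (w p) * Phi (l p) (R * c) := by
        have hm : ∀ p, Measurable fun t => |l p t| := fun p => (hl p).norm
        rw [lintegral_finsetSum _ fun p _ => (((hm p).sub_const _).ennreal_ofReal).const_mul _]
        refine Finset.sum_congr rfl fun p _ => ?_
        rw [lintegral_const_mul' _ _ ENNReal.ofReal_ne_top]
        rfl
    _ ≤ ∑ p, ENNReal.ofReal (w p) * Phi f (R * c) := by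
        gcongr with p
        exact hPhi p _ (by positivity)
    _ = Phi f (R * c) := by
        rw [← Finset.sum_mul, ← ENNReal.ofReal_sum_of_nonneg fun p _ => hw0 p, hw1,
          ENNReal.ofReal_one, one_mul]

/-- An average of parts of `f` can be completed to an average of functions equimeasurable with `f`,
and the added function is flat. -/
theorem exists_completion {f : ℝ → ℝ} (hf : Measurable f) (hf0 : ∀ t, 0 ≤ f t)
    (hfi : Integrable f mHalf) {V : Set ℝ} (hV : MeasurableSet V) (hV' : mHalf V < ∞) {b : ℝ → ℝ}
    (hb : b ∈ convexHull ℝ {z | IsPart f z ∧ ∀ t, t ∉ V → z t = 0}) {R : ℕ} (hR : 0 < R) :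
    ∃ v : ℝ → ℝ, Measurable v ∧ (∀ t, 0 ≤ v t) ∧ (∀ c, 0 ≤ c → Phi v c ≤ Phi f (R * c)) ∧
      (fun t => b t + v t) ∈ convexHull ℝ {X : ℝ → ℝ | Measurable X ∧ (∀ t, 0 ≤ X t) ∧
        ∀ c, 0 ≤ c → Phi X c = Phi f c} := by
  obtain ⟨κ, _, w, z, hw0, hw1, hz, rfl⟩ := mem_convexHull_iff_exists_fintype.1 hb
  have hR' : (0 : ℝ) < R := by exact_mod_cast hR
  have hVc : mHalf Vᶜ = ∞ := by
    rw [measure_compl hV hV'.ne, Measure.restrict_apply_univ, Real.volume_Ioi,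
      ENNReal.top_sub hV'.ne]
  -- Each term is used `R` times with weight at most `1/R`, and every copy is completed on its own
  -- set outside `V`. Disjointness keeps the added function as flat as `R⁻¹ σ_R f`.
  obtain ⟨W, hWm, hWV, hWd, hW⟩ := exists_disjoint_measure_eq_top hV.compl hVc (κ × Fin R)
  have hl := fun p : κ × Fin R => exists_complement hf hf0 hfi (hz p.1).1 (hWm p) (hW p)
  choose l hlm hl0 hlW hlz using hl
  have hsum : ∑ p : κ × Fin R, w p.1 / R = 1 := by
    rw [Fintype.sum_prod_type]
    simp only [Finset.sum_const, Finset.card_univ, Fintype.card_fin, nsmul_eq_mul]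
    rw [← hw1]
    exact Finset.sum_congr rfl fun i _ => mul_div_cancel₀ _ hR'.ne'
  have hwp : ∀ p : κ × Fin R, 0 ≤ w p.1 / R := fun p => div_nonneg (hw0 _) hR'.le
  refine ⟨fun t => ∑ p : κ × Fin R, w p.1 / R * l p t,
    Finset.measurable_sum _ fun p _ => (hlm p).const_mul _,
    fun t => Finset.sum_nonneg fun p _ => mul_nonneg (hwp p) (hl0 p t), fun c hc => ?_, ?_⟩
  · refine Phi_weighted_disjoint_le hWd hlW hlm hl0 hwp hsum (fun p => ?_) hR'.le
      (fun p c hc => ?_) hc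
    · rw [div_mul_cancel₀ _ hR'.ne', ← hw1]
      exact Finset.single_le_sum (fun i _ => hw0 i) (Finset.mem_univ p.1)
    · refine Phi_le_of_dist (hlm p).aemeasurable hf.aemeasurable (fun s hs => ?_) hc
      simp only [abs_of_nonneg (hl0 p _), abs_of_nonneg (hf0 _)]
      rw [← hlz p s hs]
      exact le_add_self
  · have := (convex_convexHull ℝ {X : ℝ → ℝ | Measurable X ∧ (∀ t, 0 ≤ X t) ∧
        ∀ c, 0 ≤ c → Phi X c = Phi f c}).sum_mem (t := Finset.univ) (w := fun p : κ × Fin R => w p.1 / R)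
      (z := fun p t => z p.1 t + l p t)
      (fun p _ => hwp p) hsum fun p _ => subset_convexHull ℝ _
        ⟨(hz p.1).1.measurable.add (hlm p), fun t => add_nonneg ((hz p.1).1.nonneg t) (hl0 p t),
          fun c hc => (hz p.1).1.Phi_add_complement hf hf0 (hz p.1).2 (hlm p) (hl0 p)
            (fun t ht => hlW p t fun h => hWV p h ht) (hlz p) hc⟩
    convert this using 1
    ext t
    simp only [Finset.sum_apply, Pi.smul_apply, smul_eq_mul, mul_add, Finset.sum_add_distrib]
    congr 1
    rw [Fintype.sum_prod_type]
    simp only [Finset.sum_const, Finset.card_univ, Fintype.card_fin, nsmul_eq_mul]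
    refine Finset.sum_congr rfl fun i _ => ?_
    field_simp

/-- On nonnegative functions the excess at level `0` is the integral, which respects convex
combinations. -/
theorem Phi_zero_of_mem_convexHull {f X : ℝ → ℝ}
    (hX : X ∈ convexHull ℝ {X : ℝ → ℝ | Measurable X ∧ (∀ t, 0 ≤ X t) ∧
        ∀ c, 0 ≤ c → Phi X c = Phi f c}) : Phi X 0 = Phi f 0 := by
  have hPhi : ∀ u : ℝ → ℝ, (∀ t, 0 ≤ u t) → Phi u 0 = ∫⁻ t, ENNReal.ofReal (u t) ∂mHalf := by
    intro u hu
    simp only [Phi, abs_of_nonneg (hu _), sub_zero]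
  have hconv : Convex ℝ {u : ℝ → ℝ | Measurable u ∧ (∀ t, 0 ≤ u t) ∧ Phi u 0 = Phi f 0} := by
    rintro u ⟨hum, hu0, hu⟩ v ⟨hvm, hv0, hv⟩ a b ha hb hab
    have h0 : ∀ t, 0 ≤ (a • u + b • v) t := fun t =>
      add_nonneg (mul_nonneg ha (hu0 t)) (mul_nonneg hb (hv0 t))
    refine ⟨(hum.const_smul a).add (hvm.const_smul b), h0, ?_⟩
    rw [hPhi _ h0]
    rw [hPhi _ hu0] at hu
    rw [hPhi _ hv0] at hv
    have : ∀ t, ENNReal.ofReal ((a • u + b • v) t) =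
        ENNReal.ofReal a * ENNReal.ofReal (u t) + ENNReal.ofReal b * ENNReal.ofReal (v t) := by
      intro t
      rw [← ENNReal.ofReal_mul ha, ← ENNReal.ofReal_mul hb,
        ← ENNReal.ofReal_add (mul_nonneg ha (hu0 t)) (mul_nonneg hb (hv0 t))]
      rfl
    simp only [this]
    rw [lintegral_add_left (hum.ennreal_ofReal.const_mul _),
      lintegral_const_mul' _ _ ENNReal.ofReal_ne_top,
      lintegral_const_mul' _ _ ENNReal.ofReal_ne_top, hu, hv, ← add_mul, ← ENNReal.ofReal_add ha hb,
      hab, ENNReal.ofReal_one, one_mul]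
  exact (convexHull_min (t := {u : ℝ → ℝ | Measurable u ∧ (∀ t, 0 ≤ u t) ∧ Phi u 0 = Phi f 0})
    (fun X hX => ⟨hX.1, hX.2.1, hX.2.2 0 le_rfl⟩) hconv hX).2.2

theorem exists_Phi_zero_le_EN [CompleteSpace E] (hE : IsSymmetric ι) (hL1 : ∀ z : E, MemL1 (ι z)) :
    ∃ K : ℝ, 0 < K ∧ ∀ u : ℝ → ℝ, Phi u 0 ≤ ENNReal.ofReal K * EN ι u := by
  obtain ⟨K, hK, h⟩ := exists_eLpNorm_le hE hL1
  refine ⟨K, hK, fun u => ?_⟩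
  rcases eq_or_ne (EN ι u) ∞ with hu | hu
  · rw [hu, ENNReal.mul_top (by simpa using hK)]; exact le_top
  · obtain ⟨z, hz⟩ := exists_of_EN_lt_top (lt_top_iff_ne_top.2 hu)
    rw [← Phi_congr hz, EN_eq_of_ae hE.injective hz, Phi_zero]
    refine (h z).trans_eq ?_
    rw [ENNReal.ofReal_mul hK.le, ofReal_norm]

/-- Nonnegative functions with the excess of `x^*` lie in `E` by full symmetry and are extreme in
the orbit, so combinations of them lift to `E`. -/
theorem exists_mem_convexHull_extremePoints (hE : IsFullySymmetric ι) (hL1 : ∀ z : E, MemL1 (ι z))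
    (x : E) {X : ℝ → ℝ} (hX : X ∈ convexHull ℝ {X : ℝ → ℝ | Measurable X ∧ (∀ t, 0 ≤ X t) ∧
        ∀ c, 0 ≤ c → Phi X c = Phi (rearrR (ι x)) c}) :
    ∃ ξ ∈ convexHull ℝ (ι ⁻¹' extremePoints ℝ (OmegaPrime (ι x))), ⇑(ι ξ) =ᵐ[mHalf] X := by
  refine convexHull_min (t := {X : ℝ → ℝ | ∃ ξ ∈ convexHull ℝ
    (ι ⁻¹' extremePoints ℝ (OmegaPrime (ι x))), ⇑(ι ξ) =ᵐ[mHalf] X}) ?_ ?_ hX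
  · rintro X ⟨hXm, hX0, hXPhi⟩
    have hXi : Integrable X mHalf := integrable_of_Phi_zero_lt_top hXm.aestronglyMeasurable (by
      rw [hXPhi 0 le_rfl]; exact Phi_lt_top (integrable_rearrR (hL1 x)) le_rfl)
    have hEN : EN ι X < ∞ := ((EN_le_of_Phi hE hL1 hXi fun c hc => (hXPhi c hc.le).le).trans
      (EN_rearrR hE hL1 x)).trans_lt (enorm_lt_top (x := x))
    obtain ⟨ξ, hξ⟩ := exists_of_EN_lt_top hEN
    refine ⟨ξ, subset_convexHull ℝ _ ?_, hξ⟩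
    refine mem_extremePoints_of_Phi_eq (hL1 x) (hξ.mono fun t ht => ht ▸ hX0 t) (hL1 ξ)
      fun c hc => ?_
    rw [Phi_congr hξ, hXPhi c hc, Phi_rearrR (hL1 x) hc]
  · rintro X ⟨ξ, hξ, hξX⟩ Y ⟨ζ, hζ, hζY⟩ a b ha hb hab
    refine ⟨a • ξ + b • ζ, convex_convexHull ℝ _ hξ hζ ha hb hab, ?_⟩
    rw [map_add, map_smul, map_smul]
    filter_upwards [AEEqFun.coeFn_add (a • ι ξ) (b • ι ζ), AEEqFun.coeFn_smul a (ι ξ),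
      AEEqFun.coeFn_smul b (ι ζ), hξX, hζY] with t h1 h2 h3 h4 h5
    rw [h1, Pi.add_apply, h2, h3]
    simp [h4, h5]

/-- Approximate `y` from below by an average of parts and complete it. The completion must carry
exactly the mass missing from `y`, so it has small integral; being flat as well, it has small norm.
-/
theorem OmegaPrime_subset_QPrime [CompleteSpace E] (hE : IsFullySymmetric ι)
    (hL1 : ∀ z : E, MemL1 (ι z)) (x : E) (hphi : phiFin ι (ι x) = 0) :
    OmegaPrime (ι x) ⊆ QPrime ι (ι x) := by
  intro y hy
  obtain ⟨hy0, hy1, hyPhi, hyPhi0⟩ := (mem_OmegaPrime_iff (hL1 x)).1 hy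
  have hyabs : ∀ᵐ t ∂mHalf, |y t| = y t := hy0.mono fun t ht => abs_of_nonneg ht
  obtain ⟨Y, hY⟩ := exists_of_EN_lt_top (ι := ι) (((EN_le_of_Phi hE hL1 hy1 hyPhi).trans
    (EN_le_of_ae (ae_eq_refl (⇑(ι x))))).trans_lt (enorm_lt_top (x := x)))
  have hYy : ι Y = y := AEEqFun.ext hY
  refine ⟨Y, ?_, hYy⟩
  by_cases hx0 : ∀ t, 0 < t → rearrR (ι x) t = 0
  · -- the trivial case `x = 0`
    refine subset_closure (subset_convexHull ℝ _ ?_)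
    rw [mem_preimage, hYy]
    refine mem_extremePoints_of_Phi_eq (hL1 x) hy0 hy1 fun c hc => ?_
    have h1 : ∀ c, 0 ≤ c → Phi (ι x) c = 0 := fun c hc => by
      rw [← Phi_rearrR (hL1 x) hc, Phi, lintegral_eq_zero_of_ae_eq_zero]
      filter_upwards [ae_pos] with t ht
      rw [hx0 t ht, abs_zero]
      exact ENNReal.ofReal_of_nonpos (by linarith)
    rw [h1 c hc]
    refine le_antisymm ?_ zero_le
    rw [← h1 0 le_rfl, ← hyPhi0]
    exact Phi_antitone _ hc
  push Not at hx0
  obtain ⟨t₀, ht₀, hft₀⟩ := hx0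
  have hone := EN_indicator_one_lt_top hE hL1 x ht₀ (lt_of_le_of_ne (rearrR_nonneg _ _) hft₀.symm)
  have hf := dec_rearrR (hL1 x)
  obtain ⟨K, hK, hKu⟩ := exists_Phi_zero_le_EN hE.toIsSymmetric hL1
  rw [Metric.mem_closure_iff]
  intro ε hε
  have hε4 : 0 < ENNReal.ofReal (ε / 4) := ENNReal.ofReal_pos.2 (by positivity)
  obtain ⟨n₀, δ, hn₀, hδ, hsmall⟩ := exists_EN_le_of_phiFin_eq_zero hE hL1 x hphi hone hε4
  -- The tolerance `δ / K` in `E` becomes `δ` in `L₁` through the bound of the inclusion.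
  obtain ⟨V, hVm, hV, b, hb, hby, hbη⟩ := exists_approx_below hE hL1 x hphi hone hy
    (η := min (ENNReal.ofReal (ε / 4)) (ENNReal.ofReal (δ / K)))
    (lt_min hε4 (ENNReal.ofReal_pos.2 (by positivity)))
  obtain ⟨v, hvm, hv0, hvPhi, hX⟩ := exists_completion hf.measurable hf.nonneg hf.integrable hVm hV hb
    hn₀
  have hbm : Measurable b := measurable_of_mem_convexHull (fun z hz => hz.1.measurable) hb
  have hb0 : ∀ t, 0 ≤ b t := nonneg_of_mem_convexHull (fun z hz => hz.1.nonneg) hb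
  have hym : Measurable fun t => |y t| := y.measurable.norm
  have hd0 : ∀ t, 0 ≤ |y t| - b t := fun t => sub_nonneg.2 (hby t)
  -- Both `b + v` and `|y|` have integral `‖x‖₁`, so `v` and `|y| - b` have equal integrals.
  have hv1 : Phi v 0 ≤ ENNReal.ofReal δ := by
    have h1 : Phi b 0 + Phi v 0 = Phi (ι x) 0 := by
      rw [← Phi_rearrR (hL1 x) le_rfl, ← Phi_zero_of_mem_convexHull hX]
      simp only [Phi, abs_of_nonneg (hb0 _), abs_of_nonneg (hv0 _),
        abs_of_nonneg (add_nonneg (hb0 _) (hv0 _)), sub_zero]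
      rw [← lintegral_add_left hbm.ennreal_ofReal]
      exact lintegral_congr fun t => (ENNReal.ofReal_add (hb0 t) (hv0 t)).symm
    have h2 : Phi b 0 + Phi (fun t => |y t| - b t) 0 = Phi y 0 := by
      simp only [Phi, abs_of_nonneg (hb0 _), abs_of_nonneg (hd0 _), sub_zero]
      rw [← lintegral_add_left hbm.ennreal_ofReal]
      refine lintegral_congr fun t => ?_
      rw [← ENNReal.ofReal_add (hb0 t) (hd0 t), add_sub_cancel]
    have h3 : Phi b 0 ≠ ∞ := ((le_self_add.trans_eq h2).trans_lt (Phi_lt_top hy1 le_rfl)).ne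
    have h4 : Phi v 0 = Phi (fun t => |y t| - b t) 0 :=
      (ENNReal.add_right_inj h3).1 (h1.trans (hyPhi0.symm.trans h2.symm))
    rw [h4]
    calc Phi (fun t => |y t| - b t) 0 ≤ ENNReal.ofReal K * ENNReal.ofReal (δ / K) :=
          (hKu _).trans (mul_le_mul_right (hbη.trans (min_le_right _ _)) _)
      _ = ENNReal.ofReal δ := by rw [← ENNReal.ofReal_mul hK.le, mul_div_cancel₀ _ hK.ne']
  have hvE : EN ι v ≤ ENNReal.ofReal (ε / 4) := hsmall n₀ v le_rfl hvm hv0 hvPhi hv1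
  obtain ⟨ξ, hξ, hξX⟩ := exists_mem_convexHull_extremePoints hE hL1 x hX
  refine ⟨ξ, hξ, ?_⟩
  have hdiff : ⇑(ι (Y - ξ)) =ᵐ[mHalf] fun t => |y t| - (b t + v t) := by
    rw [map_sub, hYy]
    filter_upwards [AEEqFun.coeFn_sub y (ι ξ), hξX, hyabs] with t h1 h2 h3
    rw [h1, Pi.sub_apply, h2, h3]
  have hnorm : ‖Y - ξ‖ₑ ≤ ENNReal.ofReal (ε / 2) := by
    rw [← EN_eq_of_ae hE.injective hdiff]
    calc EN ι (fun t => |y t| - (b t + v t)) ≤ EN ι (fun t => (|y t| - b t) + v t) := by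
          refine EN_mono hE.toIsSymmetric (hym.sub (hbm.add hvm)).aestronglyMeasurable
            (ae_of_all _ fun t => ?_)
          rw [abs_of_nonneg (add_nonneg (hd0 t) (hv0 t)), abs_le]
          constructor <;> linarith [hd0 t, hv0 t]
      _ ≤ ENNReal.ofReal (ε / 4) + ENNReal.ofReal (ε / 4) :=
          (EN_add_le _ _).trans (add_le_add (hbη.trans (min_le_left _ _)) hvE)
      _ = ENNReal.ofReal (ε / 2) := by
          rw [← ENNReal.ofReal_add (by positivity) (by positivity)]
          congr 1; ring
  rw [← ofReal_norm, ENNReal.ofReal_le_ofReal_iff (by positivity)] at hnorm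
  rw [dist_eq_norm]
  linarith

end

end SymmetricSpaces

end

theorem mainTheorem5 {E : Type*} [NormedAddCommGroup E] [NormedSpace ℝ E] [CompleteSpace E]
    (ι : E →ₗ[ℝ] SymmetricSpaces.L0) (hE : SymmetricSpaces.IsFullySymmetric ι)
    (hL1 : ∀ z : E, SymmetricSpaces.MemL1 (ι z)) (x : E) :
    Tendsto (SymmetricSpaces.phiFinQuot ι (ι x)) atTop (𝓝 (SymmetricSpaces.phiFin ι (ι x))) ∧
    SymmetricSpaces.phiFin ι (ι x) < ∞ ∧
    (SymmetricSpaces.OmegaPrime (ι x) = SymmetricSpaces.QPrime ι (ι x) ↔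
      SymmetricSpaces.phiFin ι (ι x) = 0) := by
  obtain ⟨hlim, hfin, -⟩ := SymmetricSpaces.tendsto_phiFinQuot hE hL1 x
  refine ⟨hlim, hfin, SymmetricSpaces.phiFin_eq_zero_of_OmegaPrime_eq hE hL1 x, fun hphi => ?_⟩
  exact subset_antisymm (SymmetricSpaces.OmegaPrime_subset_QPrime hE hL1 x hphi)
    (SymmetricSpaces.QPrime_subset_OmegaPrime hE.toIsSymmetric hL1 x)
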